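/- **Spectral dimension of $SU(2)$ is 3.** Let $G=SU(2)$ with normalized Haar measure, and let $C(G)$ carry the action $(\tau_g a)(x)=a(xg)$ of $G$. This is an ergodic C*-dynamical system; the Haar integral is its invariant state, and its covariant GNS representation is $(\pi,u)$ on $L_2(G)$, where $\pi(a)$ is multiplication by $a\in C(G)$ and $(u_gf)(x)=f(xg)$. Let $A(G)\subseteq C(G)$ be the *-subalgebra generated by the matrix entries of the irreducible unitary representations of $G$, and let $\mathcal A=\{a\in C(G): \tau(a)\in C(G)\otimes_{alg}A(G)\}$, where $\tau(a)$ is the function $g\mapsto\tau_g a$. An equivariant spectral triple is given by a self-adjoint operator $D$ on $L_2(G)$ with compact resolvent such that $[D,\pi(a)]$ is bounded for all $a\in\mathcal A$ and $D$ commutes with every $u_g$. $D$ is $p$-summable ($p>0$) if $(I+D^2)^{-p/2}$ is of trace class. The spectral dimension of $SU(2)$ is the infimum of all $p>0$ for which there is a $p$-summable equivariant spectral triple. A Peter–Weyl basis is an orthonormal basis $e^{(n)}_{ij}=\sqrt{2n+1}\,U^{(n)}_{ij}$ of $L_2(G)$, where $n\in\{0,\tfrac12,1,\dots\}$, $i,j\in\{-n,-n+1,\dots,n\}$,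 and $U^{(n)}$ is a continuous irreducible unitary representation of $G$ on $\mathbb C^{2n+1}$. Let $\alpha(x)=x_{11}$ and $\beta(x)=x_{21}$ be the entries of the first column of $x\in SU(2)$. Then: 1. Every self-adjoint operator $D$ on $L_2(G)$ that commutes with all $u_g$ is diagonal in some Peter–Weyl basis (which may depend on $D$), with $D e^{(n)}_{ij}=d(n,i)\,e^{(n)}_{ij}$ for some real numbers $d(n,i)$. 2. If $D$ is self-adjoint, $D e^{(n)}_{ij}=d(n,i)\,e^{(n)}_{ij}$ for a Peter–Weyl basis, and $[D,\pi(\alpha)]$ and $[D,\pi(\beta)]$ are bounded, then there is a constant $C>0$ (depending on $D$) with $|d(n,i)|\le 2Cn$ for all $n\ge\tfrac12$ and all $i$. 3. If $D$ is self-adjoint, commutes with all $u_g$, and $[D,\pi(\alpha)]$ and $[D,\pi(\beta)]$ are bounded, then $D$ is not $p$-summable for any $0<p\le 3$. 4. For some Peter–Weyl basis, there is an equivariant spectral triple $D$ with $D e^{(n)}_{ij}=n\,e^{(n)}_{ij}$, and it is $p$-summable for every $p>3$. 5. The spectral dimension of $SU(2)$ is $3$. -/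

import Mathlib

open MeasureTheory TopologicalSpace
open scoped ENNReal InnerProductSpace

noncomputable section

/-! ### Unbounded operators on a Hilbert space -/

section Operators

universe u

variable {H : Type u} [NormedAddCommGroup H] [InnerProductSpace ℂ H] [CompleteSpace H]

/-- `R = (D - z)⁻¹` as a bounded everywhere defined operator. -/
def IsResolventAt (D : H →ₗ.[ℂ] H) (z : ℂ) (R : H →L[ℂ] H) : Prop :=
  (∀ y : H, ∃ h : R y ∈ D.domain, D ⟨R y, h⟩ - z • R y = y) ∧
    ∀ x : D.domain, R (D x - z • (x : H)) = x

/-- Some resolvent `(D - z)⁻¹` exists and is compact (equivalently, all resolvents are compact). -/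
def HasCompactResolvent (D : H →ₗ.[ℂ] H) : Prop :=
  ∃ (z : ℂ) (R : H →L[ℂ] H), IsResolventAt D z R ∧ IsCompactOperator R

/-- `[D, S]` is bounded: `S` preserves the domain of `D`, and `D S - S D`, which is densely defined,
is bounded there. -/
def HasBoundedCommutator (D : H →ₗ.[ℂ] H) (S : H →L[ℂ] H) : Prop :=
  ∃ h : ∀ x : D.domain, S (x : H) ∈ D.domain,
    ∃ C : ℝ, ∀ x : D.domain, ‖D ⟨S (x : H), h x⟩ - S (D x)‖ ≤ C * ‖(x : H)‖

/-- The unbounded operator `D` commutes with the unitary operator `u`. -/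
def CommutesWithUnitary (D : H →ₗ.[ℂ] H) (u : H ≃ₗᵢ[ℂ] H) : Prop :=
  ∃ h : ∀ x : D.domain, u (x : H) ∈ D.domain, ∀ x : D.domain, D ⟨u (x : H), h x⟩ = u (D x)

/-- `S` is trace class: `∑ ⟨bᵢ, |S| bᵢ⟩ < ∞` for an orthonormal basis `b`, where `|S| = (S* S)^{1/2}`.
(The sum of these nonnegative numbers does not depend on the basis.) -/
def IsTraceClassOp (S : H →L[ℂ] H) : Prop :=
  ∃ (ι : Type u) (b : HilbertBasis ι ℂ H), Summable fun i => (⟪b i, CFC.abs S (b i)⟫_ℂ).re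

/-- `T = (I + D²)⁻¹` as a bounded everywhere defined operator. -/
def IsInverseOneAddSq (D : H →ₗ.[ℂ] H) (T : H →L[ℂ] H) : Prop :=
  (∀ y : H, ∃ (h₁ : T y ∈ D.domain) (h₂ : D ⟨T y, h₁⟩ ∈ D.domain),
      T y + D ⟨D ⟨T y, h₁⟩, h₂⟩ = y) ∧
    ∀ (x : D.domain) (h : D x ∈ D.domain), T ((x : H) + D ⟨D x, h⟩) = x

/-- `D` is `p`-summable (for `p > 0`): the operator `(I + D²)^{-p/2} = ((I + D²)⁻¹)^{p/2}` is of trace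
class. For self-adjoint `D` the bounded positive operator `(I + D²)⁻¹` exists and is unique, and its
power is taken in the continuous functional calculus. -/
def IsPSummable (D : H →ₗ.[ℂ] H) (p : ℝ) : Prop :=
  ∃ T : H →L[ℂ] H, IsInverseOneAddSq D T ∧ IsTraceClassOp (CFC.rpow T (p / 2))

/-- `(H, π, D)` is a spectral triple for the unital *-algebra `𝒜`. (A compact resolvent of a densely
defined operator forces `H` to be separable.) -/
structure IsSpectralTriple {𝒜 : Type*} [Semiring 𝒜] [Algebra ℂ 𝒜] [Star 𝒜]
    (π : 𝒜 →⋆ₐ[ℂ] (H →L[ℂ] H)) (D : H →ₗ.[ℂ] H) : Prop where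
  selfAdjoint : IsSelfAdjoint D
  compactResolvent : HasCompactResolvent D
  boundedCommutator : ∀ a : 𝒜, HasBoundedCommutator D (π a)

end Operators

/-! ### Ergodic actions of compact groups on C*-algebras -/

section Systems

/-- An ergodic C*-dynamical system `(A, G, τ)` with `G` a compact group, the action `τ : A → A ⊗ C(G)`
being written as the continuous functions `g ↦ τ g a` on `G` with values in `A`. -/
structure ErgodicSystem (G A : Type*) [Group G] [TopologicalSpace G] [CStarAlgebra A] where
  τ : G →* (A ≃⋆ₐ[ℂ] A)
  continuous_τ : ∀ a : A, Continuous fun g => τ g a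
  ergodic : ∀ a : A, (∀ g, τ g a = a) → ∃ c : ℂ, a = algebraMap ℂ A c

/-- The finite-dimensional unitary matrix representation `U` is irreducible. -/
def IsIrreducibleMatrixRep {G : Type*} [Group G] {n : ℕ}
    (U : G →* Matrix.unitaryGroup (Fin n) ℂ) : Prop :=
  0 < n ∧ ∀ W : Submodule ℂ (Fin n → ℂ),
    (∀ g, ∀ v ∈ W, (U g : Matrix (Fin n) (Fin n) ℂ).mulVec v ∈ W) → W = ⊥ ∨ W = ⊤

variable {G : Type*} [Group G] [TopologicalSpace G] [CompactSpace G]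

variable (G) in
/-- `A(G)`: the *-subalgebra of `C(G)` generated by the matrix entries of the continuous irreducible
unitary representations of `G`. -/
def matrixEntryAlgebra : StarSubalgebra ℂ C(G, ℂ) :=
  StarAlgebra.adjoin ℂ {f : C(G, ℂ) | ∃ (n : ℕ) (U : G →* Matrix.unitaryGroup (Fin n) ℂ),
    Continuous U ∧ IsIrreducibleMatrixRep U ∧
      ∃ i j, ∀ g, f g = (U g : Matrix (Fin n) (Fin n) ℂ) i j}

variable {A : Type*} [CStarAlgebra A]

variable (G A) in
/-- The algebraic tensor product `A ⊗ A(G)`, as functions from `G` to `A`. -/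
def algTensor : Submodule ℂ (G → A) :=
  Submodule.span ℂ {F | ∃ c : A, ∃ f ∈ matrixEntryAlgebra G, F = fun g => f g • c}

theorem algTensor_mul {F K : G → A} (hF : F ∈ algTensor G A) (hK : K ∈ algTensor G A) :
    F * K ∈ algTensor G A := by
  unfold algTensor at hF
  induction hF using Submodule.span_induction with
  | zero => simp
  | add x y _ _ hx hy => rw [add_mul]; exact add_mem hx hy
  | smul c x _ hx => rw [smul_mul_assoc]; exact Submodule.smul_mem _ _ hx
  | mem x hx =>
    obtain ⟨c, f, hf, rfl⟩ := hx
    unfold algTensor at hK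
    induction hK using Submodule.span_induction with
    | zero => simp
    | add x y _ _ hx hy => rw [mul_add]; exact add_mem hx hy
    | smul c x _ hx => rw [mul_smul_comm]; exact Submodule.smul_mem _ _ hx
    | mem y hy =>
      obtain ⟨c', f', hf', rfl⟩ := hy
      refine Submodule.subset_span ⟨c * c', f * f', mul_mem hf hf', ?_⟩
      ext g
      simp [smul_smul, mul_comm]

theorem algTensor_star {F : G → A} (hF : F ∈ algTensor G A) : star F ∈ algTensor G A := by
  unfold algTensor at hF
  induction hF using Submodule.span_induction with
  | zero => simp
  | add x y _ _ hx hy => rw [star_add]; exact add_mem hx hy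
  | smul c x _ hx => rw [star_smul]; exact Submodule.smul_mem _ _ hx
  | mem x hx =>
    obtain ⟨c, f, hf, rfl⟩ := hx
    refine Submodule.subset_span ⟨star c, star f, star_mem hf, ?_⟩
    ext g
    simp

/-- The *-subalgebra `𝒜 = {a ∈ A : τ(a) ∈ A ⊗ A(G)}` (algebraic tensor product). -/
def ErgodicSystem.core (S : ErgodicSystem G A) : StarSubalgebra ℂ A where
  carrier := {a | (fun g => S.τ g a) ∈ algTensor G A}
  mul_mem' {a b} ha hb := by
    have := algTensor_mul ha hb
    simpa [Pi.mul_def] using this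
  add_mem' {a b} ha hb := by
    have := (algTensor G A).add_mem ha hb
    simpa [Pi.add_def] using this
  algebraMap_mem' r := by
    refine Submodule.subset_span ⟨algebraMap ℂ A r, 1, one_mem _, ?_⟩
    ext g
    simpa using AlgHomClass.commutes (S.τ g) r
  star_mem' {a} ha := by
    have := algTensor_star ha
    simpa [Pi.star_def, map_star] using this

/-- The covariant GNS representation `(H, π, u)` of an ergodic system on `H`: the GNS representation
of the invariant state `ρ`, with the unitary representation `u` of `G` induced by the action. It is
unique up to unitary equivalence. -/
structure GNSRep (S : ErgodicSystem G A) (H : Type*) [NormedAddCommGroup H]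
    [InnerProductSpace ℂ H] [CompleteSpace H] where
  ρ : A →ₗ[ℂ] ℂ
  ρ_one : ρ 1 = 1
  ρ_nonneg : ∀ a, ∃ r : ℝ, 0 ≤ r ∧ ρ (star a * a) = r
  ρ_invariant : ∀ g a, ρ (S.τ g a) = ρ a
  η : A →ₗ[ℂ] H
  η_dense : DenseRange η
  η_inner : ∀ a b, ⟪η a, η b⟫_ℂ = ρ (star a * b)
  π : A →⋆ₐ[ℂ] (H →L[ℂ] H)
  π_η : ∀ a b, π a (η b) = η (a * b)
  u : G →* (H ≃ₗᵢ[ℂ] H)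
  u_η : ∀ g a, u g (η a) = η (S.τ g a)

namespace GNSRep

variable {S : ErgodicSystem G A} {H : Type*} [NormedAddCommGroup H] [InnerProductSpace ℂ H]
  [CompleteSpace H]

/-- `D` is equivariant with respect to `(π, u)`. -/
def IsEquivariant (R : GNSRep S H) (D : H →ₗ.[ℂ] H) : Prop :=
  ∀ g : G, CommutesWithUnitary D (R.u g)

/-- `(H, π, D)` belongs to the class of equivariant spectral triples for `𝒜`. -/
def IsEquivariantSpectralTriple (R : GNSRep S H) (D : H →ₗ.[ℂ] H) : Prop :=
  IsSpectralTriple (R.π.comp S.core.subtype) D ∧ R.IsEquivariant D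

/-- The spectral dimension: the infimum of all `p > 0` such that some equivariant spectral triple for
`𝒜` is `p`-summable (and `∞` if there is no such `p`). -/
def spectralDimension (R : GNSRep S H) : ℝ≥0∞ :=
  ⨅ (p : ℝ) (_ : 0 < p ∧ ∃ D : H →ₗ.[ℂ] H, R.IsEquivariantSpectralTriple D ∧ IsPSummable D p),
    ENNReal.ofReal p

end GNSRep

end Systems

/-! ### A compact group acting on itself -/

section Translation

set_option linter.unusedSectionVars false

variable (G : Type*) [Group G] [TopologicalSpace G] [IsTopologicalGroup G] [CompactSpace G]

/-- Right translation `(τ g a)(x) = a (x g)` on `C(G)`, that is, the comultiplication `Δ`. -/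
def rightTranslation : G →* (C(G, ℂ) ≃⋆ₐ[ℂ] C(G, ℂ)) where
  toFun g := StarAlgEquiv.ofStarAlgHom
    (ContinuousMap.compStarAlgHom' ℂ ℂ ⟨fun x : G => x * g, continuous_mul_const g⟩)
    (ContinuousMap.compStarAlgHom' ℂ ℂ ⟨fun x : G => x * g⁻¹, continuous_mul_const g⁻¹⟩)
    (by ext a x; simp) (by ext a x; simp)
  map_one' := by ext a x; simp
  map_mul' g h := by ext a x; simp [mul_assoc]

theorem rightTranslation_apply (g : G) (a : C(G, ℂ)) (x : G) :
    rightTranslation G g a x = a (x * g) := rfl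

/-- The system `(C(G), G, Δ)`: the compact group `G` acting on itself. -/
def translationSystem : ErgodicSystem G C(G, ℂ) where
  τ := rightTranslation G
  continuous_τ a := by
    have : Continuous fun p : G × G => a (p.2 * p.1) := by fun_prop
    exact (ContinuousMap.curry ⟨_, this⟩).continuous
  ergodic a ha := by
    refine ⟨a 1, ?_⟩
    ext x
    have := congrArg (fun f : C(G, ℂ) => f 1) (ha x)
    simpa [rightTranslation_apply] using this

variable [MeasurableSpace G] [BorelSpace G]

/-- The normalized Haar measure of a compact group. -/
def normHaar : Measure G := Measure.haarMeasure (⊤ : PositiveCompacts G)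

instance : (normHaar G).IsHaarMeasure := by unfold normHaar; infer_instance

instance : IsProbabilityMeasure (normHaar G) :=
  ⟨by simpa [normHaar] using Measure.haarMeasure_self (K₀ := (⊤ : PositiveCompacts G))⟩

variable {G} in
theorem measurePreserving_mul_right_normHaar (g : G) :
    MeasurePreserving (fun x : G => x * g) (normHaar G) (normHaar G) := by
  refine ⟨measurable_mul_const g, ?_⟩
  have : IsProbabilityMeasure (Measure.map (fun x : G => x * g) (normHaar G)) :=
    Measure.isProbabilityMeasure_map (measurable_mul_const g).aemeasurable
  exact Measure.isHaarMeasure_eq_of_isProbabilityMeasure _ _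

/-- `L₂(G)`. -/
abbrev L2 : Type _ := Lp ℂ 2 (normHaar G)

variable {G}

theorem memLp_mul (a : C(G, ℂ)) (f : L2 G) :
    MemLp (fun x => a x * f x) 2 (normHaar G) := by
  refine (Lp.memLp f).of_le_mul (c := ‖a‖) ?_ ?_
  · exact a.continuous.aestronglyMeasurable.mul (Lp.aestronglyMeasurable f)
  · filter_upwards with x
    rw [norm_mul]
    gcongr
    exact a.norm_coe_le_norm x

/-- The operator of multiplication by `a ∈ C(G)` on `L₂(G)`. -/
def mulOp (a : C(G, ℂ)) : L2 G →L[ℂ] L2 G :=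
  LinearMap.mkContinuous
    { toFun := fun f => (memLp_mul a f).toLp _
      map_add' := fun f g => by
        ext1
        filter_upwards [(memLp_mul a (f + g)).coeFn_toLp, (memLp_mul a f).coeFn_toLp,
          (memLp_mul a g).coeFn_toLp, Lp.coeFn_add f g,
          Lp.coeFn_add ((memLp_mul a f).toLp _) ((memLp_mul a g).toLp _)] with x h1 h2 h3 h4 h5
        rw [h1, h5, Pi.add_apply, h2, h3, h4, Pi.add_apply, mul_add]
      map_smul' := fun c f => by
        ext1
        filter_upwards [(memLp_mul a (c • f)).coeFn_toLp, (memLp_mul a f).coeFn_toLp,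
          Lp.coeFn_smul c f, Lp.coeFn_smul c ((memLp_mul a f).toLp _)] with x h1 h2 h3 h4
        rw [h1, h3, RingHom.id_apply, h4, Pi.smul_apply, Pi.smul_apply, h2, smul_eq_mul,
          smul_eq_mul, mul_left_comm] }
    ‖a‖ (fun f => by
      refine Lp.norm_le_mul_norm_of_ae_le_mul ?_
      filter_upwards [(memLp_mul a f).coeFn_toLp] with x h
      simp only [LinearMap.coe_mk, AddHom.coe_mk]
      rw [h, norm_mul]
      gcongr
      exact a.norm_coe_le_norm x)

theorem coeFn_mulOp (a : C(G, ℂ)) (f : L2 G) :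
    mulOp a f =ᵐ[normHaar G] fun x => a x * f x :=
  (memLp_mul a f).coeFn_toLp

variable (G) in
/-- The representation of `C(G)` on `L₂(G)` by multiplication operators. -/
def mulRep : C(G, ℂ) →⋆ₐ[ℂ] (L2 G →L[ℂ] L2 G) where
  toFun := mulOp
  map_one' := by
    ext f
    filter_upwards [coeFn_mulOp 1 f] with x h
    simp [h]
  map_mul' a b := by
    ext f
    filter_upwards [coeFn_mulOp (a * b) f, coeFn_mulOp a (mulOp b f), coeFn_mulOp b f]
      with x h1 h2 h3
    rw [mul_apply_eq_comp, h1, h2, h3, ContinuousMap.mul_apply, mul_assoc]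
  map_zero' := by
    ext f
    filter_upwards [coeFn_mulOp 0 f, Lp.coeFn_zero ℂ 2 (normHaar G)] with x h h'
    have h0 : (0 : L2 G →L[ℂ] L2 G) f = 0 := rfl
    rw [h, h0, h', ContinuousMap.zero_apply, zero_mul, Pi.zero_apply]
  map_add' a b := by
    ext f
    filter_upwards [coeFn_mulOp (a + b) f, coeFn_mulOp a f, coeFn_mulOp b f,
      Lp.coeFn_add (mulOp a f) (mulOp b f)] with x h1 h2 h3 h4
    rw [add_apply, h1, h4, Pi.add_apply, h2, h3, ContinuousMap.add_apply,
      add_mul]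
  commutes' c := by
    ext f
    rw [Algebra.algebraMap_eq_smul_one (A := L2 G →L[ℂ] L2 G)]
    filter_upwards [coeFn_mulOp (algebraMap ℂ C(G, ℂ) c) f, Lp.coeFn_smul c f] with x h1 h2
    rw [h1]
    simp [h2]
  map_star' a := by
    rw [ContinuousLinearMap.star_eq_adjoint, ContinuousLinearMap.eq_adjoint_iff]
    intro f g
    rw [L2.inner_def, L2.inner_def]
    refine integral_congr_ae ?_
    filter_upwards [coeFn_mulOp (star a) f, coeFn_mulOp a g] with x h1 h2
    rw [h1, h2]
    simp [mul_comm, mul_assoc]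

/-- The isometry `f ↦ f (· g)` of `L₂(G)`. -/
def translationIsometry (g : G) : L2 G →ₗᵢ[ℂ] L2 G :=
  Lp.compMeasurePreservingₗᵢ ℂ (fun x : G => x * g) (measurePreserving_mul_right_normHaar g)

theorem coeFn_translationIsometry (g : G) (f : L2 G) :
    translationIsometry g f =ᵐ[normHaar G] fun x => f (x * g) :=
  Lp.coeFn_compMeasurePreserving f (measurePreserving_mul_right_normHaar g)

theorem translationIsometry_mul (g h : G) (f : L2 G) :
    translationIsometry (g * h) f = translationIsometry g (translationIsometry h f) := by
  ext1
  filter_upwards [coeFn_translationIsometry (g * h) f,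
    coeFn_translationIsometry g (translationIsometry h f),
    (measurePreserving_mul_right_normHaar g).quasiMeasurePreserving.ae
      (coeFn_translationIsometry h f)] with x h1 h2 h3
  rw [h1, h2, h3, mul_assoc]

theorem translationIsometry_one (f : L2 G) : translationIsometry (1 : G) f = f := by
  ext1
  filter_upwards [coeFn_translationIsometry (1 : G) f] with x h1
  rw [h1, mul_one]

variable (G) in
/-- The unitary representation of `G` on `L₂(G)` by right translations `(u g f)(x) = f (x g)`. -/
def rightRegularRep : G →* (L2 G ≃ₗᵢ[ℂ] L2 G) where
  toFun g :=
    { (translationIsometry g : L2 G →ₗᵢ[ℂ] L2 G) with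
      invFun := translationIsometry g⁻¹
      left_inv := fun f => by
        change translationIsometry g⁻¹ (translationIsometry g f) = f
        rw [← translationIsometry_mul, inv_mul_cancel, translationIsometry_one]
      right_inv := fun f => by
        change translationIsometry g (translationIsometry g⁻¹ f) = f
        rw [← translationIsometry_mul, mul_inv_cancel, translationIsometry_one] }
  map_one' := LinearIsometryEquiv.ext translationIsometry_one
  map_mul' g h := LinearIsometryEquiv.ext (translationIsometry_mul g h)

theorem coeFn_rightRegularRep (g : G) (f : L2 G) :
    rightRegularRep G g f =ᵐ[normHaar G] fun x => f (x * g) :=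
  coeFn_translationIsometry g f

theorem integrable_normHaar (a : C(G, ℂ)) : Integrable a (normHaar G) :=
  a.continuous.integrable_of_hasCompactSupport (HasCompactSupport.of_compactSpace a)

variable (G) in
/-- The covariant GNS representation of `(C(G), G, Δ)` for the Haar state, realized on `L₂(G)`. -/
def haarGNS : GNSRep (translationSystem G) (L2 G) where
  ρ :=
    { toFun := fun a => ∫ x, a x ∂(normHaar G)
      map_add' := fun a b => integral_add (integrable_normHaar a) (integrable_normHaar b)
      map_smul' := fun c a => integral_const_mul c a }
  ρ_one := by simp
  ρ_nonneg a := by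
    refine ⟨∫ x, ‖a x‖ ^ 2 ∂(normHaar G), integral_nonneg fun x => by positivity, ?_⟩
    simp only [LinearMap.coe_mk, AddHom.coe_mk]
    rw [← integral_complex_ofReal]
    refine integral_congr_ae (Filter.Eventually.of_forall fun x => ?_)
    simp [Complex.conj_mul']
  ρ_invariant g a := by
    have : Measure.IsMulRightInvariant (normHaar G) :=
      ⟨fun g => (measurePreserving_mul_right_normHaar g).map_eq⟩
    exact integral_mul_right_eq_self (μ := normHaar G) a g
  η := (ContinuousMap.toLp 2 (normHaar G) ℂ : C(G, ℂ) →L[ℂ] L2 G)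
  η_dense := ContinuousMap.toLp_denseRange ℂ (normHaar G) ℂ (by norm_num)
  η_inner a b := by
    refine (ContinuousMap.inner_toLp (normHaar G) a b).trans ?_
    refine integral_congr_ae (Filter.Eventually.of_forall fun x => ?_)
    simp [mul_comm]
  π := mulRep G
  π_η a b := by
    ext1
    filter_upwards [coeFn_mulOp a (ContinuousMap.toLp 2 (normHaar G) ℂ b),
      ContinuousMap.coeFn_toLp (𝕜 := ℂ) (p := 2) (normHaar G) b,
      ContinuousMap.coeFn_toLp (𝕜 := ℂ) (p := 2) (normHaar G) (a * b)] with x h1 h2 h3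
    refine h1.trans (Eq.trans ?_ h3.symm)
    rw [h2, ContinuousMap.mul_apply]
  u := rightRegularRep G
  u_η g a := by
    ext1
    filter_upwards [coeFn_rightRegularRep g (ContinuousMap.toLp 2 (normHaar G) ℂ a),
      (measurePreserving_mul_right_normHaar g).quasiMeasurePreserving.ae
        (ContinuousMap.coeFn_toLp (𝕜 := ℂ) (p := 2) (normHaar G) a),
      ContinuousMap.coeFn_toLp (𝕜 := ℂ) (p := 2) (normHaar G) (rightTranslation G g a)]
      with x h1 h2 h3
    refine h1.trans (Eq.trans ?_ h3.symm)
    rw [h2, rightTranslation_apply]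

end Translation

/-! ### The group `SU(2)` -/

section SU2

/-- The compact group `SU(2)`. -/
abbrev SU2 : Type := Matrix.specialUnitaryGroup (Fin 2) ℂ

instance : IsTopologicalGroup SU2 where
  continuous_inv := by
    refine Continuous.subtype_mk ?_ _
    exact continuous_star.comp continuous_subtype_val

instance : CompactSpace SU2 := by
  suffices key : IsCompact (Matrix.specialUnitaryGroup (Fin 2) ℂ : Set (Matrix (Fin 2) (Fin 2) ℂ)) from
    isCompact_iff_compactSpace.mp key
  refine ((isCompact_closedBall (0 : ℂ) 1).matrix
    (m := Fin 2) (n := Fin 2)).of_isClosed_subset ?_ ?_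
  · have h : (Matrix.specialUnitaryGroup (Fin 2) ℂ : Set (Matrix (Fin 2) (Fin 2) ℂ)) =
        {x | x * star x = 1} ∩ {x | x.det = 1} := by
      ext x
      simp [Matrix.mem_specialUnitaryGroup_iff, Matrix.mem_unitaryGroup_iff]
    rw [h]
    exact (isClosed_eq (by fun_prop) (by fun_prop)).inter (isClosed_eq (by fun_prop) (by fun_prop))
  · intro x hx i j
    simpa using entry_norm_bound_of_unitary (Matrix.mem_specialUnitaryGroup_iff.mp hx).1 i j

instance : MeasurableSpace SU2 := borel SU2

instance : BorelSpace SU2 := ⟨rfl⟩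

/-- The matrix entry `α(x) = x₁₁` on `SU(2)`. -/
def entryAlpha : C(SU2, ℂ) :=
  ⟨fun x => (x : Matrix (Fin 2) (Fin 2) ℂ) 0 0,
    (continuous_apply_apply 0 0).comp continuous_subtype_val⟩

/-- The matrix entry `β(x) = x₂₁` on `SU(2)`. -/
def entryBeta : C(SU2, ℂ) :=
  ⟨fun x => (x : Matrix (Fin 2) (Fin 2) ℂ) 1 0,
    (continuous_apply_apply 1 0).comp continuous_subtype_val⟩

/-- An orthonormal basis `e^{(n)}_{ij}` of `L₂(SU(2))`, `n = m / 2` with `m ∈ ℕ`, consisting of the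
normalized matrix entries `√(2n+1) U^{(n)}_{ij}` of continuous irreducible unitary representations
`U^{(n)}` of dimension `2n + 1`; the indices `i, j` run over `2n + 1` values. -/
structure PeterWeylBasis where
  U : ∀ m : ℕ, SU2 →* Matrix.unitaryGroup (Fin (m + 1)) ℂ
  continuous_U : ∀ m, Continuous (U m)
  irreducible_U : ∀ m, IsIrreducibleMatrixRep (U m)
  e : HilbertBasis (Σ m : ℕ, Fin (m + 1) × Fin (m + 1)) ℂ (L2 SU2)
  e_eq : ∀ (m : ℕ) (i j : Fin (m + 1)), e ⟨m, (i, j)⟩ =ᵐ[normHaar SU2]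
    fun x => (Real.sqrt (m + 1) : ℂ) * (U m x : Matrix (Fin (m + 1)) (Fin (m + 1)) ℂ) i j

/-- `D e^{(n)}_{ij} = d(n, i) e^{(n)}_{ij}` for all `n = m / 2` and all `i, j`; here `d m i` stands for
`d(n, i)`. -/
def PeterWeylBasis.IsDiagonal (B : PeterWeylBasis) (D : L2 SU2 →ₗ.[ℂ] L2 SU2)
    (d : ∀ m : ℕ, Fin (m + 1) → ℝ) : Prop :=
  ∀ (m : ℕ) (i j : Fin (m + 1)), ∃ h : B.e ⟨m, (i, j)⟩ ∈ D.domain,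
    D ⟨B.e ⟨m, (i, j)⟩, h⟩ = (d m i : ℂ) • B.e ⟨m, (i, j)⟩

end SU2

end

noncomputable section

/-! ### Symmetric powers of the fundamental representation -/

section SymmetricPowers

open Polynomial

/-! The exponent 3 comes from a count: level `m` of a Peter–Weyl basis contains `(m + 1) ^ 2`
vectors, so eigenvalues of size comparable to `m` give the series `∑ (m + 1) ^ (2 - p)`, which
converges exactly for `p > 3`. It remains to see that linear growth is the most that bounded
commutators allow, and that it is attained.

Diagonality: averaging right translations against conjugate matrix coefficients produces matrix
units on the column index (`PeterWeylBasis.exists_matrixUnit`). An equivariant self-adjoint `D`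
commutes with them, hence acts on each level by one Hermitian matrix on the row index
(`IsSelfAdjoint.exists_rowMatrix`). Conjugating the representation by a diagonalizing unitary gives
the adapted basis.

Upper bound on growth: let `P m` be the homogeneous polynomials of degree `m` in `α, β`, that is,
column 0 of the symmetric power. An intertwiner between an arbitrary irreducible representation and
the symmetric power shows that `P m` has an orthonormal basis with one vector from each row, so
consisting of eigenvectors of `D` (`PeterWeylBasis.exists_columnBasis`). Multiplication by `α` and
`β` takes `P m` to `P (m + 1)`, and for a unit vector of `P (m + 1)` the squared inner products with
the images of such a basis add up to `(m + 1) / (m + 2) ≥ 1 / 2` (`sum_inner_alpha_beta`). A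
commutator multiplies these inner products by differences of eigenvalues
(`HasBoundedCommutator.sum_sq_le`), so every eigenvalue at level `m + 1` lies within a fixed
distance of one at level `m`. Induction on `m` gives the linear bound.

Attainment: multiplication by an entry of the fundamental representation shifts the level by exactly
one (`entry_mul_mem_neighbourSpan`), so its commutator with half the level is bounded. The Leibniz
rule extends this to the algebra generated by the entries, which contains the whole core.

The representation theory is built from explicit symmetric powers. Their coefficients span a dense
subspace by Stone–Weierstrass, and Schur orthogonality then leaves no room for other irreducible
representations (`exists_equiv_symRep`). -/

theorem Polynomial.homogenize_pow {R : Type*} [CommSemiring R] (p : R[X]) {n : ℕ}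
    (hp : p.natDegree ≤ n) (a : ℕ) : homogenize (p ^ a) (a * n) = homogenize p n ^ a := by
  have := homogenize_finsetProd (s := Finset.range a) (p := fun _ => p) (n := fun _ => n)
    (fun _ _ => hp)
  simpa using this

/-- The image of the monomial `X₀^(m-j) X₁^j` under the linear substitution given by the columns of
`g`, dehomogenized. -/
def symPoly (g : Matrix (Fin 2) (Fin 2) ℂ) (m j : ℕ) : ℂ[X] :=
  (C (g 0 0) + C (g 1 0) * X) ^ (m - j) * (C (g 0 1) + C (g 1 1) * X) ^ j

theorem natDegree_linear_le (a b : ℂ) : (C a + C b * X).natDegree ≤ 1 := by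
  compute_degree

theorem natDegree_symPoly_le (g : Matrix (Fin 2) (Fin 2) ℂ) {m j : ℕ} (hj : j ≤ m) :
    (symPoly g m j).natDegree ≤ m := by
  refine natDegree_mul_le.trans ?_
  have h1 := natDegree_pow_le_of_le (m - j) (natDegree_linear_le (g 0 0) (g 1 0))
  have h2 := natDegree_pow_le_of_le j (natDegree_linear_le (g 0 1) (g 1 1))
  omega

/-- The matrix entries of the `m`-th symmetric power of `g` in the monomial basis. -/
def symEntry (g : Matrix (Fin 2) (Fin 2) ℂ) (m i j : ℕ) : ℂ := (symPoly g m j).coeff i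

theorem symEntry_eq_zero (g : Matrix (Fin 2) (Fin 2) ℂ) {m i j : ℕ} (hj : j ≤ m) (hi : m < i) :
    symEntry g m i j = 0 :=
  coeff_eq_zero_of_natDegree_lt ((natDegree_symPoly_le g hj).trans_lt hi)

theorem homogenize_linear (a b : ℂ) :
    homogenize (C a + C b * X) 1 =
      MvPolynomial.C a * MvPolynomial.X 1 + MvPolynomial.C b * MvPolynomial.X 0 := by
  rw [homogenize_add, homogenize_C_mul, homogenize_C, homogenize_X one_ne_zero]
  simp

/-- Homogenizing makes substitution multiplicative: `X` becomes `B / A` with denominators cleared in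
degree `m`, in any commutative algebra. -/
theorem aeval_homogenize_eq_sum {S : Type*} [CommSemiring S] [Algebra ℂ S] (p : ℂ[X]) (m : ℕ)
    (A B : S) :
    MvPolynomial.aeval ![B, A] (homogenize p m) =
      ∑ k ∈ Finset.range (m + 1), p.coeff k • (A ^ (m - k) * B ^ k) := by
  rw [homogenize, map_sum, Finset.Nat.sum_antidiagonal_eq_sum_range_succ_mk]
  refine Finset.sum_congr rfl fun k _ => ?_
  rw [MvPolynomial.aeval_monomial, Finsupp.prod_fintype _ _ (by simp)]
  simp [Algebra.smul_def, mul_comm]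

/-- The algebra `S` is left free because two cases are needed: `ℂ[X]` gives multiplicativity in `g`,
and `ℂ` gives the generating function of the entries. -/
theorem sum_symEntry_smul {S : Type*} [CommSemiring S] [Algebra ℂ S]
    (g : Matrix (Fin 2) (Fin 2) ℂ) {m j : ℕ} (hj : j ≤ m) (A B : S) :
    ∑ k ∈ Finset.range (m + 1), symEntry g m k j • (A ^ (m - k) * B ^ k) =
      (g 0 0 • A + g 1 0 • B) ^ (m - j) * (g 0 1 • A + g 1 1 • B) ^ j := by
  unfold symEntry
  rw [← aeval_homogenize_eq_sum, symPoly]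
  have h1 := homogenize_pow (C (g 0 0) + C (g 1 0) * X) (natDegree_linear_le _ _) (m - j)
  have h2 := homogenize_pow (C (g 0 1) + C (g 1 1) * X) (natDegree_linear_le _ _) j
  have h3 := homogenize_mul (m := (m - j) * 1) (n := j * 1) _ _
    (natDegree_pow_le_of_le (m - j) (natDegree_linear_le (g 0 0) (g 1 0)) |>.trans (by simp))
    (natDegree_pow_le_of_le j (natDegree_linear_le (g 0 1) (g 1 1)) |>.trans (by simp))
  rw [h1, h2, homogenize_linear, homogenize_linear, show (m - j) * 1 + j * 1 = m by omega] at h3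
  rw [h3]
  simp [Algebra.smul_def]

theorem symEntry_mul (g h : Matrix (Fin 2) (Fin 2) ℂ) {m i j : ℕ} (hj : j ≤ m) :
    symEntry (g * h) m i j =
      ∑ k ∈ Finset.range (m + 1), symEntry g m i k * symEntry h m k j := by
  have h1 := sum_symEntry_smul h hj (C (g 0 0) + C (g 1 0) * X) (C (g 0 1) + C (g 1 1) * X)
  have h2 : symPoly (g * h) m j = ∑ k ∈ Finset.range (m + 1), symEntry h m k j • symPoly g m k := by
    unfold symPoly
    rw [h1]
    congr 2 <;>
    · simp only [Matrix.mul_apply, Fin.sum_univ_two, C_add, C_mul, smul_eq_C_mul]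
      ring
  rw [symEntry, h2, finsetSum_coeff]
  refine Finset.sum_congr rfl fun k _ => ?_
  rw [coeff_smul, smul_eq_mul, mul_comm, symEntry, symEntry]

theorem symEntry_diagonal (a b : ℂ) (m i j : ℕ) :
    symEntry !![a, 0; 0, b] m i j = if i = j then a ^ (m - j) * b ^ j else 0 := by
  have h : symPoly !![a, 0; 0, b] m j = C (a ^ (m - j) * b ^ j) * X ^ j := by
    simp [symPoly, mul_pow, mul_assoc]
  rw [symEntry, h, coeff_C_mul, coeff_X_pow]
  simp

theorem symEntry_one (m i j : ℕ) : symEntry 1 m i j = if i = j then 1 else 0 := by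
  rw [Matrix.one_fin_two, symEntry_diagonal]
  simp

theorem symEntry_map_conj (g : Matrix (Fin 2) (Fin 2) ℂ) (m i j : ℕ) :
    symEntry (g.map (starRingEnd ℂ)) m i j = starRingEnd ℂ (symEntry g m i j) := by
  simp only [symEntry, ← coeff_map]
  congr 1
  simp [symPoly, Polynomial.map_mul]

theorem eq_zero_of_forall_sum_mul_pow {n : ℕ} {a : ℕ → ℂ}
    (h : ∀ z : ℂ, ∑ i ∈ Finset.range n, a i * z ^ i = 0) {i : ℕ} (hi : i < n) : a i = 0 := by
  have h1 : ∑ i ∈ Finset.range n, C (a i) * X ^ i = (0 : ℂ[X]) :=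
    Polynomial.funext fun z => by simpa [eval_finsetSum] using h z
  have h2 := congrArg (fun p => coeff p i) h1
  simpa [finsetSum_coeff, coeff_X_pow, hi] using h2

/-- Binomial expansion of the `m`-th power of a bilinear form in `(1, x)` and `(1, y)`. The closed
form is unchanged when `g` is transposed and `x`, `y` are exchanged, which is the source of
unitarity below. -/
theorem sum_choose_symEntry (g : Matrix (Fin 2) (Fin 2) ℂ) (m : ℕ) (x y : ℂ) :
    ∑ i ∈ Finset.range (m + 1), (∑ j ∈ Finset.range (m + 1),
      (m.choose j : ℂ) * symEntry g m i j * y ^ j) * x ^ i =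
      (g 0 0 + g 1 0 * x + g 0 1 * y + g 1 1 * x * y) ^ m := by
  have h1 : ∀ j ∈ Finset.range (m + 1), ∑ i ∈ Finset.range (m + 1),
      symEntry g m i j * x ^ i = (g 0 0 + g 1 0 * x) ^ (m - j) * (g 0 1 + g 1 1 * x) ^ j := by
    intro j hj
    simpa using sum_symEntry_smul g (Nat.lt_succ_iff.mp (Finset.mem_range.mp hj)) (1 : ℂ) x
  have h2 : g 0 0 + g 1 0 * x + g 0 1 * y + g 1 1 * x * y =
      (g 0 1 + g 1 1 * x) * y + (g 0 0 + g 1 0 * x) := by ring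
  rw [h2, add_pow]
  simp_rw [Finset.sum_mul]
  rw [Finset.sum_comm]
  refine Finset.sum_congr rfl fun j hj => ?_
  calc _ = m.choose j * y ^ j * ∑ i ∈ Finset.range (m + 1), symEntry g m i j * x ^ i := by
        rw [Finset.mul_sum]
        exact Finset.sum_congr rfl fun i _ => by ring
    _ = _ := by rw [h1 j hj, mul_pow]; ring

theorem choose_mul_symEntry_transpose (g : Matrix (Fin 2) (Fin 2) ℂ) {m i j : ℕ} (hi : i ≤ m)
    (hj : j ≤ m) :
    (m.choose j : ℂ) * symEntry g.transpose m i j = (m.choose i : ℂ) * symEntry g m j i := by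
  have key : ∀ x y : ℂ, ∑ i ∈ Finset.range (m + 1), (∑ j ∈ Finset.range (m + 1),
      ((m.choose j : ℂ) * symEntry g.transpose m i j - (m.choose i : ℂ) * symEntry g m j i) *
        y ^ j) * x ^ i = 0 := by
    intro x y
    have h1 := sum_choose_symEntry g.transpose m x y
    have h2 := sum_choose_symEntry g m y x
    have h3 : (g.transpose 0 0 + g.transpose 1 0 * x + g.transpose 0 1 * y +
        g.transpose 1 1 * x * y) ^ m =
        (g 0 0 + g 1 0 * y + g 0 1 * x + g 1 1 * y * x) ^ m := by
      simp only [Matrix.transpose_apply]; ring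
    rw [h3, ← h2] at h1
    rw [← sub_eq_zero] at h1
    rw [← h1]
    simp_rw [Finset.sum_mul]
    conv_rhs => rw [Finset.sum_comm (s := Finset.range (m + 1)), ]
    rw [Finset.sum_comm, ← Finset.sum_sub_distrib]
    refine Finset.sum_congr rfl fun j _ => ?_
    rw [← Finset.sum_sub_distrib]
    exact Finset.sum_congr rfl fun i _ => by ring
  have h1 := fun y => eq_zero_of_forall_sum_mul_pow (fun x => key x y) (Nat.lt_succ_of_le hi)
  exact sub_eq_zero.mp (eq_zero_of_forall_sum_mul_pow h1 (Nat.lt_succ_of_le hj))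

/-- Expresses multiplication by a first-row entry through degree `m + 1` and a second-row entry, so
that only the second row needs the determinant. -/
theorem mul_symPoly_zero_zero (g : Matrix (Fin 2) (Fin 2) ℂ) {m j : ℕ} (hj : j ≤ m) :
    C (g 0 0) * symPoly g m j = symPoly g (m + 1) j - X * (C (g 1 0) * symPoly g m j) := by
  simp only [symPoly, show m + 1 - j = (m - j) + 1 by omega, pow_succ]
  ring

theorem mul_symPoly_zero_one (g : Matrix (Fin 2) (Fin 2) ℂ) {m j : ℕ} (hj : j ≤ m) :
    C (g 0 1) * symPoly g m j =
      symPoly g (m + 1) (j + 1) - X * (C (g 1 1) * symPoly g m j) := by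
  simp only [symPoly, show m + 1 - (j + 1) = m - j by omega, pow_succ]
  ring

/-- A Clebsch–Gordan rule. With `L₀`, `L₁` the two linear factors, the product rule for the degree
`m + 1` polynomial leaves a multiple of `g 1 1 * L₀`, and `det g = 1` reads `g 1 1 * L₀ - g 1 0 * L₁
= 1`. The truncated `m - 1` and `j - 1` are harmless: the factor `j` vanishes there. -/
theorem mul_symPoly_one_zero (g : Matrix (Fin 2) (Fin 2) ℂ) (hg : g.det = 1) {m j : ℕ}
    (hj : j ≤ m) :
    C ((m : ℂ) + 1) * (C (g 1 0) * symPoly g m j) =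
      derivative (symPoly g (m + 1) j) - C (j : ℂ) * symPoly g (m - 1) (j - 1) := by
  have hd : C (g 0 0) * C (g 1 1) - C (g 0 1) * C (g 1 0) = (1 : ℂ[X]) := by
    rw [← C_mul, ← C_mul, ← C_sub, ← Matrix.det_fin_two, hg, C_1]
  obtain ⟨a, rfl⟩ := Nat.exists_eq_add_of_le hj
  rcases j with _ | b
  · simp only [symPoly]
    simp [derivative_pow]
    ring
  · simp only [symPoly, show b + 1 + a + 1 - (b + 1) = a + 1 by omega,
      show b + 1 + a - (b + 1) = a by omega,
      Nat.add_sub_cancel]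
    simp [derivative_pow, derivative_mul]
    linear_combination -((b : ℂ[X]) + 1) * (C (g 0 0) + C (g 1 0) * X) ^ a *
      (C (g 0 1) + C (g 1 1) * X) ^ b * hd

theorem mul_symPoly_one_one (g : Matrix (Fin 2) (Fin 2) ℂ) (hg : g.det = 1) {m j : ℕ}
    (hj : j ≤ m) :
    C ((m : ℂ) + 1) * (C (g 1 1) * symPoly g m j) =
      derivative (symPoly g (m + 1) (j + 1)) + C ((m : ℂ) - j) * symPoly g (m - 1) j := by
  have hd : C (g 0 0) * C (g 1 1) - C (g 0 1) * C (g 1 0) = (1 : ℂ[X]) := by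
    rw [← C_mul, ← C_mul, ← C_sub, ← Matrix.det_fin_two, hg, C_1]
  obtain ⟨a, rfl⟩ := Nat.exists_eq_add_of_le hj
  rcases a with _ | a
  · simp only [symPoly]
    simp [derivative_pow]
    ring
  · simp only [symPoly, show j + (a + 1) + 1 - (j + 1) = a + 1 by omega,
      show j + (a + 1) - j = a + 1 by omega, show j + (a + 1) - 1 - j = a by omega]
    simp [derivative_pow, derivative_mul]
    linear_combination ((a : ℂ[X]) + 1) * (C (g 0 0) + C (g 1 0) * X) ^ a *
      (C (g 0 1) + C (g 1 1) * X) ^ j * hd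

end SymmetricPowers

/-! ### Unitarity and irreducibility of the symmetric powers. -/

section SymmetricPowerRep

/-- The square roots of the binomial coefficients, which normalize the monomial basis. -/
def sqrtChoose (m i : ℕ) : ℂ := (Real.sqrt (m.choose i) : ℂ)

theorem sqrtChoose_ne_zero {m i : ℕ} (hi : i ≤ m) : sqrtChoose m i ≠ 0 := by
  rw [sqrtChoose, Complex.ofReal_ne_zero, Real.sqrt_ne_zero (Nat.cast_nonneg _)]
  exact_mod_cast (Nat.choose_pos hi).ne'

theorem sqrtChoose_mul_self (m i : ℕ) : sqrtChoose m i * sqrtChoose m i = m.choose i := by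
  rw [sqrtChoose, ← Complex.ofReal_mul, Real.mul_self_sqrt (Nat.cast_nonneg _),
    Complex.ofReal_natCast]

theorem conj_sqrtChoose (m i : ℕ) : starRingEnd ℂ (sqrtChoose m i) = sqrtChoose m i :=
  Complex.conj_ofReal _

/-- The `m`-th symmetric power of a `2 × 2` matrix in the normalized monomial basis. -/
def symMatrix (m : ℕ) (g : Matrix (Fin 2) (Fin 2) ℂ) : Matrix (Fin (m + 1)) (Fin (m + 1)) ℂ :=
  Matrix.of fun i j => symEntry g m i j * sqrtChoose m j / sqrtChoose m i

theorem Fin.le_of_succ {m : ℕ} (i : Fin (m + 1)) : (i : ℕ) ≤ m := Nat.lt_succ_iff.mp i.2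

theorem symMatrix_apply (m : ℕ) (g : Matrix (Fin 2) (Fin 2) ℂ) (i j : Fin (m + 1)) :
    symMatrix m g i j = symEntry g m i j * sqrtChoose m j / sqrtChoose m i := rfl

theorem symMatrix_one (m : ℕ) : symMatrix m 1 = 1 := by
  ext i j
  rw [symMatrix_apply, symEntry_one, Matrix.one_apply]
  by_cases h : i = j
  · subst h
    simp [sqrtChoose_ne_zero (Fin.le_of_succ i)]
  · simp [h, Fin.val_inj]

theorem symMatrix_mul (m : ℕ) (g h : Matrix (Fin 2) (Fin 2) ℂ) :
    symMatrix m (g * h) = symMatrix m g * symMatrix m h := by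
  ext i j
  rw [symMatrix_apply, symEntry_mul g h (Fin.le_of_succ j), Matrix.mul_apply,
    ← Fin.sum_univ_eq_sum_range (fun k => symEntry g m i k * symEntry h m k j), Finset.sum_mul,
    Finset.sum_div]
  refine Finset.sum_congr rfl fun k _ => ?_
  rw [symMatrix_apply, symMatrix_apply]
  have := sqrtChoose_ne_zero (Fin.le_of_succ k)
  have := sqrtChoose_ne_zero (Fin.le_of_succ i)
  field_simp

/-- The square roots of binomial coefficients symmetrize the weights in
`choose_mul_symEntry_transpose`; this is why the monomial basis is rescaled by them. -/
theorem star_symMatrix (m : ℕ) (g : Matrix (Fin 2) (Fin 2) ℂ) :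
    star (symMatrix m g) = symMatrix m (star g) := by
  ext i j
  have h1 := choose_mul_symEntry_transpose (g.map (starRingEnd ℂ)) (Fin.le_of_succ i)
    (Fin.le_of_succ j)
  have h2 : (g.map (starRingEnd ℂ)).transpose = star g := rfl
  rw [h2, symEntry_map_conj, ← sqrtChoose_mul_self, ← sqrtChoose_mul_self] at h1
  have h3 := sqrtChoose_ne_zero (Fin.le_of_succ i)
  have h4 := sqrtChoose_ne_zero (Fin.le_of_succ j)
  rw [Matrix.star_apply, symMatrix_apply, symMatrix_apply, Complex.star_def, map_div₀, map_mul,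
    conj_sqrtChoose, conj_sqrtChoose, div_eq_div_iff h4 h3]
  linear_combination -h1

/-- The irreducible representation of `SU(2)` of dimension `m + 1`. -/
def symRep (m : ℕ) : SU2 →* Matrix.unitaryGroup (Fin (m + 1)) ℂ where
  toFun g := ⟨symMatrix m g, by
    rw [Matrix.mem_unitaryGroup_iff', star_symMatrix, ← symMatrix_mul,
      Matrix.mem_unitaryGroup_iff'.mp (Matrix.mem_specialUnitaryGroup_iff.mp g.2).1,
      symMatrix_one]⟩
  map_one' := Subtype.ext (symMatrix_one m)
  map_mul' g h := Subtype.ext (symMatrix_mul m g h)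

theorem coe_symRep (m : ℕ) (g : SU2) :
    (symRep m g : Matrix (Fin (m + 1)) (Fin (m + 1)) ℂ) = symMatrix m g := rfl

open Polynomial in
theorem continuous_coeff_mul {X : Type*} [TopologicalSpace X] {p q : X → ℂ[X]}
    (hp : ∀ i, Continuous fun x => (p x).coeff i) (hq : ∀ i, Continuous fun x => (q x).coeff i)
    (i : ℕ) : Continuous fun x => (p x * q x).coeff i := by
  simp only [coeff_mul]
  exact continuous_finsetSum _ fun k _ => (hp _).mul (hq _)

open Polynomial in
theorem continuous_coeff_pow {X : Type*} [TopologicalSpace X] {p : X → ℂ[X]}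
    (hp : ∀ i, Continuous fun x => (p x).coeff i) (n : ℕ) :
    ∀ i, Continuous fun x => (p x ^ n).coeff i := by
  induction n with
  | zero => intro i; simpa using continuous_const
  | succ n ih =>
    simp only [pow_succ]
    exact continuous_coeff_mul ih hp

open Polynomial in
theorem continuous_symEntry (m i j : ℕ) :
    Continuous fun g : Matrix (Fin 2) (Fin 2) ℂ => symEntry g m i j := by
  have h : ∀ (a b : Matrix (Fin 2) (Fin 2) ℂ → ℂ), Continuous a → Continuous b →
      ∀ i, Continuous fun g => (C (a g) + C (b g) * X).coeff i := by
    intro a b ha hb i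
    simp only [coeff_add, coeff_C, coeff_C_mul, coeff_X]
    split_ifs <;> fun_prop
  unfold symEntry symPoly
  exact continuous_coeff_mul (continuous_coeff_pow (h _ _ (by fun_prop) (by fun_prop)) _)
    (continuous_coeff_pow (h _ _ (by fun_prop) (by fun_prop)) _) i

theorem continuous_symRep (m : ℕ) : Continuous (symRep m) := by
  refine Continuous.subtype_mk (continuous_matrix fun i j => ?_) _
  exact (((continuous_symEntry m i j).comp continuous_subtype_val).mul_const _).div_const _

/-- An element of `SU(2)` whose first column is proportional to `(1, z)`. -/
theorem exists_specialUnitary_ratio (z : ℂ) : ∃ (g : SU2) (a : ℂ), a ≠ 0 ∧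
    (g : Matrix (Fin 2) (Fin 2) ℂ) 0 0 = a ∧ (g : Matrix (Fin 2) (Fin 2) ℂ) 1 0 = z * a ∧
      (g : Matrix (Fin 2) (Fin 2) ℂ) 0 1 = -starRingEnd ℂ z * a := by
  set r : ℝ := Real.sqrt (1 + ‖z‖ ^ 2) with hr
  have hr0 : 0 < r := Real.sqrt_pos.mpr (by positivity)
  have hr2 : (r : ℂ) * r = 1 + z * starRingEnd ℂ z := by
    rw [← Complex.ofReal_mul, hr, Real.mul_self_sqrt (by positivity), Complex.mul_conj']
    push_cast; ring
  have hrC : (r : ℂ) ≠ 0 := Complex.ofReal_ne_zero.mpr hr0.ne'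
  refine ⟨⟨!![(r : ℂ)⁻¹, -starRingEnd ℂ z * (r : ℂ)⁻¹; z * (r : ℂ)⁻¹, (r : ℂ)⁻¹], ?_⟩,
    (r : ℂ)⁻¹, inv_ne_zero hrC, by simp, by simp, by simp⟩
  rw [Matrix.mem_specialUnitaryGroup_iff, Matrix.mem_unitaryGroup_iff, Matrix.det_fin_two]
  constructor
  · ext i j
    fin_cases i <;> fin_cases j <;>
      simp [Matrix.mul_apply, Fin.sum_univ_two, Matrix.star_apply] <;> field_simp <;>
      first | ring1 | (rw [pow_two, hr2]; ring)
  · simp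
    field_simp
    rw [pow_two, hr2]; ring

theorem symEntry_col_zero (g : Matrix (Fin 2) (Fin 2) ℂ) {m i : ℕ} (hi : i ≤ m) :
    symEntry g m i 0 = m.choose i * g 0 0 ^ (m - i) * g 1 0 ^ i := by
  have h : symPoly g m 0 = ∑ k ∈ Finset.range (m + 1),
      Polynomial.C (m.choose k * g 0 0 ^ (m - k) * g 1 0 ^ k) * Polynomial.X ^ k := by
    simp only [symPoly, pow_zero, mul_one, Nat.sub_zero]
    rw [add_comm, add_pow]
    refine Finset.sum_congr rfl fun k _ => ?_
    simp only [mul_pow, Polynomial.C_mul, Polynomial.C_pow, Polynomial.C_eq_natCast]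
    ring
  rw [symEntry, h, Polynomial.finsetSum_coeff]
  simp [Polynomial.coeff_X_pow, Nat.lt_succ_of_le hi, -map_mul]

theorem symEntry_row_zero (g : Matrix (Fin 2) (Fin 2) ℂ) (m j : ℕ) :
    symEntry g m 0 j = g 0 0 ^ (m - j) * g 0 1 ^ j := by
  rw [symEntry, Polynomial.coeff_zero_eq_eval_zero, symPoly]
  simp

theorem eq_zero_of_forall_fin_sum_mul_pow {n : ℕ} {a : Fin n → ℂ}
    (h : ∀ z : ℂ, ∑ i, a i * z ^ (i : ℕ) = 0) : a = 0 := by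
  have h1 : ∀ z : ℂ, ∑ i ∈ Finset.range n, (if hi : i < n then a ⟨i, hi⟩ else 0) * z ^ i = 0 := by
    intro z
    rw [← Fin.sum_univ_eq_sum_range (fun i => (if hi : i < n then a ⟨i, hi⟩ else 0) * z ^ i)]
    simpa using h z
  ext i
  simpa using eq_zero_of_forall_sum_mul_pow h1 i.2

theorem Circle.mul_conj_self (t : Circle) : (t : ℂ) * starRingEnd ℂ (t : ℂ) = 1 := by
  rw [Complex.mul_conj', Circle.norm_coe]; simp

theorem Circle.conj_mul_self (t : Circle) : starRingEnd ℂ (t : ℂ) * (t : ℂ) = 1 := by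
  rw [mul_comm, Circle.mul_conj_self]

/-- The diagonal element of `SU(2)` with entries `t`, `t⁻¹`. -/
def torusElement (t : Circle) : SU2 :=
  ⟨!![(t : ℂ), 0; 0, (starRingEnd ℂ) (t : ℂ)], by
    rw [Matrix.mem_specialUnitaryGroup_iff, Matrix.mem_unitaryGroup_iff, Matrix.det_fin_two]
    refine ⟨?_, by simp [Circle.mul_conj_self]⟩
    ext i j
    fin_cases i <;> fin_cases j <;>
      simp [Matrix.mul_apply, Fin.sum_univ_two, Matrix.star_apply, Circle.mul_conj_self,
        Circle.conj_mul_self]⟩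

theorem symRep_torusElement_mulVec (m : ℕ) (t : Circle) (w : Fin (m + 1) → ℂ) (i : Fin (m + 1)) :
    (symRep m (torusElement t) : Matrix (Fin (m + 1)) (Fin (m + 1)) ℂ).mulVec w i =
      (t : ℂ) ^ m * ((starRingEnd ℂ (t : ℂ)) ^ 2) ^ (i : ℕ) * w i := by
  have h0 : (t : ℂ) ≠ 0 := t.coe_ne_zero
  have h : (t : ℂ) * starRingEnd ℂ (t : ℂ) = 1 := Circle.mul_conj_self t
  rw [Matrix.mulVec, dotProduct, Finset.sum_eq_single i]
  · rw [coe_symRep, symMatrix_apply, mul_div_assoc, div_self (sqrtChoose_ne_zero (Fin.le_of_succ i)),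
      mul_one, torusElement, symEntry_diagonal, if_pos rfl]
    congr 1
    obtain ⟨k, hk⟩ := Nat.exists_eq_add_of_le (Fin.le_of_succ i)
    have hm : (t : ℂ) ^ m = (t : ℂ) ^ (i : ℕ) * (t : ℂ) ^ k := by rw [← pow_add, ← hk]
    rw [show m - (i : ℕ) = k by omega, hm, ← pow_mul, two_mul, pow_add]
    calc _ = (1 : ℂ) ^ (i : ℕ) * ((t : ℂ) ^ k * (starRingEnd ℂ (t : ℂ)) ^ (i : ℕ)) := by simp
      _ = _ := by rw [← h, mul_pow]; ring
  · intro j _ hj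
    rw [coe_symRep, symMatrix_apply, torusElement, symEntry_diagonal, if_neg]
    · simp
    · exact fun h => hj (Fin.ext h.symm)
  · simp

/-- Averaging over powers of one torus element, twisted by a character, projects onto the weight
space of the first coordinate. -/
theorem single_mem_of_invariant {m : ℕ} {W : Submodule ℂ (Fin (m + 1) → ℂ)}
    (hW : ∀ g, ∀ v ∈ W, (symRep m g : Matrix (Fin (m + 1)) (Fin (m + 1)) ℂ).mulVec v ∈ W)
    {w : Fin (m + 1) → ℂ} (hw : w ∈ W) (hw0 : w 0 ≠ 0) : Pi.single 0 1 ∈ W := by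
  -- Chosen so that the ratio of consecutive weights, `conj t ^ 2`, is a primitive root of unity of
  -- order `m + 1`: the `m + 1` weights are then distinguished.
  set t : Circle := Circle.exp (Real.pi / (m + 1))
  obtain ⟨ω, hω⟩ : ∃ ω : ℂ, ω = starRingEnd ℂ (t : ℂ) ^ 2 := ⟨_, rfl⟩
  have hωexp : ω = Complex.exp (-(2 * Real.pi * Complex.I / ((m + 1 : ℕ) : ℂ))) := by
    rw [hω, Circle.coe_exp, ← Complex.exp_conj, ← Complex.exp_nat_mul]
    congr 1
    simp
    ring
  have hprim : IsPrimitiveRoot ω (m + 1) := by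
    rw [hωexp, Complex.exp_neg]
    exact (Complex.isPrimitiveRoot_exp (m + 1) (by omega)).inv
  have ht : (t : ℂ) * starRingEnd ℂ (t : ℂ) = 1 := Circle.mul_conj_self t
  have hv : ∑ k ∈ Finset.range (m + 1), (starRingEnd ℂ ((t : ℂ) ^ k) ^ m) •
      (symRep m (torusElement (t ^ k)) : Matrix (Fin (m + 1)) (Fin (m + 1)) ℂ).mulVec w ∈ W :=
    W.sum_mem fun k _ => W.smul_mem _ (hW _ _ hw)
  have hv2 : ∑ k ∈ Finset.range (m + 1), (starRingEnd ℂ ((t : ℂ) ^ k) ^ m) •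
      (symRep m (torusElement (t ^ k)) : Matrix (Fin (m + 1)) (Fin (m + 1)) ℂ).mulVec w =
      ((m + 1 : ℂ) * w 0) • Pi.single 0 1 := by
    ext i
    have h1 : ∀ k ∈ Finset.range (m + 1), starRingEnd ℂ ((t : ℂ) ^ k) ^ m *
        (symRep m (torusElement (t ^ k)) : Matrix (Fin (m + 1)) (Fin (m + 1)) ℂ).mulVec w i =
        (ω ^ (i : ℕ)) ^ k * w i := by
      intro k _
      rw [symRep_torusElement_mulVec, Circle.coe_pow, ← mul_assoc, ← mul_assoc, ← mul_pow,
        mul_comm (starRingEnd ℂ ((t : ℂ) ^ k)), map_pow, ← mul_pow, ht, one_pow, one_pow, one_mul,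
        hω]
      ring
    rw [Finset.sum_apply]
    simp only [Pi.smul_apply, smul_eq_mul]
    rw [Finset.sum_congr rfl h1, ← Finset.sum_mul]
    by_cases hi : i = 0
    · subst hi
      simp
    · rw [Pi.single_eq_of_ne hi, mul_zero]
      have h2 : ω ^ (i : ℕ) ≠ 1 := hprim.pow_ne_one_of_pos_of_lt
        (fun h => hi (Fin.ext h)) i.2
      have h3 := geom_sum_mul (ω ^ (i : ℕ)) (m + 1)
      rw [pow_right_comm, hprim.pow_eq_one, one_pow, sub_self] at h3
      rw [(mul_eq_zero.mp h3).resolve_right (sub_ne_zero.mpr h2), zero_mul]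
  rw [hv2] at hv
  refine (W.smul_mem_iff (mul_ne_zero ?_ hw0)).mp hv
  exact_mod_cast Nat.succ_ne_zero m

theorem isIrreducible_symRep (m : ℕ) : IsIrreducibleMatrixRep (symRep m) := by
  refine ⟨Nat.succ_pos m, fun W hW => ?_⟩
  by_contra! hcon
  obtain ⟨w, hw, hw0⟩ := W.ne_bot_iff.mp hcon.1
  -- Some translate of `w` has a nonzero first coordinate: row 0 of the symmetric power is a
  -- polynomial curve through all normalized monomials, and no nonzero `w` annihilates all of it.
  obtain ⟨g, hg⟩ : ∃ g, (symRep m g : Matrix (Fin (m + 1)) (Fin (m + 1)) ℂ).mulVec w 0 ≠ 0 := by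
    by_contra! h
    have h1 : (fun j : Fin (m + 1) => sqrtChoose m j * w j) = 0 := by
      refine eq_zero_of_forall_fin_sum_mul_pow fun z => ?_
      obtain ⟨g, a, ha, h00, -, h01⟩ := exists_specialUnitary_ratio (-starRingEnd ℂ z)
      have h2 := h g
      have hs : sqrtChoose m 0 = 1 := by simp [sqrtChoose]
      have h3 : ∀ j : Fin (m + 1), (symRep m g : Matrix (Fin (m + 1)) (Fin (m + 1)) ℂ) 0 j * w j =
          a ^ m * (sqrtChoose m j * w j * z ^ (j : ℕ)) := by
        intro j
        rw [coe_symRep, symMatrix_apply]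
        simp only [Fin.val_zero, hs, div_one]
        rw [symEntry_row_zero, h00, h01]
        simp only [map_neg, Complex.conj_conj, neg_neg]
        rw [mul_pow]
        have hm : a ^ m = a ^ (m - (j : ℕ)) * a ^ (j : ℕ) := by
          rw [← pow_add, Nat.sub_add_cancel (Fin.le_of_succ j)]
        rw [hm]
        ring
      rw [Matrix.mulVec, dotProduct, Finset.sum_congr rfl fun j _ => h3 j, ← Finset.mul_sum] at h2
      exact (mul_eq_zero.mp h2).resolve_left (pow_ne_zero _ ha)
    refine hw0 (funext fun j => ?_)
    have := congrFun h1 j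
    exact (mul_eq_zero.mp this).resolve_left (sqrtChoose_ne_zero (Fin.le_of_succ j))
  have he := single_mem_of_invariant hW (hW g w hw) hg
  -- Dually, the orbit of the first basis vector spans everything: a functional vanishing on it
  -- gives a polynomial in `z` vanishing identically.
  obtain ⟨f, hf0, hf⟩ := W.exists_le_ker_of_lt_top (lt_top_iff_ne_top.mpr hcon.2)
  have h1 : (fun i : Fin (m + 1) => f (Pi.single i 1) * sqrtChoose m i) = 0 := by
    refine eq_zero_of_forall_fin_sum_mul_pow fun z => ?_
    obtain ⟨g, a, ha, h00, h10, -⟩ := exists_specialUnitary_ratio z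
    have h2 := hf (hW g _ he)
    rw [LinearMap.mem_ker, Matrix.mulVec_single_one, LinearMap.pi_apply_eq_sum_univ f] at h2
    have hs : sqrtChoose m 0 = 1 := by simp [sqrtChoose]
    have h3 : ∀ i : Fin (m + 1), (symRep m g : Matrix (Fin (m + 1)) (Fin (m + 1)) ℂ).col 0 i •
        f (fun j => if i = j then 1 else 0) =
        a ^ m * (f (Pi.single i 1) * sqrtChoose m i * z ^ (i : ℕ)) := by
      intro i
      have h4 : (fun j => if i = j then (1 : ℂ) else 0) = Pi.single i 1 := by
        ext j; simp [Pi.single_apply, eq_comm]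
      rw [h4, Matrix.col_apply, coe_symRep, symMatrix_apply]
      simp only [Fin.val_zero, hs, mul_one]
      rw [symEntry_col_zero _ (Fin.le_of_succ i), h00, h10, ← sqrtChoose_mul_self, mul_pow,
        smul_eq_mul]
      have h5 := sqrtChoose_ne_zero (Fin.le_of_succ i)
      have hm : a ^ m = a ^ (m - (i : ℕ)) * a ^ (i : ℕ) := by
        rw [← pow_add, Nat.sub_add_cancel (Fin.le_of_succ i)]
      rw [hm]
      field_simp
    rw [Finset.sum_congr rfl fun i _ => h3 i, ← Finset.mul_sum] at h2
    exact (mul_eq_zero.mp h2).resolve_left (pow_ne_zero _ ha)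
  refine hf0 (LinearMap.pi_ext' fun i => LinearMap.ext_ring ?_)
  have := congrFun h1 i
  simpa [sqrtChoose_ne_zero (Fin.le_of_succ i)] using this

end SymmetricPowerRep

/-! ### Products and density of the matrix coefficients. -/

section MatrixCoefficients

/-- The matrix coefficient `g ↦ U(g)ᵢⱼ` of a continuous unitary representation. -/
def repCoef {G : Type*} [Group G] [TopologicalSpace G] {n : ℕ}
    {U : G →* Matrix.unitaryGroup (Fin n) ℂ} (hU : Continuous U) (i j : Fin n) : C(G, ℂ) :=
  ⟨fun g => (U g : Matrix (Fin n) (Fin n) ℂ) i j,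
    Continuous.matrix_elem (A := fun g => (U g : Matrix (Fin n) (Fin n) ℂ))
      (continuous_subtype_val.comp hU) i j⟩

theorem repCoef_apply {G : Type*} [Group G] [TopologicalSpace G] {n : ℕ}
    {U : G →* Matrix.unitaryGroup (Fin n) ℂ} (hU : Continuous U) (i j : Fin n) (g : G) :
    repCoef hU i j g = (U g : Matrix (Fin n) (Fin n) ℂ) i j := rfl

/-- The span of the matrix coefficients of `symRep m`. -/
def coefSpan (m : ℕ) : Submodule ℂ C(SU2, ℂ) :=
  Submodule.span ℂ (Set.range fun p : Fin (m + 1) × Fin (m + 1) =>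
    repCoef (continuous_symRep m) p.1 p.2)

theorem repCoef_mem_coefSpan {m : ℕ} (i j : Fin (m + 1)) :
    repCoef (continuous_symRep m) i j ∈ coefSpan m :=
  Submodule.subset_span ⟨(i, j), rfl⟩

/-- The matrix entries of the `m`-th symmetric power in the monomial basis, as functions. -/
def symCoef (m i j : ℕ) : C(SU2, ℂ) :=
  ⟨fun g => symEntry g m i j, (continuous_symEntry m i j).comp continuous_subtype_val⟩

theorem symCoef_apply (m i j : ℕ) (g : SU2) : symCoef m i j g = symEntry g m i j := rfl

theorem repCoef_symRep {m : ℕ} (i j : Fin (m + 1)) :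
    repCoef (continuous_symRep m) i j = (sqrtChoose m j / sqrtChoose m i) • symCoef m i j := by
  ext g
  rw [repCoef_apply, coe_symRep, symMatrix_apply, ContinuousMap.smul_apply, symCoef_apply,
    smul_eq_mul]
  ring

/-- The row index is allowed out of range, where the coefficient is zero; this spares the shifts `i
+ 1` in the product rules a case distinction. -/
theorem symCoef_mem_coefSpan {m i j : ℕ} (hj : j ≤ m) : symCoef m i j ∈ coefSpan m := by
  by_cases hi : i ≤ m
  · have h := repCoef_symRep (⟨i, Nat.lt_succ_of_le hi⟩ : Fin (m + 1))
      (⟨j, Nat.lt_succ_of_le hj⟩ : Fin (m + 1))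
    have hne : sqrtChoose m j / sqrtChoose m i ≠ 0 :=
      div_ne_zero (sqrtChoose_ne_zero hj) (sqrtChoose_ne_zero hi)
    refine ((coefSpan m).smul_mem_iff hne).mp ?_
    exact h ▸ repCoef_mem_coefSpan _ _
  · have : symCoef m i j = 0 := by
      ext g
      exact symEntry_eq_zero _ hj (not_le.mp hi)
    rw [this]
    exact zero_mem _

/-- The matrix entries of `SU(2)` as continuous functions. -/
def entry (r s : Fin 2) : C(SU2, ℂ) :=
  ⟨fun x => (x : Matrix (Fin 2) (Fin 2) ℂ) r s,
    (continuous_apply_apply r s).comp continuous_subtype_val⟩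

theorem entry_apply (r s : Fin 2) (x : SU2) :
    entry r s x = (x : Matrix (Fin 2) (Fin 2) ℂ) r s := rfl

theorem det_coe_SU2 (g : SU2) : (g : Matrix (Fin 2) (Fin 2) ℂ).det = 1 :=
  (Matrix.mem_specialUnitaryGroup_iff.mp g.2).2

theorem symCoef_succ_left {m j : ℕ} (hj : j ≤ m) (i : ℕ) :
    symCoef (m + 1) i j = entry 0 0 * symCoef m i j +
      (if i = 0 then 0 else entry 1 0 * symCoef m (i - 1) j) := by
  ext g
  have h := congrArg (fun p => Polynomial.coeff p i) (mul_symPoly_zero_zero (g : Matrix (Fin 2) (Fin 2) ℂ) hj)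
  rcases i with _ | i <;>
    simpa [entry_apply, symCoef_apply, symEntry, eq_sub_iff_add_eq, eq_comm] using h

theorem symCoef_succ_right {m j : ℕ} (hj : j ≤ m) (i : ℕ) :
    symCoef (m + 1) i (j + 1) = entry 0 1 * symCoef m i j +
      (if i = 0 then 0 else entry 1 1 * symCoef m (i - 1) j) := by
  ext g
  have h := congrArg (fun p => Polynomial.coeff p i) (mul_symPoly_zero_one (g : Matrix (Fin 2) (Fin 2) ℂ) hj)
  rcases i with _ | i <;>
    simpa [entry_apply, symCoef_apply, symEntry, eq_sub_iff_add_eq, eq_comm] using h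

theorem entry_one_zero_mul_symCoef {m j : ℕ} (hj : j ≤ m) (i : ℕ) :
    ((m : ℂ) + 1) • (entry 1 0 * symCoef m i j) =
      ((i : ℂ) + 1) • symCoef (m + 1) (i + 1) j - (j : ℂ) • symCoef (m - 1) i (j - 1) := by
  ext g
  have h := congrArg (fun p => Polynomial.coeff p i)
    (mul_symPoly_one_zero (g : Matrix (Fin 2) (Fin 2) ℂ) (det_coe_SU2 g) hj)
  simp only [Polynomial.coeff_C_mul, Polynomial.coeff_sub, Polynomial.coeff_derivative] at h
  simp only [entry_apply, symCoef_apply, symEntry, ContinuousMap.smul_apply,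
    ContinuousMap.sub_apply, ContinuousMap.mul_apply, smul_eq_mul]
  rw [h]; ring

theorem entry_one_one_mul_symCoef {m j : ℕ} (hj : j ≤ m) (i : ℕ) :
    ((m : ℂ) + 1) • (entry 1 1 * symCoef m i j) =
      ((i : ℂ) + 1) • symCoef (m + 1) (i + 1) (j + 1) + ((m : ℂ) - j) • symCoef (m - 1) i j := by
  ext g
  have h := congrArg (fun p => Polynomial.coeff p i)
    (mul_symPoly_one_one (g : Matrix (Fin 2) (Fin 2) ℂ) (det_coe_SU2 g) hj)
  simp only [Polynomial.coeff_C_mul, Polynomial.coeff_add, Polynomial.coeff_derivative] at h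
  simp only [entry_apply, symCoef_apply, symEntry, ContinuousMap.smul_apply,
    ContinuousMap.add_apply, ContinuousMap.mul_apply, smul_eq_mul]
  rw [h]; ring

/-- The sum of the coefficient spaces of the two neighbours of `m`. -/
def neighbourSpan (m : ℕ) : Submodule ℂ C(SU2, ℂ) :=
  ⨆ k, ⨆ (_ : k = m + 1 ∨ k + 1 = m), coefSpan k

theorem coefSpan_le_neighbourSpan {m k : ℕ} (h : k = m + 1 ∨ k + 1 = m) :
    coefSpan k ≤ neighbourSpan m :=
  le_iSup₂ (f := fun k (_ : k = m + 1 ∨ k + 1 = m) => coefSpan k) k h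

/-- The fundamental representation tensored with the `m`-th symmetric power has constituents `m + 1`
and `m - 1` only. The second row of entries comes from the determinant identities, the first row
from the second by the recursions in `m`. -/
theorem entry_mul_symCoef_mem {m j : ℕ} (hj : j ≤ m) (r s : Fin 2) (i : ℕ) :
    entry r s * symCoef m i j ∈ neighbourSpan m := by
  have hm : ((m : ℂ) + 1) ≠ 0 := by exact_mod_cast Nat.succ_ne_zero m
  have h10 : ∀ i, entry 1 0 * symCoef m i j ∈ neighbourSpan m := by
    intro i
    rw [← (neighbourSpan m).smul_mem_iff hm, entry_one_zero_mul_symCoef hj]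
    refine sub_mem (Submodule.smul_mem _ _ (coefSpan_le_neighbourSpan (Or.inl rfl)
      (symCoef_mem_coefSpan (by omega)))) ?_
    rcases j with _ | j
    · simp
    · exact Submodule.smul_mem _ _ (coefSpan_le_neighbourSpan (Or.inr (by omega))
        (symCoef_mem_coefSpan (by omega)))
  have h11 : ∀ i, entry 1 1 * symCoef m i j ∈ neighbourSpan m := by
    intro i
    rw [← (neighbourSpan m).smul_mem_iff hm, entry_one_one_mul_symCoef hj]
    refine add_mem (Submodule.smul_mem _ _ (coefSpan_le_neighbourSpan (Or.inl rfl)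
      (symCoef_mem_coefSpan (by omega)))) ?_
    rcases hj.eq_or_lt with rfl | hlt
    · simp
    · exact Submodule.smul_mem _ _ (coefSpan_le_neighbourSpan (Or.inr (by omega))
        (symCoef_mem_coefSpan (by omega)))
  have h00 : entry 0 0 * symCoef m i j ∈ neighbourSpan m := by
    rw [eq_sub_of_add_eq (symCoef_succ_left hj i).symm]
    refine sub_mem (coefSpan_le_neighbourSpan (Or.inl rfl) (symCoef_mem_coefSpan (by omega))) ?_
    split_ifs
    · exact zero_mem _
    · exact h10 _
  have h01 : entry 0 1 * symCoef m i j ∈ neighbourSpan m := by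
    rw [eq_sub_of_add_eq (symCoef_succ_right hj i).symm]
    refine sub_mem (coefSpan_le_neighbourSpan (Or.inl rfl) (symCoef_mem_coefSpan (by omega))) ?_
    split_ifs
    · exact zero_mem _
    · exact h11 _
  fin_cases r <;> fin_cases s
  · exact h00
  · exact h01
  · exact h10 i
  · exact h11 i

theorem entry_mul_mem_neighbourSpan {m : ℕ} (r s : Fin 2) {f : C(SU2, ℂ)} (hf : f ∈ coefSpan m) :
    entry r s * f ∈ neighbourSpan m := by
  have h : coefSpan m ≤ (neighbourSpan m).comap (LinearMap.mulLeft ℂ (entry r s)) := by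
    refine Submodule.span_le.mpr ?_
    rintro _ ⟨p, rfl⟩
    simp only [SetLike.mem_coe, Submodule.mem_comap, LinearMap.mulLeft_apply]
    rw [repCoef_symRep, mul_smul_comm]
    exact Submodule.smul_mem _ _ (entry_mul_symCoef_mem (Fin.le_of_succ _) r s _)
  exact h hf

/-- The star subalgebra generated by the matrix entries of `SU(2)`. -/
def entryAlgebra : StarSubalgebra ℂ C(SU2, ℂ) :=
  StarAlgebra.adjoin ℂ (Set.range fun p : Fin 2 × Fin 2 => entry p.1 p.2)

theorem entry_mem_entryAlgebra (r s : Fin 2) : entry r s ∈ entryAlgebra :=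
  StarAlgebra.subset_adjoin ℂ _ ⟨(r, s), rfl⟩

theorem symCoef_mem_entryAlgebra (m : ℕ) : ∀ i j : ℕ, j ≤ m → symCoef m i j ∈ entryAlgebra := by
  induction m with
  | zero =>
    intro i j hj
    obtain rfl : j = 0 := by omega
    have : symCoef 0 i 0 = if i = 0 then 1 else 0 := by
      ext g
      rw [symCoef_apply, symEntry, symPoly]
      split_ifs with h <;> simp [Polynomial.coeff_one, h]
    rw [this]
    split_ifs
    · exact one_mem _
    · exact zero_mem _
  | succ m ih =>
    intro i j hj
    rcases hj.eq_or_lt with rfl | hlt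
    · rw [symCoef_succ_right le_rfl]
      refine add_mem (mul_mem (entry_mem_entryAlgebra _ _) (ih _ _ le_rfl)) ?_
      split_ifs
      · exact zero_mem _
      · exact mul_mem (entry_mem_entryAlgebra _ _) (ih _ _ le_rfl)
    · have hj' : j ≤ m := by omega
      rw [symCoef_succ_left hj']
      refine add_mem (mul_mem (entry_mem_entryAlgebra _ _) (ih _ _ hj')) ?_
      split_ifs
      · exact zero_mem _
      · exact mul_mem (entry_mem_entryAlgebra _ _) (ih _ _ hj')

theorem coefSpan_le_entryAlgebra (m : ℕ) {f : C(SU2, ℂ)} (hf : f ∈ coefSpan m) :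
    f ∈ entryAlgebra := by
  have h : coefSpan m ≤ entryAlgebra.toSubalgebra.toSubmodule := by
    refine Submodule.span_le.mpr ?_
    rintro _ ⟨p, rfl⟩
    simp only [repCoef_symRep]
    exact Submodule.smul_mem _ _ (symCoef_mem_entryAlgebra _ _ _ (Fin.le_of_succ _))
  exact h hf

/-- The matrix of an element of `SU(2)` in terms of its first column. -/
theorem SU2_entries (x : SU2) :
    (x : Matrix (Fin 2) (Fin 2) ℂ) 1 1 = star ((x : Matrix (Fin 2) (Fin 2) ℂ) 0 0) ∧
    (x : Matrix (Fin 2) (Fin 2) ℂ) 0 1 = -star ((x : Matrix (Fin 2) (Fin 2) ℂ) 1 0) := by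
  have h1 : star (x : Matrix (Fin 2) (Fin 2) ℂ) * x = 1 :=
    Matrix.mem_unitaryGroup_iff'.mp (Matrix.mem_specialUnitaryGroup_iff.mp x.2).1
  have h2 : (x : Matrix (Fin 2) (Fin 2) ℂ) * (x : Matrix (Fin 2) (Fin 2) ℂ).adjugate = 1 := by
    rw [Matrix.mul_adjugate, det_coe_SU2, one_smul]
  have h3 := left_inv_eq_right_inv h1 h2
  rw [Matrix.adjugate_fin_two] at h3
  have h4 := congrFun (congrFun h3 0) 0
  have h5 := congrFun (congrFun h3 0) 1
  simp only [Matrix.star_apply, Matrix.of_apply, Matrix.cons_val', Matrix.cons_val_zero,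
    Matrix.cons_val_one] at h4 h5
  exact ⟨by simpa using h4.symm, by simpa using (neg_eq_iff_eq_neg.mpr h5).symm⟩

theorem star_entry (r s : Fin 2) : ∃ (c : ℂ) (r' s' : Fin 2), star (entry r s) = c • entry r' s' := by
  fin_cases r <;> fin_cases s
  · exact ⟨1, 1, 1, by ext x; simp [entry_apply, (SU2_entries x).1]⟩
  · exact ⟨-1, 1, 0, by ext x; simp [entry_apply, (SU2_entries x).2]⟩
  · exact ⟨-1, 0, 1, by ext x; simp [entry_apply, (SU2_entries x).2]⟩
  · exact ⟨1, 0, 0, by ext x; simp [entry_apply, (SU2_entries x).1]⟩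

theorem neighbourSpan_le_iSup (m : ℕ) : neighbourSpan m ≤ ⨆ k, coefSpan k :=
  iSup₂_le fun k _ => le_iSup coefSpan k

theorem entry_mul_mem_iSup (r s : Fin 2) {f : C(SU2, ℂ)} (hf : f ∈ ⨆ k, coefSpan k) :
    entry r s * f ∈ ⨆ k, coefSpan k := by
  have h : ⨆ k, coefSpan k ≤ (⨆ k, coefSpan k).comap (LinearMap.mulLeft ℂ (entry r s)) :=
    iSup_le fun m f hf => neighbourSpan_le_iSup m (entry_mul_mem_neighbourSpan r s hf)
  exact h hf

/-- The sum of the coefficient spaces contains 1 and is stable under multiplication by each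
generator and its adjoint, hence contains the algebra they generate. -/
theorem mem_iSup_coefSpan_of_mem_entryAlgebra {f : C(SU2, ℂ)} (hf : f ∈ entryAlgebra) :
    f ∈ ⨆ k, coefSpan k := by
  have h1 : (1 : C(SU2, ℂ)) ∈ ⨆ k, coefSpan k := by
    have : (1 : C(SU2, ℂ)) = symCoef 0 0 0 := by
      ext g
      simp [symCoef_apply, symEntry, symPoly]
    rw [this]
    exact Submodule.mem_iSup_of_mem 0 (symCoef_mem_coefSpan le_rfl)
  suffices h : ∀ f' ∈ ⨆ k, coefSpan k, f * f' ∈ ⨆ k, coefSpan k by simpa using h 1 h1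
  have hstar : ∀ r s f', f' ∈ ⨆ k, coefSpan k → star (entry r s) * f' ∈ ⨆ k, coefSpan k := by
    intro r s f' hf'
    obtain ⟨c, r', s', h⟩ := star_entry r s
    rw [h, smul_mul_assoc]
    exact Submodule.smul_mem _ _ (entry_mul_mem_iSup r' s' hf')
  -- Stability is carried for `f` and `star f` together so that the induction passes through the
  -- star.
  suffices h : (∀ f' ∈ ⨆ k, coefSpan k, f * f' ∈ ⨆ k, coefSpan k) ∧
      ∀ f' ∈ ⨆ k, coefSpan k, star f * f' ∈ ⨆ k, coefSpan k from h.1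
  unfold entryAlgebra at hf
  induction hf using StarAlgebra.adjoin_induction with
  | mem x hx =>
    obtain ⟨p, rfl⟩ := hx
    exact ⟨fun f' hf' => entry_mul_mem_iSup _ _ hf', hstar _ _⟩
  | algebraMap c =>
    constructor <;> intro f' hf'
    · rw [← Algebra.smul_def]
      exact Submodule.smul_mem _ _ hf'
    · rw [← algebraMap_star_comm, ← Algebra.smul_def]
      exact Submodule.smul_mem _ _ hf'
  | add x y _ _ hx hy =>
    refine ⟨fun f' hf' => ?_, fun f' hf' => ?_⟩
    · rw [add_mul]; exact add_mem (hx.1 _ hf') (hy.1 _ hf')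
    · rw [star_add, add_mul]; exact add_mem (hx.2 _ hf') (hy.2 _ hf')
  | mul x y _ _ hx hy =>
    refine ⟨fun f' hf' => ?_, fun f' hf' => ?_⟩
    · rw [mul_assoc]; exact hx.1 _ (hy.1 _ hf')
    · rw [star_mul, mul_comm, mul_comm, mul_assoc]; exact hy.2 _ (hx.2 _ hf')
  | star x _ hx => exact ⟨hx.2, by simpa using hx.1⟩

/-- Stone–Weierstrass: the entries of the matrices separate the points of the group. -/
theorem dense_iSup_coefSpan : Dense ((⨆ k, coefSpan k : Submodule ℂ C(SU2, ℂ)) : Set C(SU2, ℂ)) := by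
  have h : entryAlgebra.topologicalClosure = ⊤ := by
    refine ContinuousMap.starSubalgebra_topologicalClosure_eq_top_of_separatesPoints _ ?_
    intro x y hxy
    by_contra! hcon
    refine hxy (Subtype.ext (Matrix.ext fun r s => ?_))
    exact hcon (entry r s) ⟨entry r s, entry_mem_entryAlgebra r s, rfl⟩
  have hd : Dense (entryAlgebra : Set C(SU2, ℂ)) := by
    rw [dense_iff_closure_eq, ← StarSubalgebra.topologicalClosure_coe, h]
    rfl
  exact hd.mono fun f hf => mem_iSup_coefSpan_of_mem_entryAlgebra hf

end MatrixCoefficients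

/-! ### Schur's lemma and orthogonality relations. -/

section Schur

variable {G : Type*} [Group G]

/-- Kernel and range of an intertwiner are invariant, so irreducibility on the two sides forces
injectivity and surjectivity. -/
theorem IsIrreducibleMatrixRep.exists_inverse_of_intertwines {n n' : ℕ}
    {U : G →* Matrix.unitaryGroup (Fin n) ℂ} {U' : G →* Matrix.unitaryGroup (Fin n') ℂ}
    (hU : IsIrreducibleMatrixRep U) (hU' : IsIrreducibleMatrixRep U')
    {S : Matrix (Fin n) (Fin n') ℂ}
    (hS : ∀ g, (U g : Matrix (Fin n) (Fin n) ℂ) * S = S * (U' g : Matrix (Fin n') (Fin n') ℂ))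
    (hS0 : S ≠ 0) : n = n' ∧ ∃ T : Matrix (Fin n') (Fin n) ℂ, S * T = 1 ∧ T * S = 1 := by
  have hSv : ∀ g v, (U g : Matrix (Fin n) (Fin n) ℂ).mulVec (S.mulVec v) =
      S.mulVec ((U' g : Matrix (Fin n') (Fin n') ℂ).mulVec v) := by
    intro g v
    rw [Matrix.mulVec_mulVec, Matrix.mulVec_mulVec, hS]
  have hker : LinearMap.ker S.mulVecLin = ⊥ := by
    refine (hU'.2 _ fun g v hv => ?_).resolve_right fun h => hS0 ?_
    · rw [LinearMap.mem_ker, Matrix.mulVecLin_apply] at hv ⊢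
      rw [← hSv, hv, Matrix.mulVec_zero]
    · rw [LinearMap.ker_eq_top] at h
      ext i j
      simpa using congrFun (LinearMap.congr_fun h (Pi.single j 1)) i
  have hrange : LinearMap.range S.mulVecLin = ⊤ := by
    refine (hU.2 _ ?_).resolve_left fun h => hS0 ?_
    · rintro g _ ⟨v, rfl⟩
      exact ⟨_, (hSv g v).symm⟩
    · rw [LinearMap.range_eq_bot] at h
      ext i j
      simpa using congrFun (LinearMap.congr_fun h (Pi.single j 1)) i
  let e := LinearEquiv.ofBijective S.mulVecLin
    ⟨LinearMap.ker_eq_bot.mp hker, LinearMap.range_eq_top.mp hrange⟩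
  have hn : n = n' := by simpa using e.finrank_eq.symm
  subst hn
  have hu : IsUnit S := by
    rw [← Matrix.mulVec_injective_iff_isUnit]
    exact LinearMap.ker_eq_bot.mp hker
  obtain ⟨u, rfl⟩ := hu
  exact ⟨rfl, (u⁻¹ : (Matrix (Fin n) (Fin n) ℂ)ˣ), u.mul_inv, u.inv_mul⟩

theorem IsIrreducibleMatrixRep.eq_smul_one_of_commutes {n : ℕ}
    {U : G →* Matrix.unitaryGroup (Fin n) ℂ} (hU : IsIrreducibleMatrixRep U)
    {S : Matrix (Fin n) (Fin n) ℂ}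
    (hS : ∀ g, (U g : Matrix (Fin n) (Fin n) ℂ) * S = S * (U g : Matrix (Fin n) (Fin n) ℂ)) :
    ∃ c : ℂ, S = c • 1 := by
  have : Nonempty (Fin n) := ⟨⟨0, hU.1⟩⟩
  obtain ⟨c, hc⟩ := Module.End.exists_eigenvalue (Matrix.toLin' S)
  refine ⟨c, ?_⟩
  have h := (hU.2 (Module.End.eigenspace (Matrix.toLin' S) c) fun g v hv => ?_).resolve_left hc
  · ext i j
    have h1 : Pi.single j 1 ∈ Module.End.eigenspace (Matrix.toLin' S) c := h ▸ Submodule.mem_top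
    rw [Module.End.mem_eigenspace_iff, Matrix.toLin'_apply, Matrix.mulVec_single_one] at h1
    have h2 := congrFun h1 i
    simpa [Matrix.one_apply, Pi.single_apply] using h2
  · rw [Module.End.mem_eigenspace_iff, Matrix.toLin'_apply] at hv ⊢
    rw [Matrix.mulVec_mulVec, ← hS, ← Matrix.mulVec_mulVec, hv, Matrix.mulVec_smul]

theorem repCoef_mul [TopologicalSpace G] {n : ℕ} {U : G →* Matrix.unitaryGroup (Fin n) ℂ} (hU : Continuous U)
    (i j : Fin n) (g h : G) :
    repCoef hU i j (g * h) = ∑ k, repCoef hU i k g * repCoef hU k j h := by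
  simp only [repCoef_apply, map_mul, Submonoid.coe_mul, Matrix.mul_apply]

theorem conj_repCoef [TopologicalSpace G] {n : ℕ} {U : G →* Matrix.unitaryGroup (Fin n) ℂ} (hU : Continuous U)
    (i j : Fin n) (g : G) : starRingEnd ℂ (repCoef hU i j g) = repCoef hU j i g⁻¹ := by
  simp [repCoef_apply, Matrix.star_apply]

variable [TopologicalSpace G] [IsTopologicalGroup G] [CompactSpace G] [MeasurableSpace G]
  [BorelSpace G]

/-- A continuous function as an element of `L₂(G)`. -/
def toL2 : C(G, ℂ) →L[ℂ] L2 G := ContinuousMap.toLp 2 (normHaar G) ℂ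

theorem coeFn_toL2 (f : C(G, ℂ)) : toL2 f =ᵐ[normHaar G] f :=
  ContinuousMap.coeFn_toLp (𝕜 := ℂ) (p := 2) (normHaar G) f

theorem inner_toL2 (f h : C(G, ℂ)) :
    ⟪toL2 f, toL2 h⟫_ℂ = ∫ x, h x * starRingEnd ℂ (f x) ∂(normHaar G) :=
  ContinuousMap.inner_toLp (normHaar G) f h

theorem toL2_denseRange : DenseRange (toL2 : C(G, ℂ) → L2 G) :=
  ContinuousMap.toLp_denseRange ℂ (normHaar G) ℂ (by norm_num)

/-- The matrix of inner products of the `l`-th column of `U'` with the `j`-th column of `U`. -/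
def coefInner {n n' : ℕ} {U : G →* Matrix.unitaryGroup (Fin n) ℂ}
    {U' : G →* Matrix.unitaryGroup (Fin n') ℂ} (hU : Continuous U) (hU' : Continuous U')
    (j : Fin n) (l : Fin n') : Matrix (Fin n) (Fin n') ℂ :=
  Matrix.of fun i k => ⟪toL2 (repCoef hU' k l), toL2 (repCoef hU i j)⟫_ℂ

/-- Invariance of Haar measure under `g ↦ h * g` moves `h` from one factor of the integrand to the
other. -/
theorem coefInner_intertwines {n n' : ℕ} {U : G →* Matrix.unitaryGroup (Fin n) ℂ}
    {U' : G →* Matrix.unitaryGroup (Fin n') ℂ} (hU : Continuous U) (hU' : Continuous U')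
    (j : Fin n) (l : Fin n') (h : G) :
    (U h : Matrix (Fin n) (Fin n) ℂ) * coefInner hU hU' j l =
      coefInner hU hU' j l * (U' h : Matrix (Fin n') (Fin n') ℂ) := by
  ext i k
  have hint : ∀ (p : Fin n) (q : Fin n'), Integrable (fun g => repCoef hU p j g *
      starRingEnd ℂ (repCoef hU' q l g)) (normHaar G) := fun p q =>
    integrable_normHaar (repCoef hU p j * star (repCoef hU' q l))
  have h1 : ((U h : Matrix (Fin n) (Fin n) ℂ) * coefInner hU hU' j l) i k =
      ∫ g, repCoef hU i j (h * g) * starRingEnd ℂ (repCoef hU' k l g) ∂(normHaar G) := by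
    simp only [Matrix.mul_apply, coefInner, Matrix.of_apply, inner_toL2]
    simp_rw [← integral_const_mul]
    rw [← integral_finsetSum _ fun p _ => (hint p k).const_mul _]
    refine integral_congr_ae (Filter.Eventually.of_forall fun g => ?_)
    simp only [repCoef_mul, Finset.sum_mul]
    exact Finset.sum_congr rfl fun p _ => by rw [repCoef_apply hU i p, mul_assoc]
  have h2 : (coefInner hU hU' j l * (U' h : Matrix (Fin n') (Fin n') ℂ)) i k =
      ∫ g, repCoef hU i j g * starRingEnd ℂ (repCoef hU' k l (h⁻¹ * g)) ∂(normHaar G) := by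
    simp only [Matrix.mul_apply, coefInner, Matrix.of_apply, inner_toL2]
    simp_rw [← integral_mul_const]
    rw [← integral_finsetSum _ fun q _ => (hint i q).mul_const _]
    refine integral_congr_ae (Filter.Eventually.of_forall fun g => ?_)
    simp only [repCoef_mul, map_sum, map_mul, Finset.mul_sum]
    refine Finset.sum_congr rfl fun q _ => ?_
    rw [conj_repCoef hU' k q, inv_inv, repCoef_apply hU' q k]
    ring
  rw [h1, h2, ← integral_mul_left_eq_self (fun g => repCoef hU i j g *
    starRingEnd ℂ (repCoef hU' k l (h⁻¹ * g))) h]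
  simp only [inv_mul_cancel_left]

/-- Schur's lemma makes the matrix of inner products scalar; its trace is found by integrating the
orthonormality of the columns of `U g`. -/
theorem coefInner_self {n : ℕ} {U : G →* Matrix.unitaryGroup (Fin n) ℂ} (hU : Continuous U)
    (hirr : IsIrreducibleMatrixRep U) (i j k l : Fin n) :
    ⟪toL2 (repCoef hU k l), toL2 (repCoef hU i j)⟫_ℂ =
      if i = k ∧ j = l then (n : ℂ)⁻¹ else 0 := by
  obtain ⟨c, hc⟩ := hirr.eq_smul_one_of_commutes (coefInner_intertwines hU hU j l)
  have hentry : ∀ i k, ⟪toL2 (repCoef hU k l), toL2 (repCoef hU i j)⟫_ℂ =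
      c * (1 : Matrix (Fin n) (Fin n) ℂ) i k := fun i k => by
    have := congrFun (congrFun hc i) k
    simpa [coefInner] using this
  have htr : ∑ i, ⟪toL2 (repCoef hU i l), toL2 (repCoef hU i j)⟫_ℂ = if j = l then 1 else 0 := by
    simp only [inner_toL2]
    have hint : ∀ p, Integrable (fun g => repCoef hU p j g *
        starRingEnd ℂ (repCoef hU p l g)) (normHaar G) := fun p =>
      integrable_normHaar (repCoef hU p j * star (repCoef hU p l))
    rw [← integral_finsetSum _ fun p _ => hint p]
    have : ∀ g, ∑ p, repCoef hU p j g * starRingEnd ℂ (repCoef hU p l g) =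
        if j = l then 1 else 0 := by
      intro g
      have h1 := congrFun (congrFun (Matrix.mem_unitaryGroup_iff'.mp (U g).2) l) j
      rw [Matrix.mul_apply, Matrix.one_apply] at h1
      simp only [repCoef_apply]
      simp only [Matrix.star_apply] at h1
      rw [← if_congr (eq_comm (a := l) (b := j)) rfl rfl, ← h1]
      exact Finset.sum_congr rfl fun p _ => mul_comm _ _
    simp [this]
  have hn : (n : ℂ) ≠ 0 := Nat.cast_ne_zero.mpr hirr.1.ne'
  have hc' : c = if j = l then (n : ℂ)⁻¹ else 0 := by
    simp only [hentry] at htr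
    simp only [Matrix.one_apply_eq, mul_one, Finset.sum_const, Finset.card_univ, Fintype.card_fin,
      nsmul_eq_mul] at htr
    split_ifs at htr ⊢ with h
    · field_simp; rw [mul_comm]; exact htr
    · exact (mul_eq_zero.mp htr).resolve_left hn
  rw [hentry, hc', Matrix.one_apply]
  split_ifs <;> simp_all

theorem inner_toL2_repCoef_of_ne {n n' : ℕ} {U : G →* Matrix.unitaryGroup (Fin n) ℂ}
    {U' : G →* Matrix.unitaryGroup (Fin n') ℂ} (hU : Continuous U) (hU' : Continuous U')
    (hirr : IsIrreducibleMatrixRep U) (hirr' : IsIrreducibleMatrixRep U') (hn : n ≠ n')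
    (i j : Fin n) (k l : Fin n') : ⟪toL2 (repCoef hU' k l), toL2 (repCoef hU i j)⟫_ℂ = 0 := by
  have : coefInner hU hU' j l = 0 := by
    by_contra hne
    exact hn (hirr.exists_inverse_of_intertwines hirr' (coefInner_intertwines hU hU' j l) hne).1
  exact congrFun (congrFun this i) k

end Schur

/-! ### The irreducible representations of `SU(2)` and the core of the translation system. -/

section Classification

theorem dense_toL2_coefSpan :
    Dense (toL2 '' ((⨆ k, coefSpan k : Submodule ℂ C(SU2, ℂ)) : Set C(SU2, ℂ))) :=
  toL2_denseRange.dense_image toL2.continuous dense_iSup_coefSpan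

/-- Every continuous irreducible unitary representation of `SU(2)` is a symmetric power of the
fundamental representation. -/
theorem exists_equiv_symRep {n : ℕ} {U : SU2 →* Matrix.unitaryGroup (Fin n) ℂ}
    (hU : Continuous U) (hirr : IsIrreducibleMatrixRep U) :
    ∃ m, n = m + 1 ∧ ∃ (S : Matrix (Fin n) (Fin (m + 1)) ℂ) (T : Matrix (Fin (m + 1)) (Fin n) ℂ),
      S * T = 1 ∧ T * S = 1 ∧ ∀ g, (U g : Matrix (Fin n) (Fin n) ℂ) * S = S * symMatrix m g := by
  by_contra! hcon
  -- A representation inequivalent to every symmetric power has coefficients orthogonal to a dense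
  -- subspace, hence zero, although a diagonal coefficient has squared norm `1 / n`.
  have h0 : ∀ m j l, coefInner hU (continuous_symRep m) j l = 0 := by
    intro m j l
    by_contra hne
    obtain ⟨h1, T, h2, h3⟩ := hirr.exists_inverse_of_intertwines (isIrreducible_symRep m)
      (coefInner_intertwines hU (continuous_symRep m) j l) hne
    obtain ⟨g, hg⟩ := hcon m h1 _ T h2 h3
    exact hg (coefInner_intertwines hU (continuous_symRep m) j l g)
  let j : Fin n := ⟨0, hirr.1⟩
  have h1 : toL2 (repCoef hU j j) = 0 := by
    refine dense_toL2_coefSpan.eq_zero_of_inner_right ℂ ?_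
    rintro _ ⟨f, hf, rfl⟩
    have h : ⨆ k, coefSpan k ≤ ((ℂ ∙ toL2 (repCoef hU j j))ᗮ).comap
        (toL2 : C(SU2, ℂ) →L[ℂ] L2 SU2).toLinearMap := by
      refine iSup_le fun k => Submodule.span_le.mpr ?_
      rintro _ ⟨p, rfl⟩
      rw [SetLike.mem_coe, Submodule.mem_comap, Submodule.mem_orthogonal_singleton_iff_inner_left]
      exact congrFun (congrFun (h0 k j p.2) j) p.1
    exact Submodule.mem_orthogonal_singleton_iff_inner_left.mp (h hf)
  have h2 := coefInner_self hU hirr j j j j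
  rw [h1, inner_zero_left] at h2
  simp only [and_self, if_true] at h2
  exact inv_ne_zero (Nat.cast_ne_zero.mpr hirr.1.ne') h2.symm

theorem repCoef_mem_coefSpan_of_irreducible {n : ℕ} {U : SU2 →* Matrix.unitaryGroup (Fin n) ℂ}
    (hU : Continuous U) (hirr : IsIrreducibleMatrixRep U) :
    ∃ m, n = m + 1 ∧ ∀ i j, repCoef hU i j ∈ coefSpan m := by
  obtain ⟨m, hm, S, T, hST, -, h⟩ := exists_equiv_symRep hU hirr
  refine ⟨m, hm, fun i j => ?_⟩
  have h1 : repCoef hU i j =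
      ∑ l, ∑ k, (S i k * T l j) • repCoef (continuous_symRep m) k l := by
    ext g
    have h2 : (U g : Matrix (Fin n) (Fin n) ℂ) = S * symMatrix m g * T := by
      rw [← h, Matrix.mul_assoc, hST, Matrix.mul_one]
    rw [repCoef_apply, h2, Matrix.mul_apply, ContinuousMap.sum_apply]
    refine Finset.sum_congr rfl fun l _ => ?_
    rw [Matrix.mul_apply, Finset.sum_mul, ContinuousMap.sum_apply]
    refine Finset.sum_congr rfl fun k _ => ?_
    rw [ContinuousMap.smul_apply, repCoef_apply, coe_symRep, smul_eq_mul]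
    ring
  rw [h1]
  exact sum_mem fun l _ => sum_mem fun k _ => Submodule.smul_mem _ _ (repCoef_mem_coefSpan k l)

theorem matrixEntryAlgebra_le_entryAlgebra : matrixEntryAlgebra SU2 ≤ entryAlgebra := by
  refine StarAlgebra.adjoin_le ?_
  rintro f ⟨n, U, hU, hirr, i, j, hf⟩
  obtain ⟨m, -, h⟩ := repCoef_mem_coefSpan_of_irreducible hU hirr
  have : f = repCoef hU i j := by
    ext g
    exact hf g
  rw [this]
  exact coefSpan_le_entryAlgebra m (h i j)

theorem symMatrix_one_eq (g : Matrix (Fin 2) (Fin 2) ℂ) : symMatrix 1 g = g := by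
  ext i j
  fin_cases i <;> fin_cases j <;>
    simp [symMatrix_apply, symEntry, symPoly, sqrtChoose, Polynomial.coeff_X]

theorem entry_mem_matrixEntryAlgebra (r s : Fin 2) : entry r s ∈ matrixEntryAlgebra SU2 := by
  refine StarAlgebra.subset_adjoin ℂ _ ⟨2, symRep 1, continuous_symRep 1, isIrreducible_symRep 1,
    r, s, fun g => ?_⟩
  rw [coe_symRep, symMatrix_one_eq]
  rfl

/-- Matrix multiplication itself writes the translate of an entry as a finite sum of tensors. -/
theorem entry_mem_core (r s : Fin 2) : entry r s ∈ (translationSystem SU2).core := by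
  have h : (fun g => (translationSystem SU2).τ g (entry r s)) =
      ∑ k, fun g : SU2 => entry k s g • entry r k := by
    ext g x
    rw [Finset.sum_apply, ContinuousMap.sum_apply]
    exact Matrix.mul_apply.trans (Finset.sum_congr rfl fun k _ =>
      mul_comm (entry r k x) (entry k s g))
  change (fun g => (translationSystem SU2).τ g (entry r s)) ∈ algTensor SU2 C(SU2, ℂ)
  rw [h]
  exact sum_mem fun k _ => Submodule.subset_span
    ⟨entry r k, entry k s, entry_mem_matrixEntryAlgebra k s, rfl⟩

/-- Evaluating the translates at the identity recovers `a`, since `a g = (τ g a) 1`, and turns an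
algebraic tensor into an element of `A(G)`. -/
theorem mem_entryAlgebra_of_mem_core {a : C(SU2, ℂ)} (ha : a ∈ (translationSystem SU2).core) :
    a ∈ entryAlgebra := by
  have key : ∀ F ∈ algTensor SU2 C(SU2, ℂ), ∃ f ∈ matrixEntryAlgebra SU2, ∀ g, F g 1 = f g := by
    intro F hF
    unfold algTensor at hF
    induction hF using Submodule.span_induction with
    | zero => exact ⟨0, zero_mem _, fun g => rfl⟩
    | add x y _ _ hx hy =>
      obtain ⟨f, hf, hf'⟩ := hx
      obtain ⟨k, hk, hk'⟩ := hy
      exact ⟨f + k, add_mem hf hk, fun g => by simp [hf', hk']⟩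
    | smul c x _ hx =>
      obtain ⟨f, hf, hf'⟩ := hx
      exact ⟨c • f, (matrixEntryAlgebra SU2).smul_mem hf c, fun g => by simp [hf']⟩
    | mem x hx =>
      obtain ⟨c, f, hf, rfl⟩ := hx
      exact ⟨c 1 • f, (matrixEntryAlgebra SU2).smul_mem hf _, fun g => by simp [mul_comm]⟩
  obtain ⟨f, hf, h⟩ := key _ ha
  have : a = f := by
    ext g
    rw [← h g]
    change a g = a (1 * g)
    rw [one_mul]
  rw [this]
  exact matrixEntryAlgebra_le_entryAlgebra hf

end Classification

/-! ### Peter–Weyl bases from arbitrary representatives. -/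

section PeterWeyl

theorem PeterWeylBasis.e_eq_toL2 (B : PeterWeylBasis) (m : ℕ) (i j : Fin (m + 1)) :
    B.e ⟨m, (i, j)⟩ = (Real.sqrt (m + 1) : ℂ) • toL2 (repCoef (B.continuous_U m) i j) := by
  ext1
  filter_upwards [B.e_eq m i j, Lp.coeFn_smul (Real.sqrt (m + 1) : ℂ)
    (toL2 (repCoef (B.continuous_U m) i j)), coeFn_toL2 (repCoef (B.continuous_U m) i j)]
    with x h1 h2 h3
  rw [h1, h2, Pi.smul_apply, h3, smul_eq_mul, repCoef_apply]

theorem sqrt_succ_ne_zero (m : ℕ) : (Real.sqrt (m + 1) : ℂ) ≠ 0 := by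
  rw [Complex.ofReal_ne_zero]
  positivity

variable {U : ∀ m : ℕ, SU2 →* Matrix.unitaryGroup (Fin (m + 1)) ℂ}

theorem orthonormal_repCoef (hU : ∀ m, Continuous (U m))
    (hirr : ∀ m, IsIrreducibleMatrixRep (U m)) :
    Orthonormal ℂ fun p : Σ m : ℕ, Fin (m + 1) × Fin (m + 1) =>
      (Real.sqrt (p.1 + 1) : ℂ) • toL2 (repCoef (hU p.1) p.2.1 p.2.2) := by
  classical
  rw [orthonormal_iff_ite]
  rintro ⟨m, i, j⟩ ⟨m', i', j'⟩
  rw [inner_smul_left, inner_smul_right, Complex.conj_ofReal]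
  by_cases hm : m = m'
  · subst hm
    rw [coefInner_self (hU m) (hirr m)]
    have h2 : (Real.sqrt (m + 1) : ℂ) * Real.sqrt (m + 1) = m + 1 := by
      rw [← Complex.ofReal_mul, Real.mul_self_sqrt (by positivity)]
      push_cast; rfl
    have h3 : (m : ℂ) + 1 ≠ 0 := by exact_mod_cast Nat.succ_ne_zero m
    by_cases h : i' = i ∧ j' = j
    · obtain ⟨rfl, rfl⟩ := h
      simp only [and_self, if_true]
      rw [← mul_assoc, h2]
      push_cast
      exact mul_inv_cancel₀ h3
    · rw [if_neg h, if_neg, mul_zero, mul_zero]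
      simp only [Sigma.mk.injEq, heq_eq_eq, true_and, Prod.mk.injEq]
      exact fun h' => h ⟨h'.1.symm, h'.2.symm⟩
  · rw [if_neg (fun h => hm (congrArg Sigma.fst h))]
    rw [inner_toL2_repCoef_of_ne (hU m') (hU m) (hirr m') (hirr m) (by omega), mul_zero, mul_zero]

/-- Equivalent representations have the same span of coefficients, so completeness transfers from
the symmetric powers to any choice of representatives. -/
theorem repCoef_symRep_mem_span {m : ℕ} {V : SU2 →* Matrix.unitaryGroup (Fin (m + 1)) ℂ}
    (hV : Continuous V) (hirr : IsIrreducibleMatrixRep V) (i j : Fin (m + 1)) :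
    repCoef (continuous_symRep m) i j ∈
      Submodule.span ℂ (Set.range fun p : Fin (m + 1) × Fin (m + 1) => repCoef hV p.1 p.2) := by
  obtain ⟨m', hm, S, T, -, hTS, h⟩ := exists_equiv_symRep hV hirr
  obtain rfl : m = m' := by omega
  have h1 : repCoef (continuous_symRep m) i j =
      ∑ l, ∑ k, (T i k * S l j) • repCoef hV k l := by
    ext g
    have h2 : symMatrix m g = T * (V g : Matrix (Fin (m + 1)) (Fin (m + 1)) ℂ) * S := by
      rw [Matrix.mul_assoc, h, ← Matrix.mul_assoc, hTS, Matrix.one_mul]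
    rw [repCoef_apply, coe_symRep, h2, Matrix.mul_apply, ContinuousMap.sum_apply]
    refine Finset.sum_congr rfl fun l _ => ?_
    rw [Matrix.mul_apply, Finset.sum_mul, ContinuousMap.sum_apply]
    refine Finset.sum_congr rfl fun k _ => ?_
    rw [ContinuousMap.smul_apply, repCoef_apply, smul_eq_mul]
    ring
  rw [h1]
  exact sum_mem fun l _ => sum_mem fun k _ =>
    Submodule.smul_mem _ _ (Submodule.subset_span ⟨(k, l), rfl⟩)

theorem dense_span_repCoef (hU : ∀ m, Continuous (U m))
    (hirr : ∀ m, IsIrreducibleMatrixRep (U m)) :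
    ⊤ ≤ (Submodule.span ℂ (Set.range fun p : Σ m : ℕ, Fin (m + 1) × Fin (m + 1) =>
      (Real.sqrt (p.1 + 1) : ℂ) •
        toL2 (repCoef (hU p.1) p.2.1 p.2.2))).topologicalClosure := by
  rw [top_le_iff, ← Submodule.dense_iff_topologicalClosure_eq_top]
  refine dense_toL2_coefSpan.mono ?_
  rintro _ ⟨f, hf, rfl⟩
  set W := Submodule.span ℂ (Set.range fun p : Σ m : ℕ, Fin (m + 1) × Fin (m + 1) =>
      (Real.sqrt (p.1 + 1) : ℂ) • toL2 (repCoef (hU p.1) p.2.1 p.2.2)) with hW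
  have h : ⨆ k, coefSpan k ≤ W.comap (toL2 : C(SU2, ℂ) →L[ℂ] L2 SU2).toLinearMap := by
    refine iSup_le fun m => Submodule.span_le.mpr ?_
    rintro _ ⟨p, rfl⟩
    have h1 := repCoef_symRep_mem_span (hU m) (hirr m) p.1 p.2
    have h2 : Submodule.span ℂ (Set.range fun p : Fin (m + 1) × Fin (m + 1) =>
        repCoef (hU m) p.1 p.2) ≤ W.comap (toL2 : C(SU2, ℂ) →L[ℂ] L2 SU2).toLinearMap := by
      refine Submodule.span_le.mpr ?_
      rintro _ ⟨q, rfl⟩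
      exact (W.smul_mem_iff (sqrt_succ_ne_zero m)).mp (Submodule.subset_span ⟨⟨m, q⟩, rfl⟩)
    exact h2 h1
  exact h hf

/-- The Peter–Weyl basis formed by the entries of one irreducible representation in each
dimension. -/
def PeterWeylBasis.ofReps (hU : ∀ m, Continuous (U m))
    (hirr : ∀ m, IsIrreducibleMatrixRep (U m)) : PeterWeylBasis where
  U := U
  continuous_U := hU
  irreducible_U := hirr
  e := HilbertBasis.mk (orthonormal_repCoef hU hirr) (dense_span_repCoef hU hirr)
  e_eq m i j := by
    rw [HilbertBasis.coe_mk]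
    filter_upwards [Lp.coeFn_smul (Real.sqrt (m + 1) : ℂ) (toL2 (repCoef (hU m) i j)),
      coeFn_toL2 (repCoef (hU m) i j)] with x h2 h3
    rw [h2, Pi.smul_apply, h3, smul_eq_mul, repCoef_apply]

/-- The Peter–Weyl basis of the symmetric powers. -/
def symBasis : PeterWeylBasis := PeterWeylBasis.ofReps continuous_symRep isIrreducible_symRep

end PeterWeyl

/-! ### Self-adjoint operators diagonal in a Hilbert basis, and bounded commutators. -/

section DiagonalOperators

set_option linter.unusedSectionVars false

universe u

variable {H : Type u} [NormedAddCommGroup H] [InnerProductSpace ℂ H] [CompleteSpace H]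
  {ι : Type*}

theorem IsSelfAdjoint.inner_map_left {D : H →ₗ.[ℂ] H} (hD : IsSelfAdjoint D) (x y : D.domain) :
    ⟪D x, (y : H)⟫_ℂ = ⟪(x : H), D y⟫_ℂ := by
  have h := LinearPMap.adjoint_isFormalAdjoint hD.dense_domain
  rw [LinearPMap.isSelfAdjoint_def.mp hD] at h
  exact h x y

/-- The maximality contained in `D = D*`: a weak solution already lies in the domain. It replaces
all approximation arguments for the unbounded `D`. -/
theorem IsSelfAdjoint.mem_domain_of_forall_inner {D : H →ₗ.[ℂ] H} (hD : IsSelfAdjoint D) {y w : H}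
    (h : ∀ x : D.domain, ⟪w, (x : H)⟫_ℂ = ⟪y, D x⟫_ℂ) :
    ∃ hy : y ∈ D.domain, D ⟨y, hy⟩ = w := by
  have h1 := LinearPMap.mem_adjoint_domain_of_exists (T := D) y ⟨w, h⟩
  have h2 := LinearPMap.adjoint_apply_eq hD.dense_domain ⟨y, h1⟩ h
  have h3 : (⟨y, w⟩ : H × H) ∈ (LinearPMap.adjoint D).graph :=
    (LinearPMap.mem_graph_iff _).mpr ⟨⟨y, h1⟩, rfl, h2⟩
  rw [LinearPMap.isSelfAdjoint_def.mp hD] at h3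
  obtain ⟨⟨y', hy⟩, rfl, h4⟩ := (LinearPMap.mem_graph_iff _).mp h3
  exact ⟨hy, h4⟩

theorem HilbertBasis.ext_inner (e : HilbertBasis ι ℂ H) {x y : H}
    (h : ∀ i, ⟪e i, x⟫_ℂ = ⟪e i, y⟫_ℂ) : x = y := by
  refine e.repr.injective (lp.ext (funext fun i => ?_))
  rw [e.repr_apply_apply, e.repr_apply_apply, h]

/-- `D` is diagonal in the Hilbert basis `e` with eigenvalues `d`. -/
def IsDiagonalIn (D : H →ₗ.[ℂ] H) (e : HilbertBasis ι ℂ H) (d : ι → ℝ) : Prop :=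
  ∀ i, ∃ h : e i ∈ D.domain, D ⟨e i, h⟩ = (d i : ℂ) • e i

/-- The graph of a diagonal self-adjoint operator. -/
theorem IsDiagonalIn.graph_iff {D : H →ₗ.[ℂ] H} {e : HilbertBasis ι ℂ H} {d : ι → ℝ}
    (h : IsDiagonalIn D e d) (hD : IsSelfAdjoint D) {x w : H} :
    (∃ hx : x ∈ D.domain, D ⟨x, hx⟩ = w) ↔ ∀ i, ⟪e i, w⟫_ℂ = d i * ⟪e i, x⟫_ℂ := by
  constructor
  · rintro ⟨hx, rfl⟩ i
    obtain ⟨hi, hi'⟩ := h i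
    have := hD.inner_map_left ⟨e i, hi⟩ ⟨x, hx⟩
    rw [hi', inner_smul_left, Complex.conj_ofReal] at this
    exact this.symm
  · intro hw
    refine hD.mem_domain_of_forall_inner fun y => ?_
    refine (e.hasSum_inner_mul_inner w y).unique ?_
    convert e.hasSum_inner_mul_inner x (D y) using 2 with i
    obtain ⟨hi, hi'⟩ := h i
    have h1 := hD.inner_map_left ⟨e i, hi⟩ y
    rw [hi', inner_smul_left, Complex.conj_ofReal] at h1
    rw [← h1, ← inner_conj_symm w, hw, map_mul, Complex.conj_ofReal, inner_conj_symm]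
    ring

theorem IsDiagonalIn.inner_apply {D : H →ₗ.[ℂ] H} {e : HilbertBasis ι ℂ H} {d : ι → ℝ}
    (h : IsDiagonalIn D e d) (hD : IsSelfAdjoint D) (x : D.domain) (i : ι) :
    ⟪e i, D x⟫_ℂ = d i * ⟪e i, (x : H)⟫_ℂ :=
  (h.graph_iff hD).mp ⟨x.2, rfl⟩ i

/-- The maximal diagonal operator with eigenvalues `d`. -/
def diagPMap (e : HilbertBasis ι ℂ H) (d : ι → ℝ) : H →ₗ.[ℂ] H where
  domain :=
    { carrier := {x | ∃ w : H, ∀ i, ⟪e i, w⟫_ℂ = d i * ⟪e i, x⟫_ℂ}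
      add_mem' := by
        rintro x y ⟨w, hw⟩ ⟨v, hv⟩
        exact ⟨w + v, fun i => by rw [inner_add_right, inner_add_right, hw, hv, mul_add]⟩
      zero_mem' := ⟨0, by simp⟩
      smul_mem' := by
        rintro c x ⟨w, hw⟩
        exact ⟨c • w, fun i => by rw [inner_smul_right, inner_smul_right, hw, mul_left_comm]⟩ }
  toFun :=
    { toFun := fun x => x.2.choose
      map_add' := fun x y => e.ext_inner fun i => by
        rw [inner_add_right, x.2.choose_spec, y.2.choose_spec, (x + y).2.choose_spec,
          Submodule.coe_add, inner_add_right, mul_add]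
      map_smul' := fun c x => e.ext_inner fun i => by
        rw [RingHom.id_apply, inner_smul_right, x.2.choose_spec, (c • x).2.choose_spec,
          Submodule.coe_smul, inner_smul_right, mul_left_comm] }

theorem inner_diagPMap (e : HilbertBasis ι ℂ H) (d : ι → ℝ) (x : (diagPMap e d).domain) (i : ι) :
    ⟪e i, diagPMap e d x⟫_ℂ = d i * ⟪e i, (x : H)⟫_ℂ :=
  x.2.choose_spec i

theorem HilbertBasis.inner_eq_ite [DecidableEq ι] (e : HilbertBasis ι ℂ H) (i j : ι) :
    ⟪e i, e j⟫_ℂ = if i = j then 1 else 0 :=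
  orthonormal_iff_ite.mp e.orthonormal i j

theorem isDiagonalIn_diagPMap (e : HilbertBasis ι ℂ H) (d : ι → ℝ) :
    IsDiagonalIn (diagPMap e d) e d := by
  classical
  intro i
  have h : e i ∈ (diagPMap e d).domain := by
    refine ⟨(d i : ℂ) • e i, fun j => ?_⟩
    rw [inner_smul_right, e.inner_eq_ite]
    split_ifs with hij
    · rw [hij]
    · simp
  refine ⟨h, e.ext_inner fun j => ?_⟩
  rw [inner_diagPMap, inner_smul_right, e.inner_eq_ite]
  split_ifs with hij
  · rw [hij]
  · simp

/-- The domain is the largest on which the coefficients make sense; testing the adjoint on basis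
vectors shows that its domain is no larger. -/
theorem isSelfAdjoint_diagPMap (e : HilbertBasis ι ℂ H) (d : ι → ℝ) :
    IsSelfAdjoint (diagPMap e d) := by
  have hdense : Dense ((diagPMap e d).domain : Set H) := by
    have h1 : Submodule.span ℂ (Set.range e) ≤ (diagPMap e d).domain := by
      refine Submodule.span_le.mpr ?_
      rintro _ ⟨i, rfl⟩
      exact (isDiagonalIn_diagPMap e d i).1
    exact ((Submodule.dense_iff_topologicalClosure_eq_top).mpr e.dense_span).mono h1
  have hsymm : (diagPMap e d).IsFormalAdjoint (diagPMap e d) := by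
    intro x y
    refine (e.hasSum_inner_mul_inner _ _).unique ?_
    convert e.hasSum_inner_mul_inner (x : H) (diagPMap e d y) using 2 with i
    rw [inner_diagPMap, ← inner_conj_symm _ (e i), inner_diagPMap, map_mul, Complex.conj_ofReal,
      inner_conj_symm]
    ring
  rw [LinearPMap.isSelfAdjoint_def]
  refine (LinearPMap.eq_of_le_of_domain_eq (hsymm.le_adjoint hdense) ?_).symm
  refine le_antisymm (hsymm.le_adjoint hdense).1 fun y hy => ?_
  refine ⟨(diagPMap e d).adjoint ⟨y, hy⟩, fun i => ?_⟩
  obtain ⟨hi, hi'⟩ := isDiagonalIn_diagPMap e d i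
  have h := LinearPMap.adjoint_isFormalAdjoint hdense ⟨y, hy⟩ ⟨e i, hi⟩
  rw [hi', inner_smul_right] at h
  rw [← inner_conj_symm, h, map_mul, Complex.conj_ofReal, inner_conj_symm]

theorem memℓp_mul_repr (e : HilbertBasis ι ℂ H) {c : ι → ℂ} {C : ℝ} (hc : ∀ i, ‖c i‖ ≤ C) (x : H) :
    Memℓp (fun i => c i * e.repr x i) 2 := by
  refine memℓp_gen ?_
  have h := (lp.memℓp (e.repr x)).summable (by norm_num)
  simp only [ENNReal.toReal_ofNat, Real.rpow_ofNat] at h ⊢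
  refine (h.mul_left (C ^ 2)).of_nonneg_of_le (fun i => by positivity) fun i => ?_
  rw [norm_mul, mul_pow]
  gcongr
  exact hc i

/-- The bounded diagonal operator with eigenvalues `c`. -/
def diagOp (e : HilbertBasis ι ℂ H) (c : ι → ℂ) (C : ℝ) (hc : ∀ i, ‖c i‖ ≤ C) : H →L[ℂ] H :=
  LinearMap.mkContinuous
    { toFun := fun x => e.repr.symm ⟨fun i => c i * e.repr x i, memℓp_mul_repr e hc x⟩
      map_add' := fun x y => by
        rw [← map_add]
        congr 1
        ext i
        simp [mul_add]
        rfl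
      map_smul' := fun a x => by
        rw [RingHom.id_apply, ← map_smul]
        congr 1
        ext i
        simp [mul_left_comm] }
    (max C 0) (fun x => by
      rw [LinearMap.coe_mk, AddHom.coe_mk, LinearIsometryEquiv.norm_map, ← e.repr.norm_map x]
      refine abs_le_of_sq_le_sq' ?_ (by positivity) |>.2
      rw [mul_pow]
      have h1 := fun f : lp (fun _ : ι => ℂ) 2 => lp.norm_rpow_eq_tsum (p := 2) (by norm_num) f
      simp only [ENNReal.toReal_ofNat, Real.rpow_ofNat] at h1
      have h := (lp.memℓp (e.repr x)).summable (by norm_num)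
      have h' := (memℓp_mul_repr e hc x).summable (by norm_num)
      simp only [ENNReal.toReal_ofNat, Real.rpow_ofNat] at h h'
      rw [h1, h1, ← tsum_mul_left]
      refine h'.tsum_le_tsum (fun i => ?_) (h.mul_left _)
      rw [norm_mul, mul_pow]
      gcongr
      exact (hc i).trans (le_max_left _ _))

theorem inner_diagOp (e : HilbertBasis ι ℂ H) {c : ι → ℂ} {C : ℝ} (hc : ∀ i, ‖c i‖ ≤ C) (x : H)
    (i : ι) : ⟪e i, diagOp e c C hc x⟫_ℂ = c i * ⟪e i, x⟫_ℂ := by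
  rw [← e.repr_apply_apply, ← e.repr_apply_apply]
  simp [diagOp]

theorem norm_diagOp_le (e : HilbertBasis ι ℂ H) {c : ι → ℂ} {C : ℝ} (hc : ∀ i, ‖c i‖ ≤ C)
    (hC : 0 ≤ C) : ‖diagOp e c C hc‖ ≤ C := by
  refine (LinearMap.mkContinuous_norm_le _ (le_max_right _ _) _).trans ?_
  rw [max_eq_left hC]

theorem diagOp_basis (e : HilbertBasis ι ℂ H) {c : ι → ℂ} {C : ℝ} (hc : ∀ i, ‖c i‖ ≤ C) (i : ι) :
    diagOp e c C hc (e i) = c i • e i := by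
  classical
  refine e.ext_inner fun j => ?_
  rw [inner_diagOp, inner_smul_right, e.inner_eq_ite]
  split_ifs with h
  · rw [h]
  · simp

/-- Norm limit of finite-rank truncations: removing the finitely many large eigenvalues leaves a
diagonal operator of small norm. -/
theorem isCompactOperator_diagOp (e : HilbertBasis ι ℂ H) {c : ι → ℂ} {C : ℝ}
    (hc : ∀ i, ‖c i‖ ≤ C) (hlim : Filter.Tendsto c Filter.cofinite (nhds 0)) :
    IsCompactOperator (diagOp e c C hc) := by
  classical
  let F : Finset ι → H →L[ℂ] H := fun s => ∑ i ∈ s, (innerSL ℂ (e i)).smulRight (c i • e i)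
  have hF : ∀ s, IsCompactOperator (F s) := by
    intro s
    have : ∀ i, IsCompactOperator ((innerSL ℂ (e i)).smulRight (c i • e i)) := fun i => by
      have h1 : IsCompactOperator (innerSL ℂ (e i)) :=
        isCompactOperator_of_locallyCompactSpace_dom (innerSL ℂ (e i))
      exact h1.clm_comp (ContinuousLinearMap.toSpanSingleton ℂ (c i • e i))
    have h2 : F s ∈ compactOperator (RingHom.id ℂ) H H := sum_mem fun i _ => this i
    exact h2
  refine isCompactOperator_of_tendsto (l := Filter.atTop) (F := F) ?_
    (Filter.Eventually.of_forall hF)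
  rw [Metric.tendsto_atTop]
  intro ε hε
  have hfin : {i | ¬ ‖c i‖ < ε / 2}.Finite := by
    have := (Metric.tendsto_nhds.mp hlim) (ε / 2) (by positivity)
    simpa [Filter.eventually_cofinite, dist_zero_right] using this
  refine ⟨hfin.toFinset, fun s hs => ?_⟩
  have hc' : ∀ i, ‖(if i ∈ s then 0 else c i)‖ ≤ ε / 2 := by
    intro i
    split_ifs with h
    · simp; positivity
    · by_contra hcon
      exact h (hs (hfin.mem_toFinset.mpr (fun h' => hcon h'.le)))
  have hd : diagOp e c C hc - F s = diagOp e (fun i => if i ∈ s then 0 else c i) (ε / 2) hc' := by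
    ext x
    refine e.ext_inner fun i => ?_
    rw [sub_apply, inner_sub_right, inner_diagOp, inner_diagOp, sum_apply, inner_sum]
    have : ∀ j ∈ s, ⟪e i, ((innerSL ℂ (e j)).smulRight (c j • e j)) x⟫_ℂ =
        if i = j then c i * ⟪e i, x⟫_ℂ else 0 := by
      intro j _
      rw [ContinuousLinearMap.smulRight_apply, innerSL_apply_apply, inner_smul_right,
        inner_smul_right, e.inner_eq_ite]
      split_ifs with h
      · rw [h]; ring
      · simp
    rw [Finset.sum_congr rfl this, Finset.sum_ite_eq]
    split_ifs <;> simp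
  rw [dist_comm, dist_eq_norm, hd]
  exact (norm_diagOp_le e hc' (by positivity)).trans_lt (by linarith)

theorem IsDiagonalIn.hasCompactResolvent {D : H →ₗ.[ℂ] H} {e : HilbertBasis ι ℂ H} {d : ι → ℝ}
    (h : IsDiagonalIn D e d) (hD : IsSelfAdjoint D)
    (hlim : Filter.Tendsto (fun i => |d i|) Filter.cofinite Filter.atTop) :
    HasCompactResolvent D := by
  have hne : ∀ i, (d i : ℂ) - Complex.I ≠ 0 := fun i h0 => by
    simpa using congrArg Complex.im h0
  have him : ∀ i, 1 ≤ ‖(d i : ℂ) - Complex.I‖ := fun i => by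
    have := Complex.abs_im_le_norm ((d i : ℂ) - Complex.I)
    simpa using this
  have hc : ∀ i, ‖((d i : ℂ) - Complex.I)⁻¹‖ ≤ 1 := fun i => by
    rw [norm_inv]
    exact inv_le_one_of_one_le₀ (him i)
  -- At `z = i` the resolvent exists whatever the real numbers `d i` are, with norm at most 1.
  refine ⟨Complex.I, diagOp e (fun i => ((d i : ℂ) - Complex.I)⁻¹) 1 hc, ⟨fun y => ?_, fun x => ?_⟩,
    isCompactOperator_diagOp e hc ?_⟩
  · obtain ⟨hx, hx'⟩ := (h.graph_iff hD
      (x := diagOp e (fun i => ((d i : ℂ) - Complex.I)⁻¹) 1 hc y)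
      (w := y + Complex.I • diagOp e (fun i => ((d i : ℂ) - Complex.I)⁻¹) 1 hc y)).mpr fun i => by
        rw [inner_add_right, inner_smul_right, inner_diagOp]
        have := hne i
        field_simp
        ring
    exact ⟨hx, by rw [hx']; simp⟩
  · refine e.ext_inner fun i => ?_
    rw [inner_diagOp, inner_sub_right, inner_smul_right, h.inner_apply hD, ← sub_mul, ← mul_assoc,
      inv_mul_cancel₀ (hne i), one_mul]
  · rw [tendsto_zero_iff_norm_tendsto_zero]
    simp only [norm_inv]
    refine Filter.Tendsto.inv_tendsto_atTop (Filter.tendsto_atTop_mono (fun i => ?_) hlim)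
    have := Complex.abs_re_le_norm ((d i : ℂ) - Complex.I)
    simpa using this

/-- `IsDiagonalIn.graph_iff` reduces both membership in the domain and the value to coefficients, so
agreement of matrix entries with those of a bounded `K` is enough. -/
theorem IsDiagonalIn.commutator_of_inner {D : H →ₗ.[ℂ] H} {e : HilbertBasis ι ℂ H} {d : ι → ℝ}
    (h : IsDiagonalIn D e d) (hD : IsSelfAdjoint D) {S K : H →L[ℂ] H}
    (hSK : ∀ i j, ((d i : ℂ) - d j) * ⟪e i, S (e j)⟫_ℂ = ⟪e i, K (e j)⟫_ℂ) (x : D.domain) :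
    ∃ hx : S (x : H) ∈ D.domain, D ⟨S (x : H), hx⟩ = S (D x) + K x := by
  refine (h.graph_iff hD).mpr fun i => ?_
  have h1 : ∀ (R : H →L[ℂ] H) (y : H), HasSum (fun j => ⟪e i, R (e j)⟫_ℂ * ⟪e j, y⟫_ℂ)
      ⟪e i, R y⟫_ℂ := by
    intro R y
    have := e.hasSum_inner_mul_inner (R.adjoint (e i)) y
    simpa only [ContinuousLinearMap.adjoint_inner_left] using this
  rw [inner_add_right]
  refine ((h1 S (D x)).add (h1 K x)).unique ?_
  have h2 : (fun j => ⟪e i, S (e j)⟫_ℂ * ⟪e j, D x⟫_ℂ + ⟪e i, K (e j)⟫_ℂ * ⟪e j, (x : H)⟫_ℂ) =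
      fun j => (d i : ℂ) * (⟪e i, S (e j)⟫_ℂ * ⟪e j, (x : H)⟫_ℂ) := by
    funext j
    rw [h.inner_apply hD, ← hSK]
    ring
  rw [h2]
  exact (h1 S x).mul_left (d i : ℂ)

theorem IsDiagonalIn.hasBoundedCommutator {D : H →ₗ.[ℂ] H} {e : HilbertBasis ι ℂ H} {d : ι → ℝ}
    (h : IsDiagonalIn D e d) (hD : IsSelfAdjoint D) {S K : H →L[ℂ] H}
    (hSK : ∀ i j, ((d i : ℂ) - d j) * ⟪e i, S (e j)⟫_ℂ = ⟪e i, K (e j)⟫_ℂ) :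
    HasBoundedCommutator D S := by
  refine ⟨fun x => (h.commutator_of_inner hD hSK x).1, ‖K‖, fun x => ?_⟩
  rw [(h.commutator_of_inner hD hSK x).2, add_sub_cancel_left]
  exact K.le_opNorm _

theorem HasBoundedCommutator.mul {D : H →ₗ.[ℂ] H} {S T : H →L[ℂ] H}
    (hS : HasBoundedCommutator D S) (hT : HasBoundedCommutator D T) :
    HasBoundedCommutator D (S * T) := by
  obtain ⟨h1, C1, hC1⟩ := hS
  obtain ⟨h2, C2, hC2⟩ := hT
  refine ⟨fun x => h1 ⟨_, h2 x⟩, |C1| * ‖T‖ + ‖S‖ * C2, fun x => ?_⟩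
  have h3 := hC1 ⟨_, h2 x⟩
  have h4 : D ⟨(S * T) (x : H), h1 ⟨_, h2 x⟩⟩ - (S * T) (D x) =
      (D ⟨S (T (x : H)), h1 ⟨_, h2 x⟩⟩ - S (D ⟨T (x : H), h2 x⟩)) +
        S (D ⟨T (x : H), h2 x⟩ - T (D x)) := by
    rw [map_sub]
    simp [mul_apply_eq_comp]
  rw [h4]
  refine (norm_add_le _ _).trans ?_
  rw [add_mul]
  gcongr
  · refine h3.trans ?_
    rw [mul_assoc]
    exact mul_le_mul (le_abs_self _) (T.le_opNorm _) (norm_nonneg _) (abs_nonneg _)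
  · rw [mul_assoc]
    exact (S.le_opNorm _).trans (mul_le_mul_of_nonneg_left (hC2 x) (norm_nonneg _))

theorem HasBoundedCommutator.add {D : H →ₗ.[ℂ] H} {S T : H →L[ℂ] H}
    (hS : HasBoundedCommutator D S) (hT : HasBoundedCommutator D T) :
    HasBoundedCommutator D (S + T) := by
  obtain ⟨h1, C1, hC1⟩ := hS
  obtain ⟨h2, C2, hC2⟩ := hT
  refine ⟨fun x => D.domain.add_mem (h1 x) (h2 x), C1 + C2, fun x => ?_⟩
  have h3 : D ⟨(S + T) (x : H), D.domain.add_mem (h1 x) (h2 x)⟩ =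
      D ⟨S (x : H), h1 x⟩ + D ⟨T (x : H), h2 x⟩ := by
    rw [← LinearPMap.map_add]; rfl
  rw [h3, add_apply, add_sub_add_comm, add_mul]
  exact (norm_add_le _ _).trans (add_le_add (hC1 x) (hC2 x))

theorem HasBoundedCommutator.smul {D : H →ₗ.[ℂ] H} {S : H →L[ℂ] H} (c : ℂ)
    (hS : HasBoundedCommutator D S) : HasBoundedCommutator D (c • S) := by
  obtain ⟨h1, C1, hC1⟩ := hS
  refine ⟨fun x => D.domain.smul_mem c (h1 x), ‖c‖ * C1, fun x => ?_⟩
  have h3 : D ⟨(c • S) (x : H), D.domain.smul_mem c (h1 x)⟩ = c • D ⟨S (x : H), h1 x⟩ := by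
    rw [← LinearPMap.map_smul]; rfl
  rw [h3, smul_apply, ← smul_sub, norm_smul, mul_assoc]
  exact mul_le_mul_of_nonneg_left (hC1 x) (norm_nonneg _)

theorem HasBoundedCommutator.one (D : H →ₗ.[ℂ] H) : HasBoundedCommutator D 1 :=
  ⟨fun x => x.2, 0, fun x => by simp⟩

end DiagonalOperators

/-! ### Summability in terms of eigenvalues. -/

section Summability

set_option linter.unusedSectionVars false

universe u

variable {H : Type u} [NormedAddCommGroup H] [InnerProductSpace ℂ H] [CompleteSpace H]

/-- The continuous functional calculus on an eigenvector. -/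
theorem cfc_apply_eigenvector {T : H →L[ℂ] H} (hT : IsSelfAdjoint T) {v : H} {c : ℝ}
    (hv : T v = (c : ℂ) • v) (hv0 : v ≠ 0) (f : ℝ → ℝ) (hf : ContinuousOn f (spectrum ℝ T)) :
    cfc f T v = (f c : ℂ) • v := by
  have hc : c ∈ spectrum ℝ T := by
    rw [spectrum.mem_iff]
    intro hu
    obtain ⟨u, hu⟩ := hu
    have h1 : (u : H →L[ℂ] H) v = 0 := by
      rw [hu, sub_apply, hv, Algebra.algebraMap_eq_smul_one]
      simp
    have h2 : ((u⁻¹ : (H →L[ℂ] H)ˣ) * u : H →L[ℂ] H) v = v := by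
      rw [Units.inv_mul]; rfl
    rw [mul_apply_eq_comp, h1, map_zero] at h2
    exact hv0 h2.symm
  rw [cfc_apply f T hT hf]
  suffices h : ∀ g : C(spectrum ℝ T, ℝ), cfcHom hT g v = (g ⟨c, hc⟩ : ℂ) • v from h _
  have hid : cfcHom hT (.restrict (spectrum ℝ T) <| .id ℝ) v = (c : ℂ) • v := by
    rw [cfcHom_id hT, hv]
  intro g
  induction g using ContinuousMap.induction_on_of_compact with
  | const r =>
    have : ContinuousMap.const (spectrum ℝ T) r = algebraMap ℝ C(spectrum ℝ T, ℝ) r := rfl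
    rw [this, AlgHomClass.commutes, Algebra.algebraMap_eq_smul_one]
    simp
  | id => exact hid
  | star_id =>
    have : star (ContinuousMap.restrict (spectrum ℝ T) (.id ℝ)) =
        ContinuousMap.restrict (spectrum ℝ T) (.id ℝ) := by ext; simp
    rw [this]
    exact hid
  | add f g hf hg => rw [map_add, add_apply, hf, hg, ← add_smul]; simp
  | mul f g hf hg =>
    rw [map_mul, mul_apply_eq_comp, hg, map_smul, hf, smul_smul, ContinuousMap.mul_apply,
      Complex.ofReal_mul, mul_comm]
  | frequently f h =>
    refine h.mem_of_closed (isClosed_eq ?_ ?_)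
    · have h1 : Continuous fun S : H →L[ℂ] H => S v := by fun_prop
      exact h1.comp (cfcHom_continuous hT)
    · fun_prop

theorem rpow_apply_eigenvector {T : H →L[ℂ] H} (hT : 0 ≤ T) {v : H} {c : ℝ}
    (hv : T v = (c : ℂ) • v) (hv0 : v ≠ 0) {q : ℝ} (hq : 0 ≤ q) :
    CFC.rpow T q v = ((c ^ q : ℝ) : ℂ) • v := by
  have h1 : CFC.rpow T q = cfc (fun x : ℝ => x ^ q) T := CFC.rpow_eq_cfc_real hT
  rw [h1]
  exact cfc_apply_eigenvector (IsSelfAdjoint.of_nonneg hT) hv hv0 _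
    (Real.continuous_rpow_const hq).continuousOn

/-- Writing `y = T y + D² T y` gives `⟪T y, y⟫ = ‖T y‖² + ‖D T y‖²`. -/
theorem IsInverseOneAddSq.nonneg {D : H →ₗ.[ℂ] H} (hD : IsSelfAdjoint D) {T : H →L[ℂ] H}
    (hT : IsInverseOneAddSq D T) : 0 ≤ T := by
  rw [ContinuousLinearMap.nonneg_iff_isPositive, ContinuousLinearMap.isPositive_iff_complex]
  intro y
  obtain ⟨h1, h2, h3⟩ := hT.1 y
  have h4 : ⟪T y, y⟫_ℂ = ((‖T y‖ ^ 2 + ‖D ⟨T y, h1⟩‖ ^ 2 : ℝ) : ℂ) := by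
    rw [show ⟪T y, y⟫_ℂ = ⟪T y, T y + D ⟨D ⟨T y, h1⟩, h2⟩⟫_ℂ from
        congrArg (fun z => ⟪T y, z⟫_ℂ) h3.symm, inner_add_right, ← hD.inner_map_left ⟨T y, h1⟩ ⟨_, h2⟩, inner_self_eq_norm_sq_to_K,
      inner_self_eq_norm_sq_to_K]
    push_cast
    rfl
  rw [h4]
  rw [RCLike.re_to_complex, Complex.ofReal_re]
  exact ⟨rfl, by positivity⟩

/-- With `R` the square root of `S`, the terms are `‖R (e k)‖²`. Parseval in `b`, self-adjointness
of `R` and Bessel for `e` bound every finite partial sum by the sum over `b`. -/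
theorem summable_inner_of_hilbertBasis {ι κ : Type*} {S : H →L[ℂ] H} (hS : 0 ≤ S)
    (b : HilbertBasis ι ℂ H) (e : HilbertBasis κ ℂ H)
    (h : Summable fun i => (⟪b i, S (b i)⟫_ℂ).re) : Summable fun k => (⟪e k, S (e k)⟫_ℂ).re := by
  set R := CFC.sqrt S with hR
  have hRR : R * R = S := CFC.sqrt_mul_sqrt_self S hS
  have hRsa : ∀ x y, ⟪R x, y⟫_ℂ = ⟪x, R y⟫_ℂ := by
    have : IsSelfAdjoint R := IsSelfAdjoint.of_nonneg (CFC.sqrt_nonneg S)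
    exact (ContinuousLinearMap.isSelfAdjoint_iff_isSymmetric.mp this)
  have hnorm : ∀ x, (⟪x, S x⟫_ℂ).re = ‖R x‖ ^ 2 := by
    intro x
    rw [← hRR, mul_apply_eq_comp, ← hRsa, inner_self_eq_norm_sq_to_K]
    norm_cast
  simp only [hnorm] at h ⊢
  have hpars : ∀ x, HasSum (fun i => ‖⟪b i, x⟫_ℂ‖ ^ 2) (‖x‖ ^ 2) := by
    intro x
    have h1 := Complex.hasSum_re (b.hasSum_inner_mul_inner x x)
    rw [inner_self_eq_norm_sq_to_K] at h1
    convert h1 using 1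
    · funext i
      have h2 := inner_mul_symm_re_eq_norm (𝕜 := ℂ) x (b i)
      rw [norm_mul, norm_inner_symm, ← sq] at h2
      exact h2.symm
    · norm_cast
  refine summable_of_sum_le (c := ∑' i, ‖R (b i)‖ ^ 2) (fun k => by positivity) fun s => ?_
  have h1 : HasSum (fun i => ∑ k ∈ s, ‖⟪b i, R (e k)⟫_ℂ‖ ^ 2) (∑ k ∈ s, ‖R (e k)‖ ^ 2) :=
    hasSum_sum fun k _ => hpars (R (e k))
  refine hasSum_le (fun i => ?_) h1 h.hasSum
  have h2 : ∀ k ∈ s, ‖⟪b i, R (e k)⟫_ℂ‖ ^ 2 = ‖⟪e k, R (b i)⟫_ℂ‖ ^ 2 := fun k _ => by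
    rw [← hRsa, norm_inner_symm]
  rw [Finset.sum_congr rfl h2]
  exact e.orthonormal.sum_inner_products_le (R (b i))

theorem exists_diagonal {ι : Type*} (e : HilbertBasis ι ℂ H) {c : ι → ℂ} {C : ℝ}
    (hc : ∀ i, ‖c i‖ ≤ C) : ∃ T : H →L[ℂ] H, ∀ x i, ⟪e i, T x⟫_ℂ = c i * ⟪e i, x⟫_ℂ :=
  ⟨diagOp e c C hc, inner_diagOp e hc⟩

theorem IsDiagonalIn.exists_isInverseOneAddSq {ι : Type*} {D : H →ₗ.[ℂ] H}
    {e : HilbertBasis ι ℂ H} {d : ι → ℝ} (h : IsDiagonalIn D e d) (hD : IsSelfAdjoint D) :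
    ∃ T, IsInverseOneAddSq D T := by
  have hpos : ∀ i, 0 < 1 + d i ^ 2 := fun i => by positivity
  have hcd : ∀ i, (1 : ℂ) + (d i : ℂ) ^ 2 ≠ 0 := fun i => by exact_mod_cast (hpos i).ne'
  have hnorm : ∀ i, ‖(1 : ℂ) + (d i : ℂ) ^ 2‖ = 1 + d i ^ 2 := fun i => by
    rw [← Real.norm_of_nonneg (hpos i).le, ← Complex.norm_real]
    push_cast
    rfl
  obtain ⟨T, hT⟩ := exists_diagonal e (c := fun i => ((1 : ℂ) + (d i : ℂ) ^ 2)⁻¹) (C := 1) fun i => by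
    rw [norm_inv, hnorm]
    exact inv_le_one_of_one_le₀ (by nlinarith [sq_nonneg (d i)])
  -- `R` stands for `D T`, which is bounded because `2 * |d| ≤ 1 + d ^ 2`.
  obtain ⟨R, hR⟩ := exists_diagonal e (c := fun i => (d i : ℂ) * ((1 : ℂ) + (d i : ℂ) ^ 2)⁻¹)
    (C := 1) fun i => by
      rw [norm_mul, norm_inv, hnorm, Complex.norm_real, Real.norm_eq_abs, ← div_eq_mul_inv,
        div_le_one (hpos i)]
      nlinarith [sq_nonneg (|d i| - 1), sq_abs (d i)]
  refine ⟨T, fun y => ?_, fun x hx => ?_⟩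
  · obtain ⟨h1, h1'⟩ := (h.graph_iff hD (x := T y) (w := R y)).mpr fun i => by
      rw [hT, hR, mul_assoc]
    obtain ⟨h2, h2'⟩ := (h.graph_iff hD (x := R y) (w := y - T y)).mpr fun i => by
      rw [hR, inner_sub_right, hT]
      have := hcd i
      field_simp
      ring
    have h1s : D ⟨T y, h1⟩ ∈ D.domain := h1' ▸ h2
    refine ⟨h1, h1s, ?_⟩
    have : (⟨D ⟨T y, h1⟩, h1s⟩ : D.domain) = ⟨R y, h2⟩ := Subtype.ext h1'
    rw [this, h2']
    abel
  · refine e.ext_inner fun i => ?_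
    rw [hT, inner_add_right, h.inner_apply hD ⟨D x, hx⟩, h.inner_apply hD x]
    have := hcd i
    field_simp

/-- The universe of `ι` matches that of `H` so that `e` itself can witness the trace-class
condition. -/
theorem isPSummable_iff {ι : Type u} {D : H →ₗ.[ℂ] H} {e : HilbertBasis ι ℂ H} {d : ι → ℝ}
    (h : IsDiagonalIn D e d) (hD : IsSelfAdjoint D) {p : ℝ} (hp : 0 < p) :
    IsPSummable D p ↔ Summable fun i => (1 + d i ^ 2) ^ (-(p / 2)) := by
  have hpos : ∀ i, 0 < 1 + d i ^ 2 := fun i => by positivity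
  have he : ∀ i, e i ≠ 0 := fun i => e.orthonormal.ne_zero i
  have key : ∀ T : H →L[ℂ] H, IsInverseOneAddSq D T → ∀ i,
      (⟪e i, CFC.abs (CFC.rpow T (p / 2)) (e i)⟫_ℂ).re = (1 + d i ^ 2) ^ (-(p / 2)) := by
    intro T hT i
    obtain ⟨hi, hi'⟩ := h i
    have h1 : D ⟨e i, hi⟩ ∈ D.domain := by
      rw [hi']
      exact D.domain.smul_mem _ hi
    have h2 : D ⟨D ⟨e i, hi⟩, h1⟩ = ((d i : ℂ) * d i) • e i := by
      have : (⟨D ⟨e i, hi⟩, h1⟩ : D.domain) = (d i : ℂ) • ⟨e i, hi⟩ := Subtype.ext hi'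
      rw [this, LinearPMap.map_smul, hi', smul_smul]
    have h3 := hT.2 ⟨e i, hi⟩ h1
    rw [h2] at h3
    have hne : (1 : ℂ) + (d i : ℂ) * d i ≠ 0 := by
      have := (hpos i).ne'
      rw [sq] at this
      exact_mod_cast this
    have h4 : T (e i) = (((1 + d i ^ 2)⁻¹ : ℝ) : ℂ) • e i := by
      have h5 : e i + ((d i : ℂ) * d i) • e i = ((1 : ℂ) + (d i : ℂ) * d i) • e i := by
        rw [add_smul, one_smul]
      rw [h5, map_smul] at h3
      rw [← smul_right_injective H hne |>.eq_iff, h3, smul_smul]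
      push_cast
      rw [sq, mul_inv_cancel₀ hne, one_smul]
    rw [CFC.abs_of_nonneg _ CFC.rpow_nonneg,
      rpow_apply_eigenvector (hT.nonneg hD) h4 (he i) (by positivity), inner_smul_right,
      inner_self_eq_norm_sq_to_K, e.orthonormal.1 i, Real.inv_rpow (hpos i).le,
      Real.rpow_neg (hpos i).le]
    simp
  constructor
  · rintro ⟨T, hT, κ, b, hb⟩
    have h0 : 0 ≤ CFC.abs (CFC.rpow T (p / 2)) := CFC.abs_nonneg (CFC.rpow T (p / 2))
    have h1 := summable_inner_of_hilbertBasis h0 b e hb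
    simpa only [key T hT] using h1
  · intro hs
    obtain ⟨T, hT⟩ := h.exists_isInverseOneAddSq hD
    refine ⟨T, hT, ι, e, ?_⟩
    simpa only [key T hT] using hs

end Summability

/-! ### Averages of right translations. -/

section Averaging

variable {G : Type*} [Group G] [TopologicalSpace G] [IsTopologicalGroup G] [CompactSpace G]
  [MeasurableSpace G] [BorelSpace G]

theorem continuous_rightRegularRep (x : L2 G) : Continuous fun g => rightRegularRep G g x := by
  have hreg : (normHaar G).Regular := by unfold normHaar; infer_instance
  have h : Continuous fun p : G × G => p.2 * p.1 := by fun_prop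
  exact Continuous.compMeasurePreservingLp (f := fun _ : G => x)
    (g := fun g => (⟨fun x => x * g, continuous_mul_const g⟩ : C(G, G))) continuous_const
    (ContinuousMap.curry ⟨_, h⟩).continuous
    (fun g => measurePreserving_mul_right_normHaar g) (by norm_num)

theorem exists_average (c : C(G, ℂ)) : ∃ E : L2 G →L[ℂ] L2 G, ∀ x y,
    ⟪y, E x⟫_ℂ = ∫ g, c g * ⟪y, rightRegularRep G g x⟫_ℂ ∂(normHaar G) := by
  have hint : ∀ x : L2 G, Integrable (fun g => c g • rightRegularRep G g x) (normHaar G) := fun x =>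
    (c.continuous.smul (continuous_rightRegularRep x)).integrable_of_hasCompactSupport
      (HasCompactSupport.of_compactSpace _)
  refine ⟨LinearMap.mkContinuous
    { toFun := fun x => ∫ g, c g • rightRegularRep G g x ∂(normHaar G)
      map_add' := fun x y => by
        rw [← integral_add (hint x) (hint y)]
        simp only [map_add, smul_add]
      map_smul' := fun a x => by
        rw [RingHom.id_apply, ← integral_smul]
        simp only [map_smul, smul_comm a] } ‖c‖ (fun x => ?_), fun x y => ?_⟩
  · have := norm_integral_le_of_norm_le_const (μ := normHaar G) (C := ‖c‖ * ‖x‖)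
      (f := fun g => c g • rightRegularRep G g x) (Filter.Eventually.of_forall fun g => by
        rw [norm_smul, LinearIsometryEquiv.norm_map]
        exact mul_le_mul_of_nonneg_right (c.norm_coe_le_norm g) (norm_nonneg _))
    simpa using this
  · have := (innerSL ℂ y).integral_comp_comm (hint x)
    simp only [innerSL_apply_apply, inner_smul_right] at this
    exact this.symm

/-- Equivariance is applied under the weak integral against vectors of the domain, and
self-adjointness upgrades the result; `D` is never taken through the integral. -/
theorem IsSelfAdjoint.average_mem {D : L2 G →ₗ.[ℂ] L2 G} (hD : IsSelfAdjoint D)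
    (heq : (haarGNS G).IsEquivariant D) {c : C(G, ℂ)} {E : L2 G →L[ℂ] L2 G}
    (hE : ∀ x y, ⟪y, E x⟫_ℂ = ∫ g, c g * ⟪y, rightRegularRep G g x⟫_ℂ ∂(normHaar G))
    (x : D.domain) : ∃ h : E (x : L2 G) ∈ D.domain, D ⟨E (x : L2 G), h⟩ = E (D x) := by
  refine hD.mem_domain_of_forall_inner fun y => ?_
  rw [← inner_conj_symm, ← inner_conj_symm (E (x : L2 G)), hE, hE]
  congr 2
  funext g
  obtain ⟨h1, h2⟩ := heq g
  have h3 := hD.inner_map_left y ⟨_, h1 x⟩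
  rw [h2 x] at h3
  exact congrArg (c g * ·) h3.symm

theorem rightRegularRep_toL2 (g : G) (f : C(G, ℂ)) :
    rightRegularRep G g (toL2 f) = toL2 (rightTranslation G g f) :=
  (haarGNS G).u_η g f

theorem mulRep_toL2 (a f : C(G, ℂ)) : mulRep G a (toL2 f) = toL2 (a * f) :=
  (haarGNS G).π_η a f

end Averaging

/-! ### Diagonalization of equivariant operators. -/

section EquivariantOperators

theorem PeterWeylBasis.rightRegularRep_e (B : PeterWeylBasis) (g : SU2) (m : ℕ)
    (i j : Fin (m + 1)) : rightRegularRep SU2 g (B.e ⟨m, (i, j)⟩) =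
      ∑ k, repCoef (B.continuous_U m) k j g • B.e ⟨m, (i, k)⟩ := by
  have h : rightTranslation SU2 g (repCoef (B.continuous_U m) i j) =
      ∑ k, repCoef (B.continuous_U m) k j g • repCoef (B.continuous_U m) i k := by
    ext x
    rw [rightTranslation_apply, repCoef_mul, ContinuousMap.sum_apply]
    exact Finset.sum_congr rfl fun k _ => mul_comm _ _
  simp only [B.e_eq_toL2]
  rw [map_smul, rightRegularRep_toL2, h, map_sum, Finset.smul_sum]
  exact Finset.sum_congr rfl fun k _ => by rw [map_smul, smul_comm]

/-- The operators `e_{il} ↦ e_{ij}` are averages of the right translations. -/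
theorem PeterWeylBasis.exists_matrixUnit (B : PeterWeylBasis) (m : ℕ) (j l : Fin (m + 1)) :
    ∃ (c : C(SU2, ℂ)) (E : L2 SU2 →L[ℂ] L2 SU2),
      (∀ x y, ⟪y, E x⟫_ℂ = ∫ g, c g * ⟪y, rightRegularRep SU2 g x⟫_ℂ ∂(normHaar SU2)) ∧
      ∀ x, E x = ∑ i, ⟪B.e ⟨m, (i, l)⟩, x⟫_ℂ • B.e ⟨m, (i, j)⟩ := by
  classical
  -- The factor `m + 1` cancels the norm `1 / (m + 1)` in the orthogonality relations.
  obtain ⟨E, hE⟩ := exists_average (((m : ℂ) + 1) • star (repCoef (B.continuous_U m) j l))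
  refine ⟨_, E, hE, ?_⟩
  have hm : (m : ℂ) + 1 ≠ 0 := by exact_mod_cast Nat.succ_ne_zero m
  have hEe : ∀ m' (a b : Fin (m' + 1)), E (B.e ⟨m', (a, b)⟩) =
      ∑ k, (((m : ℂ) + 1) * ⟪toL2 (repCoef (B.continuous_U m) j l),
        toL2 (repCoef (B.continuous_U m') k b)⟫_ℂ) • B.e ⟨m', (a, k)⟩ := by
    intro m' a b
    refine ext_inner_left ℂ fun y => ?_
    rw [hE, inner_sum]
    simp only [inner_smul_right, B.rightRegularRep_e, inner_sum, inner_toL2, Finset.mul_sum]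
    rw [integral_finsetSum]
    · refine Finset.sum_congr rfl fun k _ => ?_
      rw [← integral_const_mul, ← integral_mul_const]
      refine integral_congr_ae (Filter.Eventually.of_forall fun g => ?_)
      simp only [ContinuousMap.smul_apply, ContinuousMap.star_apply, smul_eq_mul, Complex.star_def]
      ring
    · intro k _
      exact integrable_normHaar ((((m : ℂ) + 1) • star (repCoef (B.continuous_U m) j l)) *
        (repCoef (B.continuous_U m') k b * ContinuousMap.const SU2 ⟪y, B.e ⟨m', (a, k)⟩⟫_ℂ))
  let F : L2 SU2 →L[ℂ] L2 SU2 :=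
    ∑ i, (innerSL ℂ (B.e ⟨m, (i, l)⟩)).smulRight (B.e ⟨m, (i, j)⟩)
  have hF : ∀ x, F x = ∑ i, ⟪B.e ⟨m, (i, l)⟩, x⟫_ℂ • B.e ⟨m, (i, j)⟩ := by
    intro x
    simp [F, sum_apply]
  suffices h : E = F by
    intro x
    rw [h, hF]
  refine ContinuousLinearMap.ext_on
    (Submodule.dense_iff_topologicalClosure_eq_top.mpr B.e.dense_span) ?_
  rintro _ ⟨⟨m', a, b⟩, rfl⟩
  rw [hF, hEe]
  by_cases hmm : m = m'
  · subst hmm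
    simp only [coefInner_self (B.continuous_U m) (B.irreducible_U m), B.e.inner_eq_ite]
    have h1 : ∀ k, (((m : ℂ) + 1) * if k = j ∧ b = l then (((m + 1 : ℕ) : ℂ))⁻¹ else 0) •
        B.e ⟨m, (a, k)⟩ = if k = j then (if b = l then B.e ⟨m, (a, j)⟩ else 0) else 0 := by
      intro k
      push_cast
      by_cases h1 : k = j <;> by_cases h2 : b = l <;> simp [h1, h2, hm]
    have h2 : ∀ i, ((if (⟨m, (i, l)⟩ : Σ m : ℕ, Fin (m + 1) × Fin (m + 1)) = ⟨m, (a, b)⟩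
        then (1 : ℂ) else 0)) • B.e ⟨m, (i, j)⟩ =
        if i = a then (if b = l then B.e ⟨m, (a, j)⟩ else 0) else 0 := by
      intro i
      by_cases h1 : i = a
      · subst h1
        by_cases h2 : b = l
        · subst h2; simp
        · have : ¬ l = b := fun h => h2 h.symm
          simp [h2, this]
      · simp [h1]
    rw [Finset.sum_congr rfl fun k _ => h1 k, Finset.sum_congr rfl fun i _ => h2 i]
    simp
  · have h1 : ∀ k, ⟪toL2 (repCoef (B.continuous_U m) j l),
        toL2 (repCoef (B.continuous_U m') k b)⟫_ℂ = 0 := fun k =>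
      inner_toL2_repCoef_of_ne (B.continuous_U m') (B.continuous_U m) (B.irreducible_U m')
        (B.irreducible_U m) (by omega) _ _ _ _
    simp only [h1, B.e.inner_eq_ite]
    simp [hmm]

theorem IsSelfAdjoint.matrixUnit_mem {D : L2 SU2 →ₗ.[ℂ] L2 SU2} (hD : IsSelfAdjoint D)
    (heq : (haarGNS SU2).IsEquivariant D) (B : PeterWeylBasis) {m : ℕ} (j l : Fin (m + 1))
    {x w : L2 SU2} (hx : (x, w) ∈ D.graph) :
    (∑ i, ⟪B.e ⟨m, (i, l)⟩, x⟫_ℂ • B.e ⟨m, (i, j)⟩,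
      ∑ i, ⟪B.e ⟨m, (i, l)⟩, w⟫_ℂ • B.e ⟨m, (i, j)⟩) ∈ D.graph := by
  obtain ⟨c, E, hE, hE'⟩ := B.exists_matrixUnit m j l
  obtain ⟨y, rfl, rfl⟩ := (LinearPMap.mem_graph_iff _).mp hx
  obtain ⟨h1, h2⟩ := hD.average_mem heq hE y
  rw [← hE', ← hE']
  exact (LinearPMap.mem_graph_iff _).mpr ⟨⟨_, h1⟩, rfl, h2⟩

theorem sum_inner_smul_e (B : PeterWeylBasis) {m : ℕ} (i j l : Fin (m + 1)) :
    ∑ k, ⟪B.e ⟨m, (k, l)⟩, B.e ⟨m, (i, l)⟩⟫_ℂ • B.e ⟨m, (k, j)⟩ = B.e ⟨m, (i, j)⟩ := by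
  classical
  simp [B.e.inner_eq_ite]

/-- The projection onto column `j` of level `m` maps the dense domain into itself with
finite-dimensional image. That image is closed and dense in the range of the projection, hence equal
to it. -/
theorem IsSelfAdjoint.basis_mem_domain {D : L2 SU2 →ₗ.[ℂ] L2 SU2} (hD : IsSelfAdjoint D)
    (heq : (haarGNS SU2).IsEquivariant D) (B : PeterWeylBasis) (m : ℕ) (i j : Fin (m + 1)) :
    B.e ⟨m, (i, j)⟩ ∈ D.domain := by
  obtain ⟨c, E, hE, hE'⟩ := B.exists_matrixUnit m j j
  have hle : D.domain.map E.toLinearMap ≤ D.domain := by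
    rintro _ ⟨x, hx, rfl⟩
    exact (hD.average_mem heq hE ⟨x, hx⟩).1
  have hfin : FiniteDimensional ℂ (D.domain.map E.toLinearMap) := by
    have h1 : D.domain.map E.toLinearMap ≤
        Submodule.span ℂ (Set.range fun i => B.e ⟨m, (i, j)⟩) := by
      rintro _ ⟨x, -, rfl⟩
      change E x ∈ _
      rw [hE']
      exact sum_mem fun i _ => Submodule.smul_mem _ _ (Submodule.subset_span ⟨i, rfl⟩)
    have : FiniteDimensional ℂ (Submodule.span ℂ (Set.range fun i => B.e ⟨m, (i, j)⟩)) :=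
      FiniteDimensional.span_of_finite ℂ (Set.finite_range _)
    exact Submodule.finiteDimensional_of_le h1
  have hclosed : IsClosed ((D.domain.map E.toLinearMap : Submodule ℂ (L2 SU2)) : Set (L2 SU2)) :=
    Submodule.closed_of_finiteDimensional _
  have h1 : E (B.e ⟨m, (i, j)⟩) ∈ closure (E '' (D.domain : Set (L2 SU2))) :=
    image_closure_subset_closure_image E.continuous ⟨_, hD.dense_domain _, rfl⟩
  have h2 : E (B.e ⟨m, (i, j)⟩) = B.e ⟨m, (i, j)⟩ := by
    rw [hE', sum_inner_smul_e]
  rw [h2] at h1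
  have h3 : closure (E '' (D.domain : Set (L2 SU2))) = E '' (D.domain : Set (L2 SU2)) :=
    hclosed.closure_eq
  rw [h3] at h1
  exact hle h1

/-- An equivariant self-adjoint operator acts by a Hermitian matrix on the row indices. -/
theorem IsSelfAdjoint.exists_rowMatrix {D : L2 SU2 →ₗ.[ℂ] L2 SU2} (hD : IsSelfAdjoint D)
    (heq : (haarGNS SU2).IsEquivariant D) (B : PeterWeylBasis) (m : ℕ) :
    ∃ A : Matrix (Fin (m + 1)) (Fin (m + 1)) ℂ, A.IsHermitian ∧
      ∀ i j, (B.e ⟨m, (i, j)⟩, ∑ k, A k i • B.e ⟨m, (k, j)⟩) ∈ D.graph := by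
  let x : Fin (m + 1) → D.domain := fun i => ⟨B.e ⟨m, (i, 0)⟩, hD.basis_mem_domain heq B m i 0⟩
  -- The matrix is read off in column 0; matrix units carry it unchanged to every other column.
  refine ⟨Matrix.of fun k i => ⟪(x k : L2 SU2), D (x i)⟫_ℂ, ?_, fun i j => ?_⟩
  · ext i k
    rw [Matrix.conjTranspose_apply, Matrix.of_apply, Matrix.of_apply, Complex.star_def,
      inner_conj_symm]
    exact hD.inner_map_left _ _
  · have h := hD.matrixUnit_mem heq B j 0 (D.mem_graph (x i))
    rw [sum_inner_smul_e] at h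
    exact h

theorem IsIrreducibleMatrixRep.conj {G : Type*} [Group G] {n : ℕ}
    {U : G →* Matrix.unitaryGroup (Fin n) ℂ} (hU : IsIrreducibleMatrixRep U)
    (W : Matrix.unitaryGroup (Fin n) ℂ) :
    IsIrreducibleMatrixRep ((MulAut.conj W⁻¹).toMonoidHom.comp U) := by
  refine ⟨hU.1, fun V hV => ?_⟩
  let Wi : Matrix (Fin n) (Fin n) ℂ := (W⁻¹ : Matrix.unitaryGroup (Fin n) ℂ)
  have h1 : Wi * (W : Matrix (Fin n) (Fin n) ℂ) = 1 := congrArg Subtype.val (inv_mul_cancel W)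
  have h2 : (W : Matrix (Fin n) (Fin n) ℂ) * Wi = 1 := congrArg Subtype.val (mul_inv_cancel W)
  have h3 : ∀ g, (((MulAut.conj W⁻¹).toMonoidHom.comp U g : Matrix.unitaryGroup (Fin n) ℂ) :
      Matrix (Fin n) (Fin n) ℂ) = Wi * (U g : Matrix (Fin n) (Fin n) ℂ) * W := by
    intro g
    have : (MulAut.conj W⁻¹).toMonoidHom.comp U g = W⁻¹ * U g * W := by simp
    rw [this]
    rfl
  have h4 : ∀ v, Wi.mulVec ((W : Matrix (Fin n) (Fin n) ℂ).mulVec v) = v := fun v => by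
    rw [Matrix.mulVec_mulVec, h1, Matrix.one_mulVec]
  have hinv : ∀ g, ∀ v ∈ V.comap Wi.mulVecLin,
      (U g : Matrix (Fin n) (Fin n) ℂ).mulVec v ∈ V.comap Wi.mulVecLin := by
    intro g v hv
    rw [Submodule.mem_comap, Matrix.mulVecLin_apply] at hv ⊢
    have := hV g _ hv
    rwa [h3, Matrix.mulVec_mulVec, Matrix.mul_assoc, h2, Matrix.mul_one,
      ← Matrix.mulVec_mulVec] at this
  rcases hU.2 _ hinv with h | h
  · left
    rw [eq_bot_iff]
    intro v hv
    have : (W : Matrix (Fin n) (Fin n) ℂ).mulVec v ∈ V.comap Wi.mulVecLin := by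
      rw [Submodule.mem_comap, Matrix.mulVecLin_apply, h4]
      exact hv
    rw [h, Submodule.mem_bot] at this
    rw [Submodule.mem_bot, ← h4 v, this, Matrix.mulVec_zero]
  · right
    rw [eq_top_iff]
    intro v _
    have : (W : Matrix (Fin n) (Fin n) ℂ).mulVec v ∈ V.comap Wi.mulVecLin := h ▸ Submodule.mem_top
    rwa [Submodule.mem_comap, Matrix.mulVecLin_apply, h4] at this

/-- Equivariant self-adjoint operators are diagonal in some Peter–Weyl basis. -/
theorem IsSelfAdjoint.exists_isDiagonal {D : L2 SU2 →ₗ.[ℂ] L2 SU2} (hD : IsSelfAdjoint D)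
    (heq : (haarGNS SU2).IsEquivariant D) :
    ∃ (B : PeterWeylBasis) (d : ∀ m : ℕ, Fin (m + 1) → ℝ), B.IsDiagonal D d := by
  choose A hA hAD using hD.exists_rowMatrix heq symBasis
  -- The new rows have coefficients conjugate to the columns of `W`. Conjugating the eigenvalue
  -- equation for `A` turns it into one for the transpose, as `A` is Hermitian.
  let hA' := fun m => (hA m).transpose
  let W := fun m => (hA' m).eigenvectorUnitary
  let U' := fun m => (MulAut.conj (W m)⁻¹).toMonoidHom.comp (symRep m)
  have hU' : ∀ m g, (U' m g : Matrix (Fin (m + 1)) (Fin (m + 1)) ℂ) =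
      star (W m : Matrix (Fin (m + 1)) (Fin (m + 1)) ℂ) * symMatrix m g * W m := by
    intro m g
    have : U' m g = (W m)⁻¹ * symRep m g * W m := by simp [U']
    rw [this]
    rfl
  have hcont : ∀ m, Continuous (U' m) := by
    intro m
    refine Continuous.subtype_mk (f := fun g => (U' m g : Matrix (Fin (m + 1)) (Fin (m + 1)) ℂ)) ?_ _
    simp only [hU']
    have : Continuous fun g : SU2 => symMatrix m g :=
      continuous_subtype_val.comp (continuous_symRep m)
    exact (continuous_const.matrix_mul this).matrix_mul continuous_const
  let B := PeterWeylBasis.ofReps hcont fun m => (isIrreducible_symRep m).conj (W m)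
  refine ⟨B, fun m => (hA' m).eigenvalues, fun m i j => ?_⟩
  let w : Fin (m + 1) → Fin (m + 1) → ℂ :=
    fun k i => (W m : Matrix (Fin (m + 1)) (Fin (m + 1)) ℂ) k i
  have hBe : B.e ⟨m, (i, j)⟩ = ∑ l, ∑ k, (starRingEnd ℂ (w k i) * w l j) •
      symBasis.e ⟨m, (k, l)⟩ := by
    have h1 : repCoef (B.continuous_U m) i j = ∑ l, ∑ k, (starRingEnd ℂ (w k i) * w l j) •
        repCoef (symBasis.continuous_U m) k l := by
      ext g
      have h2 : (B.U m g : Matrix (Fin (m + 1)) (Fin (m + 1)) ℂ) = _ := hU' m g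
      rw [repCoef_apply, h2, Matrix.mul_apply, ContinuousMap.sum_apply]
      refine Finset.sum_congr rfl fun l _ => ?_
      rw [Matrix.mul_apply, Finset.sum_mul, ContinuousMap.sum_apply]
      refine Finset.sum_congr rfl fun k _ => ?_
      rw [Matrix.star_apply, ContinuousMap.smul_apply, repCoef_apply, smul_eq_mul]
      change _ = _ * symMatrix m g k l
      simp only [w, Complex.star_def]
      ring
    simp only [PeterWeylBasis.e_eq_toL2]
    rw [h1, map_sum, Finset.smul_sum]
    refine Finset.sum_congr rfl fun l _ => ?_
    rw [map_sum, Finset.smul_sum]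
    exact Finset.sum_congr rfl fun k _ => by rw [map_smul, smul_comm]
  have heig : ∀ k', ∑ k, A m k' k * starRingEnd ℂ (w k i) =
      (hA' m).eigenvalues i * starRingEnd ℂ (w k' i) := by
    intro k'
    have h1 := congrFun ((hA' m).mulVec_eigenvectorBasis i) k'
    have h2 := congrArg (starRingEnd ℂ) h1
    simp only [Matrix.mulVec, dotProduct, map_sum, map_mul, Matrix.transpose_apply,
      Pi.smul_apply, Complex.real_smul, Complex.conj_ofReal] at h2
    have h3 : ∀ k, starRingEnd ℂ (A m k k') = A m k' k := fun k => (hA m).apply k' k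
    have h4 : ∀ k, w k i = (hA' m).eigenvectorBasis i k := fun k =>
      (hA' m).eigenvectorUnitary_apply k i
    simp only [h3] at h2
    simp only [h4]
    exact h2
  have hgraph : (B.e ⟨m, (i, j)⟩, ((hA' m).eigenvalues i : ℂ) • B.e ⟨m, (i, j)⟩) ∈ D.graph := by
    have h1 : ∑ l, ∑ k, (starRingEnd ℂ (w k i) * w l j) •
        (symBasis.e ⟨m, (k, l)⟩, ∑ k', A m k' k • symBasis.e ⟨m, (k', l)⟩) ∈ D.graph :=
      sum_mem fun l _ => sum_mem fun k _ => D.graph.smul_mem _ (hAD m k l)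
    convert h1 using 1
    refine Prod.ext ?_ ?_
    · simp only [Prod.fst_sum, Prod.smul_fst]
      exact hBe
    · simp only [Prod.snd_sum, Prod.smul_snd]
      rw [hBe, Finset.smul_sum]
      refine Finset.sum_congr rfl fun l _ => ?_
      simp only [Finset.smul_sum, smul_smul]
      rw [Finset.sum_comm]
      refine Finset.sum_congr rfl fun k' _ => ?_
      rw [← Finset.sum_smul, ← mul_assoc, ← heig, Finset.sum_mul]
      congr 1
      exact Finset.sum_congr rfl fun k _ => by ring
  obtain ⟨y, hy, hy'⟩ := (LinearPMap.mem_graph_iff _).mp hgraph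
  have hy1 : (y : L2 SU2) = B.e ⟨m, (i, j)⟩ := hy
  exact ⟨hy1 ▸ y.2, (congrArg D (Subtype.ext hy1.symm)).trans hy'⟩

end EquivariantOperators

/-! ### Linear growth of the eigenvalues. -/

section EigenvalueGrowth

/-- For eigenvectors, `⟪[D, S] (v k), f⟫ = (c - δ k) * ⟪S (v k), f⟫`. The claim is Bessel's
inequality for the functional `⟪[D, S] ·, f⟫`, which has norm at most `C` on the span of the `v k`.
-/
theorem HasBoundedCommutator.sum_sq_le {H : Type*} [NormedAddCommGroup H] [InnerProductSpace ℂ H]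
    [CompleteSpace H] {D : H →ₗ.[ℂ] H} (hD : IsSelfAdjoint D) {S : H →L[ℂ] H} {C : ℝ}
    {hdom : ∀ x : D.domain, S (x : H) ∈ D.domain}
    (hC : ∀ x : D.domain, ‖D ⟨S (x : H), hdom x⟩ - S (D x)‖ ≤ C * ‖(x : H)‖)
    {ι : Type*} [Fintype ι] {v : ι → H} (hv : Orthonormal ℂ v) {δ : ι → ℝ}
    (hvD : ∀ k, (v k, (δ k : ℂ) • v k) ∈ D.graph) {f : H} (hf : ‖f‖ = 1) {c : ℝ}
    (hfD : (f, (c : ℂ) • f) ∈ D.graph) :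
    ∑ k, (c - δ k) ^ 2 * ‖⟪S (v k), f⟫_ℂ‖ ^ 2 ≤ C ^ 2 := by
  obtain ⟨f', rfl, hf'⟩ := (LinearPMap.mem_graph_iff _).mp hfD
  choose x hx hxD using fun k => (LinearPMap.mem_graph_iff _).mp (hvD k)
  simp only at hx hxD hf'
  set y : ι → ℂ := fun k => ((c : ℂ) - δ k) * ⟪S (v k), (f' : H)⟫_ℂ with hy
  set s := ∑ k, ‖y k‖ ^ 2 with hs
  have hs0 : 0 ≤ s := by positivity
  have hsum : ∑ k, (c - δ k) ^ 2 * ‖⟪S (v k), (f' : H)⟫_ℂ‖ ^ 2 = s := by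
    refine Finset.sum_congr rfl fun k _ => ?_
    rw [hy]
    simp only
    rw [norm_mul, mul_pow, ← Complex.ofReal_sub, Complex.norm_real, Real.norm_eq_abs, sq_abs]
  have hcomm : ∀ k, ⟪D ⟨S (x k : H), hdom (x k)⟩ - S (D (x k)), (f' : H)⟫_ℂ = y k := by
    intro k
    have h1 : ⟪D ⟨S (x k : H), hdom (x k)⟩, (f' : H)⟫_ℂ = c * ⟪S (v k), (f' : H)⟫_ℂ := by
      rw [hD.inner_map_left, hf', inner_smul_right]
      change _ * ⟪S (x k : H), _⟫_ℂ = _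
      rw [hx]
    rw [inner_sub_left, h1, hxD, map_smul, inner_smul_left, Complex.conj_ofReal, ← sub_mul]
  -- Weighting `v k` by `y k` makes the pairing equal to `s = ‖h‖ ^ 2`, so that `s ≤ C * √s`.
  let h : D.domain := ∑ k, y k • x k
  have hh : (h : H) = ∑ k, y k • v k := by
    simp only [h, Submodule.coe_sum, Submodule.coe_smul, hx]
  have hDh : D ⟨S (h : H), hdom h⟩ - S (D h) =
      ∑ k, y k • (D ⟨S (x k : H), hdom (x k)⟩ - S (D (x k))) := by
    have h1 : (⟨S (h : H), hdom h⟩ : D.domain) = ∑ k, y k • ⟨S (x k : H), hdom (x k)⟩ := by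
      refine Subtype.ext ?_
      simp only [h, Submodule.coe_sum, Submodule.coe_smul, map_sum, map_smul]
    have h2 : ∀ z : D.domain, D z = D.toFun z := fun z => rfl
    rw [h1]
    simp only [h, h2, map_sum, map_smul, smul_sub, Finset.sum_sub_distrib]
  have hinner : ⟪D ⟨S (h : H), hdom h⟩ - S (D h), (f' : H)⟫_ℂ = (s : ℂ) := by
    rw [hDh, sum_inner, hs]
    push_cast
    refine Finset.sum_congr rfl fun k _ => ?_
    rw [inner_smul_left, hcomm, Complex.conj_mul']
  have hnorm : ‖(h : H)‖ ^ 2 = s := by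
    have : ((‖(h : H)‖ ^ 2 : ℝ) : ℂ) = (s : ℂ) := by
      have h1 := inner_self_eq_norm_sq_to_K (𝕜 := ℂ) (h : H)
      push_cast
      refine h1.symm.trans ?_
      rw [hh, hv.inner_sum, hs]
      push_cast
      exact Finset.sum_congr rfl fun k _ => Complex.conj_mul' _
    exact_mod_cast this
  have h1 : s ≤ C * ‖(h : H)‖ := by
    have h2 := norm_inner_le_norm (𝕜 := ℂ) (D ⟨S (h : H), hdom h⟩ - S (D h)) (f' : H)
    rw [hinner, hf, mul_one, Complex.norm_real, Real.norm_of_nonneg hs0] at h2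
    exact h2.trans (hC h)
  rw [hsum]
  rcases hs0.eq_or_lt with h0 | h0
  · rw [← h0]; positivity
  · have h2 : s ^ 2 ≤ C ^ 2 * s := by
      calc s ^ 2 ≤ (C * ‖(h : H)‖) ^ 2 := pow_le_pow_left₀ hs0 h1 2
        _ = C ^ 2 * s := by rw [mul_pow, hnorm]
    nlinarith

theorem sqrtChoose_eq_of_sq {m k m' k' : ℕ} {x : ℝ} (hx : 0 ≤ x)
    (h : (m.choose k : ℝ) = x * m'.choose k') :
    sqrtChoose m k = (Real.sqrt x : ℂ) * sqrtChoose m' k' := by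
  rw [sqrtChoose, sqrtChoose, h, Real.sqrt_mul hx, Complex.ofReal_mul]

theorem repCoef_symRep_zero {m : ℕ} (k : Fin (m + 1)) :
    repCoef (continuous_symRep m) k 0 =
      sqrtChoose m k • (entry 0 0 ^ (m - (k : ℕ)) * entry 1 0 ^ (k : ℕ)) := by
  ext g
  have h := sqrtChoose_ne_zero (Fin.le_of_succ k)
  rw [repCoef_apply, coe_symRep, symMatrix_apply, Fin.val_zero,
    symEntry_col_zero _ (Fin.le_of_succ k), ← sqrtChoose_mul_self]
  simp only [ContinuousMap.smul_apply, ContinuousMap.mul_apply, ContinuousMap.pow_apply,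
    entry_apply, smul_eq_mul]
  have h1 : sqrtChoose m 0 = 1 := by simp [sqrtChoose]
  rw [h1]
  field_simp

/-- The normalized monomials `α^{m-k} β^k`. -/
def colBasis (m : ℕ) (k : Fin (m + 1)) : L2 SU2 := symBasis.e ⟨m, (k, 0)⟩

theorem colBasis_eq (m : ℕ) (k : Fin (m + 1)) :
    colBasis m k = ((Real.sqrt (m + 1) : ℂ) * sqrtChoose m k) •
      toL2 (entry 0 0 ^ (m - (k : ℕ)) * entry 1 0 ^ (k : ℕ)) := by
  rw [colBasis, PeterWeylBasis.e_eq_toL2]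
  have : repCoef (symBasis.continuous_U m) k 0 = repCoef (continuous_symRep m) k 0 := rfl
  rw [this, repCoef_symRep_zero, map_smul, smul_smul]

theorem orthonormal_colBasis (m : ℕ) : Orthonormal ℂ (colBasis m) :=
  symBasis.e.orthonormal.comp (fun k : Fin (m + 1) =>
    (⟨m, (k, 0)⟩ : Σ m : ℕ, Fin (m + 1) × Fin (m + 1))) fun k k' h => by simpa using h

/-- The product of monomials is again a monomial; the scalar is the quotient of the two
normalizations, rational by the recursion for binomial coefficients. -/
theorem mul_alpha_colBasis (m : ℕ) (k : Fin (m + 1)) :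
    mulRep SU2 (entry 0 0) (colBasis m k) =
      (Real.sqrt ((m + 1 - k) / (m + 2)) : ℂ) • colBasis (m + 1) k.castSucc := by
  rw [colBasis_eq, colBasis_eq, map_smul, mulRep_toL2, smul_smul, Fin.val_castSucc]
  have hk := Fin.le_of_succ k
  have hkR : (k : ℝ) ≤ m := by exact_mod_cast hk
  have h0 : (0 : ℝ) ≤ (m + 1 - k) / (m + 1) := div_nonneg (by linarith) (by positivity)
  have h1 : sqrtChoose m k = (Real.sqrt ((m + 1 - k) / (m + 1)) : ℂ) * sqrtChoose (m + 1) k := by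
    refine sqrtChoose_eq_of_sq h0 ?_
    have h2 := Nat.choose_mul_succ_eq m k
    have h3 : ((m.choose k : ℝ)) * (m + 1) = ((m + 1).choose k : ℝ) * (m + 1 - k) := by
      have h4 : ((m + 1 - (k : ℕ) : ℕ) : ℝ) = m + 1 - k := by
        rw [Nat.cast_sub (by omega)]; push_cast; rfl
      rw [← h4]
      exact_mod_cast h2
    field_simp
    linarith
  have h2 : (Real.sqrt (m + 1) : ℂ) * Real.sqrt ((m + 1 - k) / (m + 1)) =
      Real.sqrt ((m + 1 - k) / (m + 2)) * Real.sqrt ((m + 1 : ℕ) + 1) := by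
    rw [← Complex.ofReal_mul, ← Complex.ofReal_mul, ← Real.sqrt_mul (by positivity),
      ← Real.sqrt_mul (div_nonneg (by linarith) (by positivity))]
    congr 2
    push_cast
    field_simp
    ring
  have h3 : entry 0 0 * (entry 0 0 ^ (m - (k : ℕ)) * entry 1 0 ^ (k : ℕ)) =
      entry 0 0 ^ (m + 1 - (k : ℕ)) * entry 1 0 ^ (k : ℕ) := by
    rw [← mul_assoc, ← pow_succ', Nat.sub_add_comm hk]
  rw [h3, h1, ← mul_assoc, h2, mul_assoc]

theorem mul_beta_colBasis (m : ℕ) (k : Fin (m + 1)) :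
    mulRep SU2 (entry 1 0) (colBasis m k) =
      (Real.sqrt ((k + 1) / (m + 2)) : ℂ) • colBasis (m + 1) k.succ := by
  rw [colBasis_eq, colBasis_eq, map_smul, mulRep_toL2, smul_smul, Fin.val_succ]
  have h1 : sqrtChoose m k =
      (Real.sqrt ((k + 1) / (m + 1)) : ℂ) * sqrtChoose (m + 1) (k + 1) := by
    refine sqrtChoose_eq_of_sq (by positivity) ?_
    have h2 := Nat.add_one_mul_choose_eq m k
    have h3 : ((m : ℝ) + 1) * (m.choose k : ℝ) = ((m + 1).choose (k + 1) : ℝ) * (k + 1) := by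
      exact_mod_cast h2
    field_simp
    linarith
  have h2 : (Real.sqrt (m + 1) : ℂ) * Real.sqrt ((k + 1) / (m + 1)) =
      Real.sqrt ((k + 1) / (m + 2)) * Real.sqrt ((m + 1 : ℕ) + 1) := by
    rw [← Complex.ofReal_mul, ← Complex.ofReal_mul, ← Real.sqrt_mul (by positivity),
      ← Real.sqrt_mul (by positivity)]
    congr 2
    push_cast
    field_simp
    ring
  have h3 : entry 1 0 * (entry 0 0 ^ (m - (k : ℕ)) * entry 1 0 ^ (k : ℕ)) =
      entry 0 0 ^ (m + 1 - ((k : ℕ) + 1)) * entry 1 0 ^ ((k : ℕ) + 1) := by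
    rw [Nat.add_sub_add_right, pow_succ]; ring
  rw [h3, h1, ← mul_assoc, h2, mul_assoc]

theorem inner_sum_colBasis {m : ℕ} (k : Fin (m + 1)) (v : Fin (m + 1) → ℂ) :
    ⟪colBasis m k, ∑ i, v i • colBasis m i⟫_ℂ = v k :=
  (orthonormal_colBasis m).inner_right_fintype v k

theorem norm_sum_colBasis_sq {m : ℕ} (v : Fin (m + 1) → ℂ) :
    ‖∑ i, v i • colBasis m i‖ ^ 2 = ∑ i, ‖v i‖ ^ 2 := by
  have h1 := inner_self_eq_norm_sq_to_K (𝕜 := ℂ) (∑ i, v i • colBasis m i)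
  rw [(orthonormal_colBasis m).inner_sum] at h1
  simp only [Complex.conj_mul'] at h1
  refine Complex.ofReal_injective ?_
  push_cast
  exact h1.symm

/-- In the span of the monomials of degree `m + 1` in `α, β`, multiplication by `α` and `β` from
degree `m` is, up to a factor, the adjoint of an isometry. -/
theorem sum_inner_alpha_beta {m : ℕ} (v : Fin (m + 2) → ℂ) :
    ∑ k, (‖⟪mulRep SU2 (entry 0 0) (colBasis m k), ∑ i, v i • colBasis (m + 1) i⟫_ℂ‖ ^ 2 +
      ‖⟪mulRep SU2 (entry 1 0) (colBasis m k), ∑ i, v i • colBasis (m + 1) i⟫_ℂ‖ ^ 2) =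
      (m + 1) / (m + 2) * ∑ i, ‖v i‖ ^ 2 := by
  have h1 : ∀ k : Fin (m + 1),
      ‖⟪mulRep SU2 (entry 0 0) (colBasis m k), ∑ i, v i • colBasis (m + 1) i⟫_ℂ‖ ^ 2 =
        (m + 1 - (k : ℝ)) / (m + 2) * ‖v k.castSucc‖ ^ 2 := by
    intro k
    have hkR : (k : ℝ) ≤ m := by exact_mod_cast Fin.le_of_succ k
    rw [mul_alpha_colBasis, inner_smul_left, inner_sum_colBasis, Complex.conj_ofReal, norm_mul,
      mul_pow, Complex.norm_real, Real.norm_of_nonneg (Real.sqrt_nonneg _),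
      Real.sq_sqrt (div_nonneg (by linarith) (by positivity))]
  have h2 : ∀ k : Fin (m + 1),
      ‖⟪mulRep SU2 (entry 1 0) (colBasis m k), ∑ i, v i • colBasis (m + 1) i⟫_ℂ‖ ^ 2 =
        ((k : ℝ) + 1) / (m + 2) * ‖v k.succ‖ ^ 2 := by
    intro k
    rw [mul_beta_colBasis, inner_smul_left, inner_sum_colBasis, Complex.conj_ofReal, norm_mul,
      mul_pow, Complex.norm_real, Real.norm_of_nonneg (Real.sqrt_nonneg _),
      Real.sq_sqrt (by positivity)]
  simp only [h1, h2, Finset.sum_add_distrib]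
  -- Both sums extend to all of `Fin (m + 2)`, since the weight vanishes at the missing index: `m +
  -- 1` here, `0` in `h4`. The weights then add up to a constant.
  have h3 : ∑ j : Fin (m + 2), (m + 1 - (j : ℝ)) / (m + 2) * ‖v j‖ ^ 2 =
      ∑ k : Fin (m + 1), (m + 1 - (k : ℝ)) / (m + 2) * ‖v k.castSucc‖ ^ 2 := by
    rw [Fin.sum_univ_castSucc]
    simp
  have h4 : ∑ j : Fin (m + 2), (j : ℝ) / (m + 2) * ‖v j‖ ^ 2 =
      ∑ k : Fin (m + 1), ((k : ℝ) + 1) / (m + 2) * ‖v k.succ‖ ^ 2 := by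
    rw [Fin.sum_univ_succ]
    simp
  rw [← h3, ← h4, ← Finset.sum_add_distrib, Finset.mul_sum]
  exact Finset.sum_congr rfl fun j _ => by ring

/-- In every Peter–Weyl basis the rows meet the space of homogeneous polynomials in `α, β` in an
orthonormal basis of the latter. -/
theorem PeterWeylBasis.exists_columnBasis (B : PeterWeylBasis) (m : ℕ) :
    ∃ (M : Matrix (Fin (m + 1)) (Fin (m + 1)) ℂ) (v : Fin (m + 1) → ℂ),
      (∀ i, ∑ k, M i k • colBasis m k = ∑ j, v j • B.e ⟨m, (i, j)⟩) ∧
      Orthonormal ℂ fun i => ∑ k, M i k • colBasis m k := by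
  classical
  obtain ⟨m', hm, S, T, -, hTS, hS⟩ := exists_equiv_symRep (B.continuous_U m) (B.irreducible_U m)
  obtain rfl : m = m' := by omega
  -- Squared length of column 0 of the intertwiner, nonzero because `S` has a left inverse; dividing
  -- by its root normalizes the vectors.
  set N : ℝ := ∑ j, ‖S j 0‖ ^ 2 with hN
  have hN0 : 0 < N := by
    refine lt_of_le_of_ne (by positivity) fun h0 => ?_
    have h1 : ∀ j, S j 0 = 0 := fun j => by
      have := (Finset.sum_eq_zero_iff_of_nonneg fun j _ => by positivity).mp h0.symm j
        (Finset.mem_univ j)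
      simpa using this
    have h2 := congrFun (congrFun hTS 0) 0
    simp [Matrix.mul_apply, h1] at h2
  have hr : (Real.sqrt N : ℂ) ≠ 0 := Complex.ofReal_ne_zero.mpr (Real.sqrt_pos.mpr hN0).ne'
  set r : ℂ := (Real.sqrt N : ℂ)⁻¹ with hrdef
  have heq : ∀ i, ∑ k, (r • S) i k • colBasis m k = ∑ j, (r * S j 0) • B.e ⟨m, (i, j)⟩ := by
    intro i
    -- Column 0 of `U S = S Sym`: the left side lies in row `i` of the given basis, the right side
    -- among the homogeneous polynomials.
    have h1 : ∑ j, S j 0 • repCoef (B.continuous_U m) i j =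
        ∑ k, S i k • repCoef (symBasis.continuous_U m) k 0 := by
      ext g
      have h2 := congrFun (congrFun (hS g) i) 0
      rw [Matrix.mul_apply, Matrix.mul_apply] at h2
      rw [ContinuousMap.sum_apply, ContinuousMap.sum_apply]
      refine Eq.trans (Finset.sum_congr rfl fun j _ => ?_) h2
      rw [ContinuousMap.smul_apply, repCoef_apply, smul_eq_mul, mul_comm]
    have h3 : ∑ k, S i k • colBasis m k = ∑ j, S j 0 • B.e ⟨m, (i, j)⟩ := by
      have h4 := congrArg (fun f => (Real.sqrt (m + 1) : ℂ) • toL2 f) h1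
      simp only [map_sum, map_smul, Finset.smul_sum] at h4
      simp only [colBasis, PeterWeylBasis.e_eq_toL2]
      simp only [smul_comm (Real.sqrt (m + 1) : ℂ)] at h4
      exact h4.symm
    have h5 := congrArg (r • ·) h3
    simpa only [Finset.smul_sum, smul_smul, Matrix.smul_apply, smul_eq_mul] using h5
  refine ⟨r • S, fun j => r * S j 0, heq, ?_⟩
  have hfun : (fun i => ∑ k, (r • S) i k • colBasis m k) =
      fun i => ∑ j, (r * S j 0) • B.e ⟨m, (i, j)⟩ := funext heq
  rw [hfun, orthonormal_iff_ite]
  intro i i'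
  by_cases h : i = i'
  · subst h
    have hort : Orthonormal ℂ fun j => B.e ⟨m, (i, j)⟩ :=
      B.e.orthonormal.comp (fun j : Fin (m + 1) =>
        (⟨m, (i, j)⟩ : Σ m : ℕ, Fin (m + 1) × Fin (m + 1))) fun j j' h => by simpa using h
    rw [if_pos rfl, hort.inner_sum]
    have h7 : ∀ x, starRingEnd ℂ (r * S x 0) * (r * S x 0) =
        r ^ 2 * ((‖S x 0‖ ^ 2 : ℝ) : ℂ) := by
      intro x
      have : starRingEnd ℂ r = r := by rw [hrdef, map_inv₀, Complex.conj_ofReal]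
      rw [map_mul, this, Complex.ofReal_pow, ← Complex.mul_conj']
      ring
    rw [Finset.sum_congr rfl fun x _ => h7 x, ← Finset.mul_sum, ← Complex.ofReal_sum, ← hN, hrdef,
      inv_pow, ← Complex.ofReal_pow, Real.sq_sqrt hN0.le]
    exact inv_mul_cancel₀ (Complex.ofReal_ne_zero.mpr hN0.ne')
  · rw [if_neg h, sum_inner]
    refine Finset.sum_eq_zero fun j _ => ?_
    rw [inner_sum]
    refine Finset.sum_eq_zero fun j' _ => ?_
    rw [inner_smul_left, inner_smul_right, B.e.inner_eq_ite, if_neg (by simp [h])]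
    simp

/-- `M` has orthonormal rows and is square, hence unitary. -/
theorem sum_norm_inner_orthonormal {m : ℕ} {M : Matrix (Fin (m + 1)) (Fin (m + 1)) ℂ}
    (hM : Orthonormal ℂ fun i => ∑ k, M i k • colBasis m k) (x : Fin (m + 1) → ℂ) :
    ∑ i, ‖∑ k, starRingEnd ℂ (M i k) * x k‖ ^ 2 = ∑ k, ‖x k‖ ^ 2 := by
  have h1 : M * star M = 1 := by
    ext i i'
    have := orthonormal_iff_ite.mp hM i' i
    rw [(orthonormal_colBasis m).inner_sum] at this
    rw [Matrix.mul_apply, Matrix.one_apply, ← if_congr (eq_comm (a := i') (b := i)) rfl rfl, ← this]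
    exact Finset.sum_congr rfl fun k _ => mul_comm _ _
  have h2 : star M * M = 1 := mul_eq_one_comm.mp h1
  have h3 : ((∑ i, ‖∑ k, starRingEnd ℂ (M i k) * x k‖ ^ 2 : ℝ) : ℂ) =
      ((∑ k, ‖x k‖ ^ 2 : ℝ) : ℂ) := by
    push_cast
    simp only [← Complex.mul_conj', map_sum, map_mul, Complex.conj_conj, Finset.sum_mul_sum]
    rw [Finset.sum_comm]
    refine Finset.sum_congr rfl fun k _ => ?_
    rw [Finset.sum_comm]
    have h4 : ∀ l, ∑ i, starRingEnd ℂ (M i k) * x k * (M i l * starRingEnd ℂ (x l)) =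
        if k = l then x k * starRingEnd ℂ (x l) else 0 := by
      intro l
      have h5 := congrFun (congrFun h2 k) l
      rw [Matrix.mul_apply, Matrix.one_apply] at h5
      have h6 : ∑ i, starRingEnd ℂ (M i k) * x k * (M i l * starRingEnd ℂ (x l)) =
          (∑ i, star M k i * M i l) * (x k * starRingEnd ℂ (x l)) := by
        rw [Finset.sum_mul]
        refine Finset.sum_congr rfl fun i _ => ?_
        rw [Matrix.star_apply, Complex.star_def]
        ring
      rw [h6, h5]
      split_ifs <;> simp
    simp [h4]
  exact_mod_cast h3

/-- If all eigenvalues at level `m` were farther than `K` from one at level `m + 1`, the bounds for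
`α` and `β` would add up to `K ^ 2 / 2 ≤ C1 ^ 2 + C2 ^ 2`. -/
theorem PeterWeylBasis.IsDiagonal.exists_abs_sub_le {B : PeterWeylBasis}
    {D : L2 SU2 →ₗ.[ℂ] L2 SU2} {d : ∀ m : ℕ, Fin (m + 1) → ℝ} (hd : B.IsDiagonal D d)
    (hD : IsSelfAdjoint D) (hα : HasBoundedCommutator D (mulRep SU2 (entry 0 0)))
    (hβ : HasBoundedCommutator D (mulRep SU2 (entry 1 0))) :
    ∃ K : ℝ, 0 < K ∧ ∀ (m : ℕ) (i : Fin (m + 2)), ∃ k : Fin (m + 1), |d (m + 1) i - d m k| ≤ K := by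
  obtain ⟨h1, C1, hC1⟩ := hα
  obtain ⟨h2, C2, hC2⟩ := hβ
  -- Any constant with half its square above `C1 ^ 2 + C2 ^ 2` would do; the summand 1 makes it
  -- positive even when both bounds vanish.
  refine ⟨2 * (|C1| + |C2|) + 1, by positivity, fun m i => ?_⟩
  by_contra! hcon
  obtain ⟨M, v, hMv, hM⟩ := B.exists_columnBasis m
  obtain ⟨M', v', hMv', hM'⟩ := B.exists_columnBasis (m + 1)
  have hgraph : ∀ (m : ℕ) (i : Fin (m + 1)) (v : Fin (m + 1) → ℂ),
      (∑ j, v j • B.e ⟨m, (i, j)⟩, (d m i : ℂ) • ∑ j, v j • B.e ⟨m, (i, j)⟩) ∈ D.graph := by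
    intro m i v
    have h3 : ∑ j, v j • (B.e ⟨m, (i, j)⟩, (d m i : ℂ) • B.e ⟨m, (i, j)⟩) ∈ D.graph := by
      refine sum_mem fun j _ => D.graph.smul_mem _ ?_
      obtain ⟨h, h'⟩ := hd m i j
      exact (LinearPMap.mem_graph_iff _).mpr ⟨⟨_, h⟩, rfl, h'⟩
    convert h3 using 1
    refine Prod.ext ?_ ?_
    · simp only [Prod.fst_sum, Prod.smul_fst]
    · simp only [Prod.snd_sum, Prod.smul_snd, Finset.smul_sum]
      exact Finset.sum_congr rfl fun j _ => smul_comm _ _ _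
  have hg : ∀ k, (∑ l, M k l • colBasis m l, (d m k : ℂ) • ∑ l, M k l • colBasis m l) ∈ D.graph :=
    fun k => by rw [hMv]; exact hgraph m k v
  have hf : (∑ l, M' i l • colBasis (m + 1) l,
      (d (m + 1) i : ℂ) • ∑ l, M' i l • colBasis (m + 1) l) ∈ D.graph := by
    rw [hMv']; exact hgraph (m + 1) i v'
  set f := ∑ l, M' i l • colBasis (m + 1) l with hfdef
  have hf1 : ‖f‖ = 1 := hM'.1 i
  have hs1 := HasBoundedCommutator.sum_sq_le hD hC1 hM hg hf1 hf
  have hs2 := HasBoundedCommutator.sum_sq_le hD hC2 hM hg hf1 hf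
  -- The sum of squares is the same over the eigenvectors and over the normalized monomials, so
  -- `sum_inner_alpha_beta` applies to the eigenvectors.
  have hinner : ∀ S : L2 SU2 →L[ℂ] L2 SU2, ∑ k, ‖⟪S (∑ l, M k l • colBasis m l), f⟫_ℂ‖ ^ 2 =
      ∑ k, ‖⟪S (colBasis m k), f⟫_ℂ‖ ^ 2 := by
    intro S
    rw [← sum_norm_inner_orthonormal hM (fun k => ⟪S (colBasis m k), f⟫_ℂ)]
    refine Finset.sum_congr rfl fun k _ => ?_
    rw [map_sum, sum_inner]
    simp only [map_smul, inner_smul_left]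
  have htot := sum_inner_alpha_beta (m := m) (M' i)
  rw [← hfdef, ← norm_sum_colBasis_sq, ← hfdef, hf1, one_pow, mul_one, Finset.sum_add_distrib,
    ← hinner, ← hinner] at htot
  have hle : ∀ (S : L2 SU2 →L[ℂ] L2 SU2) (k : Fin (m + 1)),
      (2 * (|C1| + |C2|) + 1) ^ 2 * ‖⟪S (∑ l, M k l • colBasis m l), f⟫_ℂ‖ ^ 2 ≤
        (d (m + 1) i - d m k) ^ 2 * ‖⟪S (∑ l, M k l • colBasis m l), f⟫_ℂ‖ ^ 2 := by
    intro S k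
    refine mul_le_mul_of_nonneg_right ?_ (by positivity)
    rw [← sq_abs (d (m + 1) i - d m k)]
    exact pow_le_pow_left₀ (by positivity) (hcon k).le 2
  have h5 := (Finset.sum_le_sum fun k _ => hle (mulRep SU2 (entry 0 0)) k).trans hs1
  have h6 := (Finset.sum_le_sum fun k _ => hle (mulRep SU2 (entry 1 0)) k).trans hs2
  rw [← Finset.mul_sum] at h5 h6
  have h7 : (1 : ℝ) / 2 ≤ (m + 1) / (m + 2) := by
    rw [div_le_div_iff₀ (by norm_num) (by positivity)]
    have : (0 : ℝ) ≤ m := Nat.cast_nonneg m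
    linarith
  rw [← htot] at h7
  have h8 := mul_le_mul_of_nonneg_left h7 (sq_nonneg (2 * (|C1| + |C2|) + 1))
  nlinarith [abs_nonneg C1, abs_nonneg C2, sq_abs C1, sq_abs C2,
    mul_nonneg (abs_nonneg C1) (abs_nonneg C2)]

/-- The eigenvalues of an operator with bounded commutators grow at most linearly. -/
theorem PeterWeylBasis.IsDiagonal.exists_linear_bound {B : PeterWeylBasis}
    {D : L2 SU2 →ₗ.[ℂ] L2 SU2} {d : ∀ m : ℕ, Fin (m + 1) → ℝ} (hd : B.IsDiagonal D d)
    (hD : IsSelfAdjoint D) (hα : HasBoundedCommutator D (mulRep SU2 (entry 0 0)))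
    (hβ : HasBoundedCommutator D (mulRep SU2 (entry 1 0))) :
    ∃ C : ℝ, 0 < C ∧ ∀ m : ℕ, 0 < m → ∀ i : Fin (m + 1), |d m i| ≤ 2 * C * ((m : ℝ) / 2) := by
  obtain ⟨K, hK, h⟩ := hd.exists_abs_sub_le hD hα hβ
  have h1 : ∀ (m : ℕ) (i : Fin (m + 1)), |d m i| ≤ |d 0 0| + K * m := by
    intro m
    induction m with
    | zero =>
      intro i
      obtain rfl : i = 0 := Fin.ext (by omega)
      simp
    | succ m ih =>
      intro i
      obtain ⟨k, hk⟩ := h m i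
      have h2 := abs_sub_abs_le_abs_sub (d (m + 1) i) (d m k)
      have h3 := ih k
      push_cast
      linarith
  refine ⟨|d 0 0| + K, by positivity, fun m hm i => ?_⟩
  have hm1 : (1 : ℝ) ≤ m := by exact_mod_cast hm
  have h2 := h1 m i
  nlinarith [abs_nonneg (d 0 0)]

end EigenvalueGrowth

/-! ### The critical exponent. -/

section Summability

theorem summable_sigma_square_iff {f : ℕ → ℝ} (hf : ∀ m, 0 ≤ f m) :
    (Summable fun p : Σ m : ℕ, Fin (m + 1) × Fin (m + 1) => f p.1) ↔
      Summable fun m : ℕ => ((m : ℝ) + 1) ^ 2 * f m := by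
  rw [summable_sigma_of_nonneg fun p => hf p.1]
  have h : ∀ m : ℕ, ∑' _ : Fin (m + 1) × Fin (m + 1), f m = ((m : ℝ) + 1) ^ 2 * f m := by
    intro m
    rw [tsum_fintype, Finset.sum_const, Finset.card_univ, Fintype.card_prod, Fintype.card_fin,
      nsmul_eq_mul]
    push_cast
    ring
  simp only [h]
  exact and_iff_right fun m => (hasSum_fintype _).summable

/-- Level `m` contributes `(m + 1) ^ (2 - p)`; at `p = 3` this is the harmonic series, so the
critical exponent itself is excluded. -/
theorem summable_sigma_rpow_iff {p : ℝ} :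
    (Summable fun q : Σ m : ℕ, Fin (m + 1) × Fin (m + 1) => ((q.1 : ℝ) + 1) ^ (-p)) ↔ 3 < p := by
  rw [summable_sigma_square_iff (f := fun m => ((m : ℝ) + 1) ^ (-p)) fun m => by positivity]
  have h : ∀ m : ℕ, ((m : ℝ) + 1) ^ 2 * ((m : ℝ) + 1) ^ (-p) = ((m + 1 : ℕ) : ℝ) ^ (2 - p) := by
    intro m
    rw [← Real.rpow_natCast, ← Real.rpow_add (by positivity)]
    push_cast
    rfl
  simp only [h]
  rw [summable_nat_add_iff (f := fun m : ℕ => (m : ℝ) ^ (2 - p)) 1, Real.summable_nat_rpow]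
  constructor <;> intro h <;> linarith

/-- An eigenvalue sequence of at most linear growth is not summable below the critical exponent. -/
theorem not_summable_of_linear_growth {d : (Σ m : ℕ, Fin (m + 1) × Fin (m + 1)) → ℝ} {K : ℝ}
    (hd : ∀ q, |d q| ≤ K * ((q.1 : ℝ) + 1)) {p : ℝ} (hp : 0 < p) (hp3 : p ≤ 3) :
    ¬ Summable fun q => (1 + d q ^ 2) ^ (-(p / 2)) := by
  intro hs
  have hK : 0 < 1 + K ^ 2 := by positivity
  have h : Summable fun q : Σ m : ℕ, Fin (m + 1) × Fin (m + 1) =>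
      (1 + K ^ 2) ^ (-(p / 2)) * ((q.1 : ℝ) + 1) ^ (-p) := by
    refine hs.of_nonneg_of_le (fun q => by positivity) fun q => ?_
    have hq : (0 : ℝ) ≤ q.1 := Nat.cast_nonneg _
    have h1 : ((q.1 : ℝ) + 1) ^ (-p) = (((q.1 : ℝ) + 1) ^ 2) ^ (-(p / 2)) := by
      rw [← Real.rpow_natCast, ← Real.rpow_mul (by positivity)]
      congr 1
      push_cast
      ring
    rw [h1, ← Real.mul_rpow hK.le (by positivity)]
    refine Real.rpow_le_rpow_of_nonpos (by positivity) ?_ (by linarith)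
    have h2 : d q ^ 2 ≤ (K * ((q.1 : ℝ) + 1)) ^ 2 := by
      rw [← sq_abs (d q)]
      exact pow_le_pow_left₀ (abs_nonneg _) (hd q) 2
    nlinarith
  rw [summable_mul_left_iff (by positivity)] at h
  exact absurd (summable_sigma_rpow_iff.mp h) (by linarith)

theorem summable_half_spectrum {p : ℝ} (hp : 3 < p) :
    Summable fun q : Σ m : ℕ, Fin (m + 1) × Fin (m + 1) =>
      (1 + ((q.1 : ℝ) / 2) ^ 2) ^ (-(p / 2)) := by
  -- From `1 + m ^ 2 / 4 ≥ (m + 1) ^ 2 / 8`, which amounts to `(m - 1) ^ 2 + 6 ≥ 0`.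
  have h := (summable_sigma_rpow_iff.mpr hp).mul_left ((1 / 8 : ℝ) ^ (-(p / 2)))
  refine h.of_nonneg_of_le (fun q => by positivity) fun q => ?_
  have h1 : ((q.1 : ℝ) + 1) ^ (-p) = (((q.1 : ℝ) + 1) ^ 2) ^ (-(p / 2)) := by
    rw [← Real.rpow_natCast, ← Real.rpow_mul (by positivity)]
    congr 1
    push_cast
    ring
  rw [h1, ← Real.mul_rpow (by norm_num) (by positivity)]
  refine Real.rpow_le_rpow_of_nonpos (by positivity) ?_ (by linarith)
  nlinarith [sq_nonneg ((q.1 : ℝ) - 1)]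

end Summability

/-! ### The spectral triple given by half the level. -/

section StandardTriple

/-- An operator which moves the grading by exactly one step has a bounded commutator with half the
grading operator. -/
theorem IsDiagonalIn.hasBoundedCommutator_of_grading {H ι : Type*} [NormedAddCommGroup H]
    [InnerProductSpace ℂ H] [CompleteSpace H] {D : H →ₗ.[ℂ] H} {e : HilbertBasis ι ℂ H} {N : ι → ℕ}
    (h : IsDiagonalIn D e fun i => (N i : ℝ) / 2) (hD : IsSelfAdjoint D) {S : H →L[ℂ] H}
    (hS : ∀ i j, N i ≠ N j + 1 → N i + 1 ≠ N j → ⟪e i, S (e j)⟫_ℂ = 0) :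
    HasBoundedCommutator D S := by
  have h1 : ∀ i, ‖Complex.I ^ N i‖ ≤ 1 := fun i => by simp
  have h2 : ∀ i, ‖(-Complex.I) ^ N i‖ ≤ 1 := fun i => by simp
  set w := diagOp e _ _ h1 with hw
  set w' := diagOp e _ _ h2 with hw'
  have hI : ∀ n : ℕ, Complex.I ^ n * (-Complex.I) ^ n = 1 := fun n => by
    rw [← mul_pow]; simp
  -- With `w = i ^ N`, this `K` multiplies the entry at level difference `k` by `sin (π k / 2) / 2`,
  -- which equals the required `k / 2` for `k = 1` and `k = -1`.
  refine h.hasBoundedCommutator hD (K := (4 * Complex.I)⁻¹ • (w * S * w' - w' * S * w)) ?_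
  intro i j
  have hK : ⟪e i, ((4 * Complex.I)⁻¹ • (w * S * w' - w' * S * w)) (e j)⟫_ℂ =
      (4 * Complex.I)⁻¹ * (Complex.I ^ N i * (-Complex.I) ^ N j -
        (-Complex.I) ^ N i * Complex.I ^ N j) * ⟪e i, S (e j)⟫_ℂ := by
    rw [smul_apply, sub_apply, inner_smul_right, inner_sub_right]
    change _ * (⟪e i, w (S (w' (e j)))⟫_ℂ - ⟪e i, w' (S (w (e j)))⟫_ℂ) = _
    rw [hw, hw', inner_diagOp, inner_diagOp, diagOp_basis, diagOp_basis, map_smul, map_smul,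
      inner_smul_right, inner_smul_right]
    ring
  rw [hK]
  have hI0 := Complex.I_ne_zero
  by_cases hij : N i = N j + 1
  · congr 1
    have h3 : Complex.I ^ (N j + 1) * (-Complex.I) ^ N j -
        (-Complex.I) ^ (N j + 1) * Complex.I ^ N j = 2 * Complex.I := by
      linear_combination (2 * Complex.I) * hI (N j)
    rw [hij, h3]
    push_cast
    field_simp
    ring
  by_cases hji : N i + 1 = N j
  · congr 1
    have h3 : Complex.I ^ N i * (-Complex.I) ^ (N i + 1) -
        (-Complex.I) ^ N i * Complex.I ^ (N i + 1) = -(2 * Complex.I) := by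
      linear_combination -(2 * Complex.I) * hI (N i)
    rw [← hji, h3]
    push_cast
    field_simp
    ring
  · rw [hS i j hij hji, mul_zero, mul_zero]

theorem inner_toL2_coefSpan_of_ne {m k : ℕ} (hmk : m ≠ k) {f f' : C(SU2, ℂ)} (hf : f ∈ coefSpan m)
    (hf' : f' ∈ coefSpan k) : ⟪toL2 f, toL2 f'⟫_ℂ = 0 := by
  unfold coefSpan at hf hf'
  induction hf using Submodule.span_induction with
  | zero => simp
  | add x y _ _ hx hy => rw [map_add, inner_add_left, hx, hy, add_zero]
  | smul c x _ hx => rw [map_smul, inner_smul_left, hx, mul_zero]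
  | mem x hx =>
    obtain ⟨p, rfl⟩ := hx
    induction hf' using Submodule.span_induction with
    | zero => simp
    | add x y _ _ hx hy => rw [map_add, inner_add_right, hx, hy, add_zero]
    | smul c x _ hx => rw [map_smul, inner_smul_right, hx, mul_zero]
    | mem x hx =>
      obtain ⟨q, rfl⟩ := hx
      exact inner_toL2_repCoef_of_ne _ _ (isIrreducible_symRep k) (isIrreducible_symRep m)
        (by omega) _ _ _ _

theorem inner_toL2_neighbourSpan {m k : ℕ} (h1 : m ≠ k + 1) (h2 : m + 1 ≠ k) {f f' : C(SU2, ℂ)}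
    (hf : f ∈ coefSpan m) (hf' : f' ∈ neighbourSpan k) : ⟪toL2 f, toL2 f'⟫_ℂ = 0 := by
  have h : neighbourSpan k ≤ LinearMap.ker ((innerSL ℂ (toL2 f)) ∘L toL2).toLinearMap :=
    iSup₂_le fun l hl x hx => inner_toL2_coefSpan_of_ne (by omega) hf hx
  exact h hf'

theorem symBasis_e (q : Σ m : ℕ, Fin (m + 1) × Fin (m + 1)) :
    ∃ f ∈ coefSpan q.1, symBasis.e q = toL2 f := by
  obtain ⟨m, i, j⟩ := q
  refine ⟨(Real.sqrt (m + 1) : ℂ) • repCoef (continuous_symRep m) i j,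
    Submodule.smul_mem _ _ (repCoef_mem_coefSpan i j), ?_⟩
  rw [PeterWeylBasis.e_eq_toL2, map_smul]
  rfl

/-- The operator `e^{(n)}_{ij} ↦ n e^{(n)}_{ij}`. -/
def halfDegreeOp : L2 SU2 →ₗ.[ℂ] L2 SU2 := diagPMap symBasis.e fun q => (q.1 : ℝ) / 2

theorem isDiagonalIn_halfDegreeOp :
    IsDiagonalIn halfDegreeOp symBasis.e fun q => (q.1 : ℝ) / 2 :=
  isDiagonalIn_diagPMap _ _

theorem isSelfAdjoint_halfDegreeOp : IsSelfAdjoint halfDegreeOp := isSelfAdjoint_diagPMap _ _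

theorem hasBoundedCommutator_halfDegreeOp_entry (r s : Fin 2) :
    HasBoundedCommutator halfDegreeOp (mulRep SU2 (entry r s)) := by
  refine IsDiagonalIn.hasBoundedCommutator_of_grading (e := symBasis.e) (N := Sigma.fst)
    isDiagonalIn_halfDegreeOp isSelfAdjoint_halfDegreeOp fun q q' h1 h2 => ?_
  obtain ⟨f, hf, hq⟩ := symBasis_e q
  obtain ⟨f', hf', hq'⟩ := symBasis_e q'
  rw [hq, hq']
  refine (congrArg (fun x => ⟪toL2 f, x⟫_ℂ) (mulRep_toL2 (entry r s) f')).trans ?_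
  exact inner_toL2_neighbourSpan h1 h2 hf (entry_mul_mem_neighbourSpan r s hf')

theorem hasBoundedCommutator_halfDegreeOp {a : C(SU2, ℂ)} (ha : a ∈ entryAlgebra) :
    HasBoundedCommutator halfDegreeOp (mulRep SU2 a) := by
  unfold entryAlgebra at ha
  have ha' : a ∈ (StarAlgebra.adjoin ℂ
    (Set.range fun p : Fin 2 × Fin 2 => entry p.1 p.2)).toSubalgebra := ha
  -- Adjoining the adjoints of the generators as well makes the star step unnecessary: the adjoint
  -- of an entry is a multiple of an entry.
  rw [StarAlgebra.adjoin_toSubalgebra] at ha'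
  clear ha
  induction ha' using Algebra.adjoin_induction with
  | mem x hx =>
    rcases hx with ⟨p, rfl⟩ | ⟨p, hp⟩
    · exact hasBoundedCommutator_halfDegreeOp_entry _ _
    · obtain ⟨c, r, s, h⟩ := star_entry p.1 p.2
      have hx : x = c • entry r s := by
        rw [← h]
        exact (star_eq_iff_star_eq.mp hp.symm).symm
      rw [hx, map_smul]
      exact (hasBoundedCommutator_halfDegreeOp_entry _ _).smul c
  | algebraMap c =>
    rw [Algebra.algebraMap_eq_smul_one, map_smul, map_one]
    exact (HasBoundedCommutator.one _).smul c
  | add x y _ _ hx hy => rw [map_add]; exact hx.add hy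
  | mul x y _ _ hx hy => rw [map_mul]; exact hx.mul hy

/-- Translations preserve the level, so the entrywise criterion holds with commutator `K = 0`. -/
theorem commutesWithUnitary_halfDegreeOp (g : SU2) :
    CommutesWithUnitary halfDegreeOp (rightRegularRep SU2 g) := by
  have key : ∀ q q', (((((q.1 : ℝ) / 2 : ℝ)) : ℂ) - (((q'.1 : ℝ) / 2 : ℝ) : ℂ)) *
      ⟪symBasis.e q, (rightRegularRep SU2 g).toContinuousLinearEquiv.toContinuousLinearMap
        (symBasis.e q')⟫_ℂ = ⟪symBasis.e q, (0 : L2 SU2 →L[ℂ] L2 SU2) (symBasis.e q')⟫_ℂ := by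
    classical
    intro q q'
    rw [zero_apply, inner_zero_right]
    by_cases h : q.1 = q'.1
    · rw [h, sub_self, zero_mul]
    · obtain ⟨m', i', j'⟩ := q'
      change _ * ⟪symBasis.e q, rightRegularRep SU2 g (symBasis.e ⟨m', (i', j')⟩)⟫_ℂ = 0
      rw [PeterWeylBasis.rightRegularRep_e, inner_sum, Finset.sum_eq_zero, mul_zero]
      intro k _
      rw [inner_smul_right, symBasis.e.inner_eq_ite, if_neg, mul_zero]
      rintro rfl
      exact h rfl
  have h := isDiagonalIn_halfDegreeOp.commutator_of_inner isSelfAdjoint_halfDegreeOp key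
  refine ⟨fun x => (h x).1, fun x => ?_⟩
  refine (h x).2.trans ?_
  rw [zero_apply, add_zero]
  rfl

theorem hasCompactResolvent_halfDegreeOp : HasCompactResolvent halfDegreeOp := by
  refine isDiagonalIn_halfDegreeOp.hasCompactResolvent isSelfAdjoint_halfDegreeOp ?_
  rw [Filter.tendsto_atTop]
  intro b
  rw [Filter.eventually_cofinite]
  obtain ⟨N, hN⟩ := exists_nat_ge (2 * b)
  have hfin := ((Finset.range N).sigma fun m =>
    (Finset.univ : Finset (Fin (m + 1) × Fin (m + 1)))).finite_toSet
  refine hfin.subset fun q hq => ?_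
  rw [Finset.mem_coe, Finset.mem_sigma]
  refine ⟨Finset.mem_range.mpr ?_, Finset.mem_univ _⟩
  rw [Set.mem_ofPred_eq, not_le, abs_of_nonneg (by positivity)] at hq
  have : (q.1 : ℝ) < N := by linarith
  exact_mod_cast this

theorem isEquivariantSpectralTriple_halfDegreeOp :
    (haarGNS SU2).IsEquivariantSpectralTriple halfDegreeOp :=
  ⟨⟨isSelfAdjoint_halfDegreeOp, hasCompactResolvent_halfDegreeOp, fun a =>
    hasBoundedCommutator_halfDegreeOp (mem_entryAlgebra_of_mem_core a.2)⟩,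
    commutesWithUnitary_halfDegreeOp⟩

theorem isPSummable_halfDegreeOp {p : ℝ} (hp : 3 < p) : IsPSummable halfDegreeOp p :=
  (isPSummable_iff isDiagonalIn_halfDegreeOp isSelfAdjoint_halfDegreeOp (by linarith)).mpr
    (summable_half_spectrum hp)

end StandardTriple

/-! ### The spectral dimension. -/

section SpectralDimension

theorem PeterWeylBasis.IsDiagonal.isDiagonalIn {B : PeterWeylBasis} {D : L2 SU2 →ₗ.[ℂ] L2 SU2}
    {d : ∀ m : ℕ, Fin (m + 1) → ℝ} (hd : B.IsDiagonal D d) :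
    IsDiagonalIn D B.e fun q => d q.1 q.2.1 :=
  fun q => hd q.1 q.2.1 q.2.2

theorem not_isPSummable_of_hasBoundedCommutator {D : L2 SU2 →ₗ.[ℂ] L2 SU2} (hD : IsSelfAdjoint D)
    (heq : (haarGNS SU2).IsEquivariant D) (hα : HasBoundedCommutator D (mulRep SU2 (entry 0 0)))
    (hβ : HasBoundedCommutator D (mulRep SU2 (entry 1 0))) {p : ℝ} (hp : 0 < p) (hp3 : p ≤ 3) :
    ¬ IsPSummable D p := by
  obtain ⟨B, d, hd⟩ := hD.exists_isDiagonal heq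
  obtain ⟨C, hC, hdC⟩ := hd.exists_linear_bound hD hα hβ
  rw [isPSummable_iff hd.isDiagonalIn hD hp]
  -- The linear bound says nothing at level 0, so `|d 0 0|` is added to the constant.
  refine not_summable_of_linear_growth (K := C + |d 0 0|) (fun q => ?_) hp hp3
  obtain ⟨m, i, j⟩ := q
  simp only
  rcases Nat.eq_zero_or_pos m with rfl | hm
  · obtain rfl : i = 0 := Fin.ext (by omega)
    simp [hC.le]
  · have h1 := hdC m hm i
    have hm0 : (0 : ℝ) ≤ m := Nat.cast_nonneg m
    nlinarith [mul_nonneg (abs_nonneg (d 0 0)) hm0, abs_nonneg (d 0 0)]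

/-- The standard triple is summable at `3 + ε` for every `ε > 0`; conversely the core contains `α`
and `β`, so the growth bound applies to every competing triple. -/
theorem spectralDimension_SU2 : (haarGNS SU2).spectralDimension = 3 := by
  refine le_antisymm ?_ ?_
  · refine ENNReal.le_of_forall_pos_le_add fun ε hε _ => ?_
    have hε' : (0 : ℝ) < ε := hε
    refine (iInf₂_le (3 + (ε : ℝ)) ⟨by positivity, halfDegreeOp,
      isEquivariantSpectralTriple_halfDegreeOp, isPSummable_halfDegreeOp (by linarith)⟩).trans ?_
    rw [ENNReal.ofReal_add (by norm_num) hε'.le, ENNReal.ofReal_coe_nnreal]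
    simp
  · refine le_iInf₂ fun p hp => ?_
    obtain ⟨hp0, D, ⟨hD, heq⟩, hsum⟩ := hp
    have hp3 : 3 ≤ p := by
      by_contra! hlt
      exact not_isPSummable_of_hasBoundedCommutator hD.selfAdjoint heq
        (hD.boundedCommutator ⟨_, entry_mem_core 0 0⟩)
        (hD.boundedCommutator ⟨_, entry_mem_core 1 0⟩) hp0 hlt.le hsum
    rw [← ENNReal.ofReal_ofNat]
    exact ENNReal.ofReal_le_ofReal hp3

end SpectralDimension
end

theorem mainTheorem3 :
    -- (1) equivariant self-adjoint operators are diagonal, with eigenvalues `d(n, i)`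
    (∀ D : L2 SU2 →ₗ.[ℂ] L2 SU2, IsSelfAdjoint D → (haarGNS SU2).IsEquivariant D →
      ∃ (B : PeterWeylBasis) (d : ∀ m : ℕ, Fin (m + 1) → ℝ), B.IsDiagonal D d) ∧
    -- (2) bounded commutators with `α`, `β` force `|d(n, i)| ≤ 2 C n` for `n = m / 2 > 0`
    (∀ (D : L2 SU2 →ₗ.[ℂ] L2 SU2) (B : PeterWeylBasis) (d : ∀ m : ℕ, Fin (m + 1) → ℝ),
      IsSelfAdjoint D → B.IsDiagonal D d →
      HasBoundedCommutator D ((haarGNS SU2).π entryAlpha) →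
      HasBoundedCommutator D ((haarGNS SU2).π entryBeta) →
      ∃ C : ℝ, 0 < C ∧ ∀ m : ℕ, 0 < m → ∀ i : Fin (m + 1), |d m i| ≤ 2 * C * ((m : ℝ) / 2)) ∧
    -- (3) no such operator is `p`-summable for `p ≤ 3`
    (∀ D : L2 SU2 →ₗ.[ℂ] L2 SU2, IsSelfAdjoint D → (haarGNS SU2).IsEquivariant D →
      HasBoundedCommutator D ((haarGNS SU2).π entryAlpha) →
      HasBoundedCommutator D ((haarGNS SU2).π entryBeta) →
      ∀ p : ℝ, 0 < p → p ≤ 3 → ¬ IsPSummable D p) ∧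
    -- (4) `d(n, i) = n` gives an equivariant spectral triple that is `p`-summable for all `p > 3`
    (∃ (D : L2 SU2 →ₗ.[ℂ] L2 SU2) (B : PeterWeylBasis),
      (haarGNS SU2).IsEquivariantSpectralTriple D ∧ B.IsDiagonal D (fun m _ => (m : ℝ) / 2) ∧
      ∀ p : ℝ, 3 < p → IsPSummable D p) ∧
    -- (5) the spectral dimension of `SU(2)` is `3`
    (haarGNS SU2).spectralDimension = 3 := by
  exact ⟨fun D hD heq => hD.exists_isDiagonal heq,
    fun D B d hD hd hα hβ => hd.exists_linear_bound hD hα hβ,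
    fun D hD heq hα hβ p hp hp3 => not_isPSummable_of_hasBoundedCommutator hD heq hα hβ hp hp3,
    ⟨halfDegreeOp, symBasis, isEquivariantSpectralTriple_halfDegreeOp,
      fun m i j => isDiagonalIn_halfDegreeOp ⟨m, (i, j)⟩, fun p hp => isPSummable_halfDegreeOp hp⟩,
    spectralDimension_SU2⟩
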